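/- Let $B=B(r,\xi)\ge 0$, defined for $r\ge 0$, $\xi\in[-1,1]$, be a measurable collision kernel satisfying: (H1) there is a non-increasing $\varphi\in L^1([0,\infty))$ with $B(r,\cos\theta)\le \varphi(r)\,r$, and $\|(1+r^{-1})B(r,\cos\theta)\|_{L^\infty_{r,\theta}}<\infty$; (H2) there is $R_0>0$ with $B(r,\cos\theta)=0$ for $r\le R_0$, and there is $\delta>0$ independent of $r$ with $\delta\sup_{\theta\in[0,\pi]}B(r,\cos\theta)\le 2\pi\int_0^\pi B(r,\cos\theta)\sin\theta\,d\theta$ for all $r$. Let $$Q(g,f)(v)=\int_{\mathbb R^3}\int_{\mathbb S^2}B\Big(|v-v_*|,\tfrac{v-v_*}{|v-v_*|}\cdot\sigma\Big)\,[g(v_*')f(v')-g(v_*)f(v)]\,d\sigma\,dv_*,$$ $$v'=\tfrac{v+v_*}{2}+\tfrac{|v-v_*|}{2}\sigma,\qquad v_*'=\tfrac{v+v_*}{2}-\tfrac{|v-v_*|}{2}\sigma,$$ let $S_qg(x,v)=g(x-qv_1,v)$ for $(x,v)\in\mathbb R\times\mathbb R^3$, and set $\|g\|_X=\sup_{q\ge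 0}\|S_qg\|_{L^\infty_x(\mathbb R,L^1_v(\mathbb R^3))}$. Let $f$ be a mild solution of the Boltzmann equation $\partial_tf+v_1\partial_xf=Q(f,f)$ on $[0,\infty)\times\mathbb R\times\mathbb R^3$ with initial datum $f_{\mathrm{in}}\ge 0$, that is, for every $t\ge 0$ and almost every $(x,v)$, $$f(t)=S_tf_{\mathrm{in}}+\int_0^tS_{t-s}Q(f,f)(s)\,ds ,$$ where the integrand is integrable in $s\in[0,t]$. Suppose that $$f\in L^\infty([0,\infty),X)\cap C([0,\infty),W^{1,1}(\mathbb R\times\mathbb R^3))\cap C_b([0,\infty),L^1(1+|v|^2)).$$ Then $\|f(t)\|_X\to 0$ as $t\to\infty$. -/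

import Mathlib

open MeasureTheory Filter Topology Set
open scoped ENNReal ContDiff

noncomputable section

namespace Boltzmann1D

/-- Velocity space `ℝ³` with its Euclidean norm; the first component `v₁` is `v 0`. -/
abbrev Vel : Type := EuclideanSpace ℝ (Fin 3)

/-- Phase space `ℝ_x × ℝ³_v`, with Lebesgue measure. -/
abbrev Phase : Type := ℝ × Vel

/-- A collision kernel `B(r, ξ)`, used for `r ≥ 0` and `ξ = cos θ ∈ [-1,1]`:
measurable and non-negative. -/
structure IsCollisionKernel (B : ℝ → ℝ → ℝ) : Prop where
  measurable : Measurable (Function.uncurry B)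
  nonneg : ∀ r, 0 ≤ r → ∀ ξ ∈ Icc (-1 : ℝ) 1, 0 ≤ B r ξ

/-- Hypothesis (H1): `B(r, cos θ) ≤ φ(r) r` for some non-increasing `φ ∈ L¹([0,∞))`, and
`(1 + r⁻¹) B(r, cos θ)` lies in `L^∞` in `(r, θ)`. -/
def HypH1 (B : ℝ → ℝ → ℝ) : Prop :=
  (∃ φ : ℝ → ℝ, AntitoneOn φ (Ioi 0) ∧ IntegrableOn φ (Ioi 0) ∧
    ∀ r, 0 < r → ∀ θ ∈ Icc (0 : ℝ) Real.pi, B r (Real.cos θ) ≤ φ r * r) ∧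
  eLpNorm (fun p : ℝ × ℝ => (1 + p.1⁻¹) * B p.1 (Real.cos p.2)) ⊤
    (volume.restrict (Ioi (0 : ℝ) ×ˢ Icc (0 : ℝ) Real.pi)) < ⊤

/-- Hypothesis (H2): `B(r, cos θ) = 0` for `r ≤ R₀`, for some `R₀ > 0`, and
`δ sup_θ B(r, cos θ) ≤ 2π ∫₀^π B(r, cos θ) sin θ dθ` for some `δ > 0` independent of `r`. -/
def HypH2 (B : ℝ → ℝ → ℝ) : Prop :=
  (∃ R₀ : ℝ, 0 < R₀ ∧ ∀ r, 0 ≤ r → r ≤ R₀ → ∀ θ ∈ Icc (0 : ℝ) Real.pi,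
    B r (Real.cos θ) = 0) ∧
  ∃ δ : ℝ, 0 < δ ∧ ∀ r, 0 ≤ r → ∀ θ ∈ Icc (0 : ℝ) Real.pi,
    δ * B r (Real.cos θ) ≤ 2 * Real.pi * ∫ τ in (0 : ℝ)..Real.pi, B r (Real.cos τ) * Real.sin τ

/-- Post-collisional velocity `v' = (v + v⋆)/2 + σ |v - v⋆|/2`. -/
def postV (v vs σ : Vel) : Vel := (1 / 2 : ℝ) • (v + vs) + (‖v - vs‖ / 2) • σ

/-- Post-collisional velocity `v⋆' = (v + v⋆)/2 - σ |v - v⋆|/2`. -/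
def postVs (v vs σ : Vel) : Vel := (1 / 2 : ℝ) • (v + vs) - (‖v - vs‖ / 2) • σ

/-- The Boltzmann collision operator `Q(g,f)(v)`: an integral over `v⋆ ∈ ℝ³` (Lebesgue measure)
and `σ ∈ S²` (surface measure, of total mass `4π`). -/
def collision (B : ℝ → ℝ → ℝ) (g f : Vel → ℝ) (v : Vel) : ℝ :=
  ∫ p : Vel × Metric.sphere (0 : Vel) 1,
    B ‖v - p.1‖ (inner ℝ (‖v - p.1‖⁻¹ • (v - p.1)) (p.2 : Vel)) *
      (g (postVs v p.1 p.2) * f (postV v p.1 p.2) - g p.1 * f v)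
    ∂((volume : Measure Vel).prod (volume : Measure Vel).toSphere)

/-- `Q(g,f)` acting on functions of `(x,v)`, with `x` as a parameter. -/
def collisionPhase (B : ℝ → ℝ → ℝ) (g f : Phase → ℝ) : Phase → ℝ :=
  fun p => collision B (fun v => g (p.1, v)) (fun v => f (p.1, v)) p.2

/-- The transport semigroup `S_q f(x,v) = f(x - q v₁, v)`. -/
def transport (q : ℝ) (f : Phase → ℝ) : Phase → ℝ :=
  fun p => f (p.1 - q * p.2 0, p.2)

/-- The norm `‖f‖_X = sup_{q ≥ 0} ‖S_q f‖_{L^∞_x L¹_v}`, with values in `[0,∞]`. -/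
def normX (f : Phase → ℝ) : ℝ≥0∞ :=
  ⨆ (q : ℝ) (_ : 0 ≤ q), essSup (fun x : ℝ => ∫⁻ v : Vel, ‖transport q f (x, v)‖ₑ) volume

/-- The norm of `L¹(1+|v|²)`, with values in `[0,∞]`. -/
def normL12 (f : Phase → ℝ) : ℝ≥0∞ :=
  ∫⁻ p : Phase, ‖(1 + ‖p.2‖ ^ 2) * f p‖ₑ

/-- `w` is the weak (distributional) derivative of `g` in the direction `e`. -/
structure HasWeakDeriv (g : Phase → ℝ) (e : Phase) (w : Phase → ℝ) : Prop where
  locallyIntegrable : LocallyIntegrable g volume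
  locallyIntegrable_deriv : LocallyIntegrable w volume
  integral_eq : ∀ ψ : Phase → ℝ, ContDiff ℝ ∞ ψ → HasCompactSupport ψ →
    ∫ p, g p * fderiv ℝ ψ p e = - ∫ p, w p * ψ p

/-- `‖∂_e g‖_{L¹}`, equal to `∞` if `g` has no weak derivative in the direction `e`.
The weak derivative is unique almost everywhere, so the infimum is over a single value. -/
def weakDerivNorm (e : Phase) (g : Phase → ℝ) : ℝ≥0∞ :=
  ⨅ (w : Phase → ℝ) (_ : HasWeakDeriv g e w), ∫⁻ p, ‖w p‖ₑ

/-- The norm of the Sobolev space `W^{1,1}(ℝ × ℝ³)`, with values in `[0,∞]`: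
the sum of the `L¹` norms of `g`, `∂_x g`, `∂_{v₁} g`, `∂_{v₂} g`, `∂_{v₃} g`. -/
def normW11 (g : Phase → ℝ) : ℝ≥0∞ :=
  (∫⁻ p, ‖g p‖ₑ) + weakDerivNorm (1, 0) g +
    ∑ i : Fin 3, weakDerivNorm (0, EuclideanSpace.single i 1) g

/-- `f ∈ C([0,∞), Y)`, where `Y` is the space of measurable functions of finite norm `N`. -/
structure ContinuousIn (N : (Phase → ℝ) → ℝ≥0∞) (f : ℝ → Phase → ℝ) : Prop where
  mem : ∀ t, 0 ≤ t → AEStronglyMeasurable (f t) volume ∧ N (f t) < ⊤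
  tendsto : ∀ t₀, 0 ≤ t₀ → Tendsto (fun t => N (f t - f t₀)) (𝓝[Ici 0] t₀) (𝓝 0)

/-- `f ∈ C_b([0,∞), Y)`: continuous and bounded. -/
structure BoundedContinuousIn (N : (Phase → ℝ) → ℝ≥0∞) (f : ℝ → Phase → ℝ) : Prop
    extends ContinuousIn N f where
  bounded : (⨆ (t : ℝ) (_ : 0 ≤ t), N (f t)) < ⊤

/-- `f ∈ L^∞([0,∞), X)`. -/
def BoundedInX (f : ℝ → Phase → ℝ) : Prop :=
  essSup (fun t => normX (f t)) (volume.restrict (Ici (0 : ℝ))) < ⊤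

/-- `f` is a global mild solution of `∂_t f + v₁ ∂_x f = Q(f,f)` on `ℝ_x × ℝ³_v` with initial
datum `f_in ≥ 0`: for each `t ≥ 0` the Duhamel formula
`f(t) = S_t f_in + ∫₀ᵗ S_{t-s} Q(f,f)(s) ds` holds for almost every `(x,v)`, the integrand being
integrable in `s`. -/
structure IsMildSolution (B : ℝ → ℝ → ℝ) (fin : Phase → ℝ) (f : ℝ → Phase → ℝ) : Prop where
  measurable : Measurable (Function.uncurry f)
  initial_nonneg : ∀ᵐ p : Phase, 0 ≤ fin p
  integrable : ∀ t, 0 ≤ t → ∀ᵐ p : Phase,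
    IntervalIntegrable (fun s => transport (t - s) (collisionPhase B (f s) (f s)) p) volume 0 t
  duhamel : ∀ t, 0 ≤ t → ∀ᵐ p : Phase,
    f t p = transport t fin p +
      ∫ s in (0 : ℝ)..t, transport (t - s) (collisionPhase B (f s) (f s)) p

end Boltzmann1D

end

open MeasureTheory Filter Topology Set
open scoped ENNReal ContDiff

noncomputable section

namespace Boltzmann1D

/-! Start Duhamel's formula at a late time `T` and drop the loss term, which has a sign because the
solution stays non-negative (`Sol.nonneg`). Then `S_q f(t)` is at most `f(T)` transported freely for
a time `t + q - T`, plus the transported gain produced on `[T, t]`. Each must be small in `L^∞_x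
L¹_v`, uniformly in `q ≥ 0` (`Sol.normX_le`).

Free transport decays because `f(T)` has an integrable derivative in `v₁`. If `Ψ' = ψ`, then `q ψ(x
+ q v₁)` is the `v₁`-derivative of `Ψ(x + q v₁)`, so `q` times the transported spatial density is at
most `‖∂_{v₁} f(T)‖_{L¹}` (`HasWeakDeriv.lintegral_shear_le`).

In the gain, the pre-post change of variables moves `σ` into the point of evaluation `x - τ v'₁`. By
Archimedes' theorem `σ₁` is uniformly distributed, so `v'₁` is spread evenly over an interval of
length `|v - v⋆|`. Since only `|v - v⋆| > R₀` matters, the gain of age `τ` is at most a constant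
over `τ` times the number of collisions in the whole space (`GoodKernel.lintegral_gainE_le_dissip`).
For small `τ` the majorant `φ(r) r` compensates the shortness of the interval and gives a bound by
the square of the `X` norm, free of `τ` (`GoodKernel.lintegral_gainE_le_sq`).

It remains to see that the number of collisions is integrable in time
(`Sol.lintegral_dissip_lt_top`). Bony's functional, the integral of `(w₁ - v₁) sign(y - x) f f` over
pairs of particles, is bounded by mass and energy. Collisions leave it unchanged, since they
conserve mass and momentum, while free flow increases it at a rate proportional to the integral of
`(v₁ - w₁)² f f` over pairs at the same place. So the latter is integrable in time
(`Sol.lintegral_spread_le`). On the other hand, collisions change `∫ v₁² f` by a gain proportional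
to `|v - v⋆|² σ₁²` and a loss proportional to `(v₁ - v⋆₁)²`. The moment is bounded and the loss is
integrable in time, hence so is the gain; and the gain dominates the number of collisions, because
the kernel cannot concentrate near `σ₁ = 0` and vanishes for `|v - v⋆| ≤ R₀`. -/

/-- The unit sphere of velocity space. -/
abbrev Sph : Type := Metric.sphere (0 : Vel) 1

/-! ### Integration over the unit sphere -/

/-- Surface measure on the unit sphere. -/
abbrev surf : Measure Sph := (volume : Measure Vel).toSphere

lemma lintegral_polar (G : Vel → ℝ≥0∞) (hG : Measurable G) :
    ∫⁻ V, G V = ∫⁻ ζ : Sph, ∫⁻ r in Ioi (0 : ℝ), ENNReal.ofReal (r ^ 2) * G (r • (ζ : Vel)) ∂volume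
      ∂surf := by
  have hmp := (volume : Measure Vel).measurePreserving_homeomorphUnitSphereProd
  have h1 : ∫⁻ V, G V = ∫⁻ V : ({0}ᶜ : Set Vel), G V ∂(Measure.comap Subtype.val volume) := by
    conv_lhs => rw [← restrict_compl_singleton (μ := (volume : Measure Vel)) 0]
    exact (lintegral_subtype_comap (measurableSet_singleton (0 : Vel)).compl _).symm
  have h2 : ∀ V : ({0}ᶜ : Set Vel), G V =
      (fun p : Sph × Ioi (0 : ℝ) => G ((p.2 : ℝ) • (p.1 : Vel)))
        (homeomorphUnitSphereProd Vel V) := by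
    intro V
    have := V.2
    simp only [mem_compl_iff, mem_singleton_iff] at this
    simp [homeomorphUnitSphereProd, smul_smul, this]
  rw [h1, lintegral_congr h2, hmp.lintegral_comp
    (f := fun p : Sph × Ioi (0 : ℝ) => G ((p.2 : ℝ) • (p.1 : Vel))) (by fun_prop)]
  rw [lintegral_prod _ (by fun_prop)]
  refine lintegral_congr fun ζ => ?_
  rw [Measure.volumeIoiPow, lintegral_withDensity_eq_lintegral_mul _ (by fun_prop) (by fun_prop)]
  have : Module.finrank ℝ Vel - 1 = 2 := by simp
  rw [this]
  exact lintegral_subtype_comap measurableSet_Ioi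
    (fun r : ℝ => ENNReal.ofReal (r ^ 2) * G (r • (ζ : Vel)))

lemma lintegral_sq_unit : ∫⁻ r in Ioi (0 : ℝ), ENNReal.ofReal (r ^ 2) * (Iio 1).indicator 1 r
    = ENNReal.ofReal (1 / 3) := by
  have : ∀ r : ℝ, ENNReal.ofReal (r ^ 2) * (Iio 1).indicator 1 r
      = (Iio 1).indicator (fun r => ENNReal.ofReal (r ^ 2)) r := by
    intro r; by_cases h : r ∈ Iio (1 : ℝ) <;> simp [h]
  rw [lintegral_congr this, setLIntegral_indicator measurableSet_Iio, inter_comm, Ioi_inter_Iio,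
    setLIntegral_congr Ioo_ae_eq_Ioc,
    ← ofReal_integral_eq_lintegral_ofReal, ← intervalIntegral.integral_of_le zero_le_one]
  · norm_num
  · exact (continuous_pow 2).integrableOn_Ioc
  · exact Eventually.of_forall fun r => by positivity

/-- Extending `h` to be homogeneous of degree zero turns a surface integral into a Lebesgue integral
over the unit ball, where isometries and coordinates are available. The factor is `3 = 1 / ∫₀¹ r²
dr`. -/
lemma lintegral_surf (h : Vel → ℝ≥0∞) (hh : Measurable h) :
    ∫⁻ ζ : Sph, h ζ ∂surf =
      3 * ∫⁻ V : Vel, (Iio 1).indicator 1 ‖V‖ * h (‖V‖⁻¹ • V) := by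
  have hm : Measurable ((Iio (1:ℝ)).indicator (1 : ℝ → ℝ≥0∞)) :=
    measurable_one.indicator measurableSet_Iio
  rw [lintegral_polar _ (by fun_prop)]
  have : ∀ ζ : Sph, ∫⁻ r in Ioi (0 : ℝ), ENNReal.ofReal (r ^ 2) *
      ((Iio 1).indicator 1 ‖r • (ζ : Vel)‖ * h (‖r • (ζ : Vel)‖⁻¹ • r • (ζ : Vel))) ∂volume
      = ENNReal.ofReal (1 / 3) * h ζ := by
    intro ζ
    rw [← lintegral_sq_unit, ← lintegral_mul_const _ (by fun_prop)]
    refine setLIntegral_congr_fun measurableSet_Ioi fun r hr => ?_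
    have hr : 0 < r := hr
    have h1 : ‖r • (ζ : Vel)‖ = r := by simp [norm_smul, abs_of_pos hr]
    simp only [h1, smul_smul, inv_mul_cancel₀ hr.ne', one_smul, mul_assoc]
  rw [lintegral_congr this, lintegral_const_mul _ (by fun_prop), ← mul_assoc]
  have : (3 : ℝ≥0∞) * ENNReal.ofReal (1 / 3) = 1 := by
    rw [show (3 : ℝ≥0∞) = ENNReal.ofReal 3 by simp, ← ENNReal.ofReal_mul (by norm_num)]
    norm_num
  rw [this, one_mul]

lemma lintegral_surf_isometry (e : Vel ≃ₗᵢ[ℝ] Vel) (h : Vel → ℝ≥0∞) (hh : Measurable h) :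
    ∫⁻ ζ : Sph, h (e ζ) ∂surf = ∫⁻ ζ : Sph, h ζ ∂surf := by
  have he : Measurable e := e.continuous.measurable
  have hm : Measurable ((Iio (1:ℝ)).indicator (1 : ℝ → ℝ≥0∞)) :=
    measurable_one.indicator measurableSet_Iio
  rw [lintegral_surf (fun v => h (e v)) (by fun_prop), lintegral_surf h hh,
    ← (e.measurePreserving).lintegral_comp
      (f := fun V : Vel => (Iio 1).indicator 1 ‖V‖ * h (‖V‖⁻¹ • V)) (by fun_prop)]
  simp

lemma lintegral_vel_coord (g : ℝ → ℝ → ℝ≥0∞) (hg : Measurable (Function.uncurry g)) :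
    ∫⁻ V : Vel, g (V 0) (V 1 ^ 2 + V 2 ^ 2) =
      ∫⁻ x : ℝ, ∫⁻ p : ℝ × ℝ, g x (p.1 ^ 2 + p.2 ^ 2) := by
  have h1 := (EuclideanSpace.volume_preserving_symm_measurableEquiv_toLp (Fin 3)).symm
  have h2 := volume_preserving_piFinSuccAbove (fun _ : Fin 3 => ℝ) 0
  have h3 := volume_preserving_finTwoArrow ℝ
  have hg' : ∀ {α : Type} [MeasurableSpace α] (a b : α → ℝ), Measurable a → Measurable b →
      Measurable fun x => g (a x) (b x) := fun a b ha hb => hg.comp (ha.prodMk hb)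
  rw [← h1.lintegral_comp (by refine hg' _ _ ?_ ?_ <;> fun_prop)]
  have : ∫⁻ x : ℝ, ∫⁻ p : ℝ × ℝ, g x (p.1 ^ 2 + p.2 ^ 2)
     = ∫⁻ x : ℝ, ∫⁻ p : Fin 2 → ℝ, g x (p 0 ^ 2 + p 1 ^ 2) := by
    refine lintegral_congr fun x => ?_
    rw [← h3.lintegral_comp (by refine hg' _ _ ?_ ?_ <;> fun_prop)]
    rfl
  rw [this, ← lintegral_prod (f := fun q : ℝ × (Fin 2 → ℝ) => g q.1 (q.2 0 ^ 2 + q.2 1 ^ 2))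
    (by refine (hg' _ _ ?_ ?_).aemeasurable <;> fun_prop)]
  rw [← Measure.volume_eq_prod, ← h2.lintegral_comp (by refine hg' _ _ ?_ ?_ <;> fun_prop)]
  rfl

lemma lintegral_plane_radial (g : ℝ → ℝ≥0∞) (hg : Measurable g) :
    ∫⁻ p : ℝ × ℝ, g (p.1 ^ 2 + p.2 ^ 2) =
      ENNReal.ofReal (2 * Real.pi) * ∫⁻ ρ in Ioi (0:ℝ), ENNReal.ofReal ρ * g (ρ ^ 2) := by
  rw [← lintegral_comp_polarCoord_symm]
  simp only [polarCoord_target, polarCoord_symm_apply, smul_eq_mul]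
  have : ∀ p : ℝ × ℝ, (p.1 * Real.cos p.2) ^ 2 + (p.1 * Real.sin p.2) ^ 2 = p.1 ^ 2 := by
    intro p
    have := Real.sin_sq_add_cos_sq p.2
    linear_combination p.1 ^ 2 * this
  simp only [this]
  rw [Measure.volume_eq_prod, ← Measure.prod_restrict, lintegral_prod _ (by fun_prop)]
  simp only [lintegral_const, MeasurableSet.univ, Measure.restrict_apply, univ_inter,
    Real.volume_Ioo]
  rw [lintegral_mul_const _ (by fun_prop), mul_comm]
  congr 2
  ring

/-- Polar coordinates `x = r cos θ`, `ρ = r sin θ` in the half-plane `ρ > 0`: the weight `ρ` and the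
Jacobian `r` give `r² sin θ`, and the radial integral separates. -/
lemma lintegral_archimedes_aux (h : ℝ → ℝ≥0∞) (hh : Measurable h) :
    ∫⁻ x : ℝ, ∫⁻ ρ in Ioi (0:ℝ), ENNReal.ofReal ρ *
      ((Iio 1).indicator 1 (√(x ^ 2 + ρ ^ 2)) * h ((√(x ^ 2 + ρ ^ 2))⁻¹ * x)) =
      ENNReal.ofReal (1 / 3) *
        ∫⁻ θ in Ioo 0 Real.pi, ENNReal.ofReal (Real.sin θ) * h (Real.cos θ) := by
  have hm : Measurable ((Iio (1:ℝ)).indicator (1 : ℝ → ℝ≥0∞)) :=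
    measurable_one.indicator measurableSet_Iio
  have hm0 : Measurable ((Ioi (0:ℝ)).indicator (1 : ℝ → ℝ≥0∞)) :=
    measurable_one.indicator measurableSet_Ioi
  have h1 : ∀ x : ℝ, ∫⁻ ρ in Ioi (0:ℝ), ENNReal.ofReal ρ *
      ((Iio 1).indicator 1 (√(x ^ 2 + ρ ^ 2)) * h ((√(x ^ 2 + ρ ^ 2))⁻¹ * x)) =
      ∫⁻ ρ : ℝ, (Ioi (0:ℝ)).indicator 1 ρ * (ENNReal.ofReal ρ *
      ((Iio 1).indicator 1 (√(x ^ 2 + ρ ^ 2)) * h ((√(x ^ 2 + ρ ^ 2))⁻¹ * x))) := by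
    intro x
    rw [← lintegral_indicator measurableSet_Ioi]
    refine lintegral_congr fun ρ => ?_
    by_cases hρ : ρ ∈ Ioi (0:ℝ) <;> simp [hρ]
  rw [lintegral_congr h1, ← lintegral_prod (f := fun p : ℝ × ℝ => (Ioi (0:ℝ)).indicator 1 p.2 *
    (ENNReal.ofReal p.2 * ((Iio 1).indicator 1 (√(p.1 ^ 2 + p.2 ^ 2)) *
      h ((√(p.1 ^ 2 + p.2 ^ 2))⁻¹ * p.1)))) (by fun_prop), ← Measure.volume_eq_prod,
    ← lintegral_comp_polarCoord_symm]
  simp only [polarCoord_target, polarCoord_symm_apply, smul_eq_mul]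
  -- The condition `ρ > 0` keeps only the angles in `(0, π)` out of `(-π, π)`.
  have h2 : ∀ p ∈ Ioi (0:ℝ) ×ˢ Ioo (-Real.pi) Real.pi, ENNReal.ofReal p.1 *
      ((Ioi (0:ℝ)).indicator 1 (p.1 * Real.sin p.2) * (ENNReal.ofReal (p.1 * Real.sin p.2) *
      ((Iio 1).indicator 1 (√((p.1 * Real.cos p.2) ^ 2 + (p.1 * Real.sin p.2) ^ 2)) *
      h ((√((p.1 * Real.cos p.2) ^ 2 + (p.1 * Real.sin p.2) ^ 2))⁻¹ * (p.1 * Real.cos p.2))))) =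
      (ENNReal.ofReal (p.1 ^ 2) * (Iio 1).indicator 1 p.1) *
        (Ioo 0 Real.pi).indicator
          (fun θ => ENNReal.ofReal (Real.sin θ) * h (Real.cos θ)) p.2 := by
    rintro ⟨r, θ⟩ ⟨hr, hθ⟩
    simp only [mem_Ioi, mem_Ioo] at hr hθ
    have e1 : (r * Real.cos θ) ^ 2 + (r * Real.sin θ) ^ 2 = r ^ 2 := by
      linear_combination r ^ 2 * Real.sin_sq_add_cos_sq θ
    simp only [e1, Real.sqrt_sq hr.le]
    rw [← mul_assoc r⁻¹, inv_mul_cancel₀ hr.ne', one_mul]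
    by_cases hθ0 : 0 < θ
    · have hs := Real.sin_pos_of_pos_of_lt_pi hθ0 hθ.2
      rw [indicator_of_mem (show r * Real.sin θ ∈ Ioi 0 from mul_pos hr hs),
        indicator_of_mem (show θ ∈ Ioo 0 Real.pi from ⟨hθ0, hθ.2⟩), ENNReal.ofReal_mul hr.le,
        pow_two, ENNReal.ofReal_mul hr.le]
      simp only [Pi.one_apply, one_mul]
      ring
    · have hs := Real.sin_nonpos_of_nonpos_of_neg_pi_le (not_lt.1 hθ0) hθ.1.le
      rw [indicator_of_notMem (show r * Real.sin θ ∉ Ioi 0 from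
          not_lt.2 (mul_nonpos_of_nonneg_of_nonpos hr.le hs)),
        indicator_of_notMem (show θ ∉ Ioo 0 Real.pi from fun h => hθ0 h.1)]
      simp
  rw [setLIntegral_congr_fun (measurableSet_Ioi.prod measurableSet_Ioo) h2,
    Measure.volume_eq_prod, ← Measure.prod_restrict, lintegral_prod_mul (f := fun r : ℝ => ENNReal.ofReal (r ^ 2) * (Iio 1).indicator 1 r) (by fun_prop)
      (((by fun_prop : Measurable fun θ => ENNReal.ofReal (Real.sin θ) *
        h (Real.cos θ)).indicator measurableSet_Ioo).aemeasurable), lintegral_sq_unit,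
    setLIntegral_indicator measurableSet_Ioo]
  congr 3
  rw [inter_eq_left]
  exact Ioo_subset_Ioo_left (by linarith [Real.pi_pos])

/-- Archimedes' theorem: `σ₁` is uniformly distributed on the unit sphere. -/
lemma lintegral_surf_fst (h : ℝ → ℝ≥0∞) (hh : Measurable h) :
    ∫⁻ ζ : Sph, h ((ζ : Vel) 0) ∂surf = ENNReal.ofReal (2 * Real.pi) *
      ∫⁻ θ in Ioo 0 Real.pi, ENNReal.ofReal (Real.sin θ) * h (Real.cos θ) := by
  have hm : Measurable ((Iio (1:ℝ)).indicator (1 : ℝ → ℝ≥0∞)) :=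
    measurable_one.indicator measurableSet_Iio
  rw [lintegral_surf (fun v => h (v 0)) (by fun_prop)]
  have hn : ∀ V : Vel, ‖V‖ = √(V 0 ^ 2 + (V 1 ^ 2 + V 2 ^ 2)) := by
    intro V
    rw [EuclideanSpace.norm_eq, Fin.sum_univ_three]
    simp [add_assoc]
  have := lintegral_vel_coord (fun a b => (Iio 1).indicator 1 (√(a ^ 2 + b)) *
    h ((√(a ^ 2 + b))⁻¹ * a)) (by fun_prop)
  simp only [hn, PiLp.smul_apply, smul_eq_mul]
  rw [this]
  have h2 : ∀ x : ℝ, ∫⁻ p : ℝ × ℝ, (Iio 1).indicator 1 (√(x ^ 2 + (p.1 ^ 2 + p.2 ^ 2))) *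
    h ((√(x ^ 2 + (p.1 ^ 2 + p.2 ^ 2)))⁻¹ * x) = ENNReal.ofReal (2 * Real.pi) *
      ∫⁻ ρ in Ioi (0:ℝ), ENNReal.ofReal ρ *
      ((Iio 1).indicator 1 (√(x ^ 2 + ρ ^ 2)) * h ((√(x ^ 2 + ρ ^ 2))⁻¹ * x)) := fun x =>
    lintegral_plane_radial (fun b => (Iio 1).indicator 1 (√(x ^ 2 + b)) *
      h ((√(x ^ 2 + b))⁻¹ * x)) (by fun_prop)
  rw [lintegral_congr h2, lintegral_const_mul' _ _ ENNReal.ofReal_ne_top,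
    lintegral_archimedes_aux h hh, ← mul_assoc, ← mul_assoc, mul_comm 3, mul_assoc (ENNReal.ofReal _)]
  have : (3 : ℝ≥0∞) * ENNReal.ofReal (1 / 3) = 1 := by
    rw [show (3 : ℝ≥0∞) = ENNReal.ofReal 3 by simp, ← ENNReal.ofReal_mul (by norm_num)]
    norm_num
  rw [this, mul_one]

/-- A reflection carries `e` to the first basis vector and preserves the surface measure. This is
why the total cross section depends on the relative speed only. -/
lemma lintegral_surf_inner (e : Vel) (he : ‖e‖ = 1) (h : ℝ → ℝ≥0∞) (hh : Measurable h) :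
    ∫⁻ ζ : Sph, h (inner ℝ e (ζ : Vel)) ∂surf = ENNReal.ofReal (2 * Real.pi) *
      ∫⁻ θ in Ioo 0 Real.pi, ENNReal.ofReal (Real.sin θ) * h (Real.cos θ) := by
  rw [← lintegral_surf_fst h hh]
  set e0 : Vel := EuclideanSpace.single 0 1
  have h0 : ‖e‖ = ‖e0‖ := by simp [e0, he]
  set R : Vel ≃ₗᵢ[ℝ] Vel := (ℝ ∙ (e - e0))ᗮ.reflection
  have hR : R e = e0 := Submodule.reflection_sub h0
  rw [← lintegral_surf_isometry R (fun v => h (v 0)) (by fun_prop)]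
  refine lintegral_congr fun ζ => ?_
  rw [← R.inner_map_map, hR]
  simp [e0, EuclideanSpace.inner_single_left]

/-! ### Symmetries of the collision measure -/

/-- Collision parameters `(v, (v⋆, σ))`. -/
abbrev Col : Type := Vel × (Vel × Sph)

instance : SigmaFinite surf := inferInstance

instance sigmaFinite_vel_surf : SigmaFinite ((volume : Measure Vel).prod surf) :=
  Measure.prod.instSigmaFinite

/-- The collision measure `dv dv⋆ dσ`. -/
abbrev colMeas : Measure Col := (volume : Measure Vel).prod ((volume : Measure Vel).prod surf)

/-- The direction of `V`, or `σ` if `V = 0`. -/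
def dir (V : Vel) (σ : Sph) : Sph :=
  -- Keeping `σ` when `V = 0` makes `collide` an involution at every point, with no exceptional set.
  ⟨open scoped Classical in if V = 0 then (σ : Vel) else ‖V‖⁻¹ • V, by
    split_ifs with h
    · exact σ.2
    · simp [norm_smul, h]⟩

lemma measurable_dir : Measurable (fun p : Vel × Sph => dir p.1 p.2) := by
  refine Measurable.subtype_mk (Measurable.ite ?_ (by fun_prop) (by fun_prop))
  exact measurable_fst (measurableSet_singleton 0)

@[fun_prop]
lemma Measurable.dir {α : Type*} [MeasurableSpace α] {f : α → Vel} {g : α → Sph}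
    (hf : Measurable f) (hg : Measurable g) : Measurable fun a => Boltzmann1D.dir (f a) (g a) :=
  measurable_dir.comp (hf.prodMk hg)

lemma norm_smul_dir (V : Vel) (σ : Sph) : ‖V‖ • (dir V σ : Vel) = V := by
  by_cases h : V = 0
  · simp [h]
  · simp [dir, h, smul_smul]

lemma dir_norm_smul (V : Vel) (σ : Sph) : dir (‖V‖ • (σ : Vel)) (dir V σ) = σ := by
  ext1
  by_cases h : V = 0
  · simp [dir, h]
  · have h' : (‖V‖ • (σ : Vel)) ≠ 0 := by
      have : (σ : Vel) ≠ 0 := fun h0 => by simpa [h0] using σ.2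
      simp [h, this]
    have hn : ‖V‖ ≠ 0 := by simpa using h
    simp only [dir, if_neg h', norm_smul]
    simp [smul_smul, hn]

/-- The pre-post collisional change of variables. -/
def collide (y : Col) : Col :=
  (postV y.1 y.2.1 y.2.2, (postVs y.1 y.2.1 y.2.2, dir (y.1 - y.2.1) y.2.2))

/-- Exchange of the two colliding particles. -/
def exchange (y : Col) : Col := (y.2.1, (y.1, -y.2.2))

lemma postV_sub_postVs (v vs σ : Vel) : postV v vs σ - postVs v vs σ = ‖v - vs‖ • σ := by
  simp only [postV, postVs]
  module

@[fun_prop]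
lemma measurable_postV {α : Type*} [MeasurableSpace α] {f g h : α → Vel}
    (hf : Measurable f) (hg : Measurable g) (hh : Measurable h) :
    Measurable fun a => postV (f a) (g a) (h a) := by
  unfold postV; fun_prop

@[fun_prop]
lemma measurable_postVs {α : Type*} [MeasurableSpace α] {f g h : α → Vel}
    (hf : Measurable f) (hg : Measurable g) (hh : Measurable h) :
    Measurable fun a => postVs (f a) (g a) (h a) := by
  unfold postVs; fun_prop

@[fun_prop]
lemma measurable_collide : Measurable collide := by
  unfold collide; fun_prop

@[fun_prop]
lemma measurable_exchange : Measurable exchange := by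
  unfold exchange
  have : Measurable fun σ : Sph => -σ := continuous_neg.measurable
  fun_prop

lemma collide_collide (y : Col) : collide (collide y) = y := by
  obtain ⟨v, vs, σ⟩ := y
  simp only [collide, postV_sub_postVs, dir_norm_smul]
  have h1 : ‖(‖v - vs‖ • (σ : Vel))‖ = ‖v - vs‖ := by simp [norm_smul]
  have h2 := norm_smul_dir (v - vs) σ
  ext1
  · simp only
    rw [postV, postV_sub_postVs]
    simp only [h1, div_eq_inv_mul, mul_smul, h2]
    simp only [postV, postVs]
    module
  · ext1
    · simp only
      rw [postVs, postV_sub_postVs]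
      simp only [h1, div_eq_inv_mul, mul_smul, h2]
      simp only [postV, postVs]
      module
    · rfl

/-- With `V = r ζ` the measure is `r² dr dζ dσ`, which is symmetric in the two unit vectors, and the
map swaps `ζ` and `σ`. -/
lemma lintegral_swap_dir (G : Vel → Sph → ℝ≥0∞) (hG : Measurable (Function.uncurry G)) :
    ∫⁻ V : Vel, ∫⁻ σ, G (‖V‖ • (σ : Vel)) (dir V σ) ∂surf = ∫⁻ V : Vel, ∫⁻ σ, G V σ ∂surf := by
  have hG' : ∀ {α : Type} [MeasurableSpace α] (a : α → Vel) (b : α → Sph), Measurable a →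
      Measurable b → Measurable fun x => G (a x) (b x) := fun a b ha hb => hG.comp (ha.prodMk hb)
  have m1 : Measurable fun V : Vel => ∫⁻ σ, G (‖V‖ • (σ : Vel)) (dir V σ) ∂surf := by
    refine Measurable.lintegral_prod_right' (f := fun p : Vel × Sph => G (‖p.1‖ • (p.2 : Vel)) (dir p.1 p.2)) ?_
    apply hG' <;> fun_prop
  have m2 : Measurable fun V : Vel => ∫⁻ σ, G V σ ∂surf :=
    Measurable.lintegral_prod_right' (f := fun p : Vel × Sph => G p.1 p.2) hG
  have key : ∀ ζ : Sph, ∫⁻ r in Ioi (0 : ℝ), ENNReal.ofReal (r ^ 2) *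
      (∫⁻ σ, G (‖r • (ζ : Vel)‖ • (σ : Vel)) (dir (r • (ζ : Vel)) σ) ∂surf) =
      ∫⁻ σ : Sph, ∫⁻ r in Ioi (0 : ℝ), ENNReal.ofReal (r ^ 2) * G (r • (σ : Vel)) ζ ∂volume ∂surf := by
    intro ζ
    rw [lintegral_lintegral_swap]
    · refine setLIntegral_congr_fun measurableSet_Ioi fun r hr => ?_
      have hr : 0 < r := hr
      have h1 : ‖r • (ζ : Vel)‖ = r := by simp [norm_smul, abs_of_pos hr]
      have h2 : ∀ σ, dir (r • (ζ : Vel)) σ = ζ := by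
        intro σ
        have := dir_norm_smul (r • (σ : Vel)) ζ
        have h3 : (r • (ζ : Vel)) ≠ 0 := by rw [← norm_ne_zero_iff, h1]; exact hr.ne'
        ext1
        simp only [dir, if_neg h3, h1]
        rw [smul_smul, inv_mul_cancel₀ hr.ne', one_smul]
      simp only [h1, h2]
      rw [lintegral_const_mul _ (by apply hG' <;> fun_prop)]
    · refine Measurable.aemeasurable (Measurable.mul (by fun_prop) ?_)
      apply hG' <;> fun_prop
  rw [lintegral_polar _ m1, lintegral_congr key, lintegral_lintegral_swap, lintegral_polar _ m2]
  · refine lintegral_congr fun σ => ?_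
    rw [lintegral_lintegral_swap]
    · refine lintegral_congr fun r => ?_
      rw [lintegral_const_mul _ (by apply hG' <;> fun_prop)]
    · refine Measurable.aemeasurable (Measurable.mul (by fun_prop) ?_)
      apply hG' <;> fun_prop
  · refine Measurable.aemeasurable (Measurable.lintegral_prod_right'
      (f := fun p : (Sph × Sph) × ℝ => ENNReal.ofReal (p.2 ^ 2) * G (p.2 • (p.1.2 : Vel)) p.1.1) ?_)
    refine (Measurable.mul (by fun_prop) ?_)
    apply hG' <;> fun_prop

/-- Coordinates of centre of mass `c` and relative velocity `V`: a collision fixes `c` and only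
swaps the direction of `V` with `σ`. -/
lemma lintegral_col (G : Col → ℝ≥0∞) (hG : Measurable G) :
    ∫⁻ y, G y ∂colMeas =
      ∫⁻ c : Vel, ∫⁻ V : Vel, ∫⁻ σ, G (c + (1 / 2 : ℝ) • V, (c - (1 / 2 : ℝ) • V, σ)) ∂surf := by
  have m1 : Measurable fun p : Vel × Vel => ∫⁻ σ, G (p.1, (p.2, σ)) ∂surf :=
    Measurable.lintegral_prod_right' (f := fun p : (Vel × Vel) × Sph => G (p.1.1, (p.1.2, p.2)))
      (by fun_prop)
  have h1 : ∀ v, ∫⁻ z, G (v, z) ∂((volume : Measure Vel).prod surf)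
      = ∫⁻ V : Vel, ∫⁻ σ, G (v, (v - V, σ)) ∂surf := by
    intro v
    rw [lintegral_prod _ (by fun_prop)]
    exact (lintegral_sub_left_eq_self (fun vs => ∫⁻ σ, G (v, (vs, σ)) ∂surf) v).symm
  rw [lintegral_prod _ (by fun_prop), lintegral_congr h1, lintegral_lintegral_swap]
  · have h2 : ∀ V : Vel, ∫⁻ v, ∫⁻ σ, G (v, (v - V, σ)) ∂surf
        = ∫⁻ c : Vel, ∫⁻ σ, G (c + (1 / 2 : ℝ) • V, (c - (1 / 2 : ℝ) • V, σ)) ∂surf := by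
      intro V
      rw [← lintegral_add_right_eq_self (fun v => ∫⁻ σ, G (v, (v - V, σ)) ∂surf) ((1 / 2 : ℝ) • V)]
      refine lintegral_congr fun c => ?_
      have hc : c + (1 / 2 : ℝ) • V - V = c - (1 / 2 : ℝ) • V := by module
      simp only [hc]
    rw [lintegral_congr h2, lintegral_lintegral_swap]
    exact (m1.comp (f := fun p : Vel × Vel => ((p.2 + (1 / 2 : ℝ) • p.1 : Vel),
      (p.2 - (1 / 2 : ℝ) • p.1 : Vel))) (by fun_prop)).aemeasurable
  · exact (m1.comp (f := fun p : Vel × Vel => (p.1, p.1 - p.2)) (by fun_prop)).aemeasurable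

lemma lintegral_collide (G : Col → ℝ≥0∞) (hG : Measurable G) :
    ∫⁻ y, G (collide y) ∂colMeas = ∫⁻ y, G y ∂colMeas := by
  rw [lintegral_col _ (by fun_prop), lintegral_col _ hG]
  refine lintegral_congr fun c => ?_
  rw [← lintegral_swap_dir (fun V σ => G (c + (1 / 2 : ℝ) • V, (c - (1 / 2 : ℝ) • V, σ)))
    (by simp only [Function.uncurry_def]; fun_prop)]
  refine lintegral_congr fun V => lintegral_congr fun σ => ?_
  have hV : c + (1 / 2 : ℝ) • V - (c - (1 / 2 : ℝ) • V) = V := by module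
  simp only [collide, postV, postVs, hV]
  congr! 2
  · module
  · congr! 1; module

lemma lintegral_exchange (G : Col → ℝ≥0∞) (hG : Measurable G) :
    ∫⁻ y, G (exchange y) ∂colMeas = ∫⁻ y, G y ∂colMeas := by
  have hneg : Measurable fun σ : Sph => -σ := continuous_neg.measurable
  have hS : MeasurePreserving (fun σ : Sph => -σ) surf surf := by
    refine ⟨hneg, Measure.ext_of_lintegral _ fun g hg => ?_⟩
    rw [lintegral_map hg hneg]
    -- `dir` extends `g` from the sphere to the whole space, so that isometry invariance applies to
    -- the antipodal map. The point chosen as default plays no role, since `dir` is only evaluated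
    -- on the sphere.
    have := lintegral_surf_isometry (LinearIsometryEquiv.neg ℝ)
      (fun v => g (dir v ⟨EuclideanSpace.single 0 1, by simp⟩)) (by fun_prop)
    have hd : ∀ σ τ : Sph, dir (σ : Vel) τ = σ := by
      intro σ τ
      have h1 : ‖(σ : Vel)‖ = 1 := by simp
      have := norm_smul_dir (σ : Vel) τ
      rw [h1, one_smul] at this
      exact Subtype.ext this
    simp only [LinearIsometryEquiv.coe_neg, hd] at this
    rw [← this]
    refine lintegral_congr fun σ => ?_
    rw [← hd (-σ) ⟨EuclideanSpace.single 0 1, by simp⟩]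
    simp
  rw [lintegral_prod _ (by fun_prop), lintegral_prod _ (by fun_prop)]
  have h1 : ∀ v : Vel, ∫⁻ z, G (exchange (v, z)) ∂((volume : Measure Vel).prod surf)
      = ∫⁻ vs, ∫⁻ σ, G (vs, (v, σ)) ∂surf := by
    intro v
    rw [lintegral_prod _ (by fun_prop)]
    refine lintegral_congr fun vs => ?_
    exact hS.lintegral_comp (f := fun σ => G (vs, (v, σ))) (by fun_prop)
  have h2 : ∀ v : Vel, ∫⁻ z, G (v, z) ∂((volume : Measure Vel).prod surf)
      = ∫⁻ vs, ∫⁻ σ, G (v, (vs, σ)) ∂surf := by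
    intro v
    rw [lintegral_prod _ (by fun_prop)]
  have m1 : Measurable fun p : Vel × Vel => ∫⁻ σ, G (p.2, (p.1, σ)) ∂surf :=
    Measurable.lintegral_prod_right' (f := fun p : (Vel × Vel) × Sph => G (p.1.2, (p.1.1, p.2)))
      (by fun_prop)
  rw [lintegral_congr h1, lintegral_congr h2, lintegral_lintegral_swap m1.aemeasurable]

/-- The collision kernel as a function of the collision parameters. -/
def kern (B : ℝ → ℝ → ℝ) (y : Col) : ℝ :=
  B ‖y.1 - y.2.1‖ (inner ℝ (‖y.1 - y.2.1‖⁻¹ • (y.1 - y.2.1)) (y.2.2 : Vel))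

lemma kern_exchange (B : ℝ → ℝ → ℝ) (y : Col) : kern B (exchange y) = kern B y := by
  obtain ⟨v, vs, σ⟩ := y
  simp only [kern, exchange]
  rw [norm_sub_rev vs v, ← neg_sub v vs, smul_neg]
  simp only [inner_neg_left, neg_neg, Metric.sphere, coe_neg_sphere, inner_neg_right]

/-- Microreversibility: the relative speed is preserved, and swapping its direction with `σ` only
swaps the two arguments of the inner product. -/
lemma kern_collide (B : ℝ → ℝ → ℝ) (y : Col) : kern B (collide y) = kern B y := by
  obtain ⟨v, vs, σ⟩ := y
  simp only [kern, collide, postV_sub_postVs]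
  have h1 : ‖(‖v - vs‖ • (σ : Vel))‖ = ‖v - vs‖ := by simp [norm_smul]
  rw [h1]
  by_cases h : v - vs = 0
  · simp [h]
  · have hn : ‖v - vs‖ ≠ 0 := by simpa using h
    rw [smul_smul, inv_mul_cancel₀ hn, one_smul, real_inner_comm]
    simp [dir, h]

lemma measurable_kern {B : ℝ → ℝ → ℝ} (hB : Measurable (Function.uncurry B)) :
    Measurable (kern B) :=
  hB.comp (f := fun y : Col => (‖y.1 - y.2.1‖,
    inner ℝ (‖y.1 - y.2.1‖⁻¹ • (y.1 - y.2.1)) (y.2.2 : Vel))) (by fun_prop)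

/-! ### Bounds for the collision kernel -/

/-- The kernel as an extended non-negative function of the collision parameters. -/
def kernE (B : ℝ → ℝ → ℝ) (y : Col) : ℝ≥0∞ := ENNReal.ofReal (kern B y)

/-- The total cross section at relative speed `r`. -/
def crossE (B : ℝ → ℝ → ℝ) (r : ℝ) : ℝ≥0∞ :=
  ENNReal.ofReal (2 * Real.pi) *
    ∫⁻ θ in Ioo 0 Real.pi, ENNReal.ofReal (Real.sin θ) * ENNReal.ofReal (B r (Real.cos θ))

lemma measurable_kernE {B : ℝ → ℝ → ℝ} (hB : Measurable (Function.uncurry B)) :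
    Measurable (kernE B) := (measurable_kern hB).ennreal_ofReal

lemma measurable_crossE {B : ℝ → ℝ → ℝ} (hB : Measurable (Function.uncurry B)) :
    Measurable (crossE B) := by
  unfold crossE
  refine Measurable.const_mul (Measurable.lintegral_prod_right' (f := fun p : ℝ × ℝ =>
    ENNReal.ofReal (Real.sin p.2) * ENNReal.ofReal (B p.1 (Real.cos p.2))) ?_) _
  have : Measurable fun p : ℝ × ℝ => B p.1 (Real.cos p.2) :=
    hB.comp (f := fun p : ℝ × ℝ => (p.1, Real.cos p.2)) (by fun_prop)
  fun_prop

/-- What is used of the collision kernel: a bound `b`, a lower cutoff `R₀` for the relative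
speed, a lower bound `δ` for the ratio of total to differential cross section, and a
non-increasing integrable majorant `Φ` of `B(r, ·) / r`. -/
structure GoodKernel (B : ℝ → ℝ → ℝ) (b R₀ δ : ℝ) (Φ : ℝ → ℝ≥0∞) : Prop where
  measurable : Measurable (Function.uncurry B)
  R_pos : 0 < R₀
  delta_pos : 0 < δ
  antitone : Antitone Φ
  lintegral_lt_top : ∫⁻ r in Ioi 0, Φ r < ⊤
  kern_nonneg : ∀ y, 0 ≤ kern B y
  kern_le : ∀ y, kern B y ≤ b
  kern_eq_zero : ∀ y : Col, ‖y.1 - y.2.1‖ ≤ R₀ → kern B y = 0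
  kernE_le_majorant : ∀ y : Col, kernE B y ≤ Φ ‖y.1 - y.2.1‖ * ENNReal.ofReal ‖y.1 - y.2.1‖
  kernE_le_cross : ∀ y : Col, ENNReal.ofReal δ * kernE B y ≤ crossE B ‖y.1 - y.2.1‖
  lintegral_kernE : ∀ v vs, ∫⁻ σ, kernE B (v, (vs, σ)) ∂surf = crossE B ‖v - vs‖

lemma exists_goodKernel {B : ℝ → ℝ → ℝ} (hB : IsCollisionKernel B) (hH1 : HypH1 B)
    (hH2 : HypH2 B) : ∃ b R₀ δ Φ, GoodKernel B b R₀ δ Φ := by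
  obtain ⟨⟨φ, hφa, hφi, hφ⟩, -⟩ := hH1
  obtain ⟨⟨R₀, hR, hR0⟩, δ, hδ, hδ'⟩ := hH2
  -- The value `⊤` on `r ≤ 0` makes `Φ` non-increasing on the whole line, hence measurable, without
  -- changing its integral over `r > 0`.
  set Φ : ℝ → ℝ≥0∞ := fun r => if r ≤ 0 then ⊤ else ENNReal.ofReal (φ r) with hΦ
  have hΦa : Antitone Φ := by
    intro x y hxy
    simp only [hΦ]
    by_cases hx : x ≤ 0
    · simp [hx]
    · have hy : ¬ y ≤ 0 := by linarith
      rw [if_neg hx, if_neg hy]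
      exact ENNReal.ofReal_le_ofReal (hφa (not_le.1 hx) (not_le.1 hy) hxy)
  have hΦi : ∫⁻ r in Ioi 0, Φ r < ⊤ := by
    have : ∫⁻ r in Ioi (0:ℝ), Φ r = ∫⁻ r in Ioi 0, ENNReal.ofReal (φ r) :=
      setLIntegral_congr_fun measurableSet_Ioi fun r hr => by
        simp [hΦ, not_le.2 (mem_Ioi.1 hr)]
    rw [this]
    exact hφi.lintegral_lt_top
  -- the argument of `B` in `kern` is a cosine
  have hcos : ∀ y : Col, ∃ θ ∈ Icc (0:ℝ) Real.pi,
      inner ℝ (‖y.1 - y.2.1‖⁻¹ • (y.1 - y.2.1)) (y.2.2 : Vel) = Real.cos θ := by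
    intro y
    have h1 : |inner ℝ (‖y.1 - y.2.1‖⁻¹ • (y.1 - y.2.1)) (y.2.2 : Vel)| ≤ 1 := by
      refine (abs_real_inner_le_norm _ _).trans ?_
      have : ‖(y.2.2 : Vel)‖ = 1 := by simp
      rw [this, mul_one, norm_smul, norm_inv, norm_norm]
      exact inv_mul_le_one
    refine ⟨Real.arccos (inner ℝ (‖y.1 - y.2.1‖⁻¹ • (y.1 - y.2.1)) (y.2.2 : Vel)), ⟨Real.arccos_nonneg _, Real.arccos_le_pi _⟩, ?_⟩
    rw [Real.cos_arccos (abs_le.1 h1).1 (abs_le.1 h1).2]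
  have hk0 : ∀ y, 0 ≤ kern B y := by
    intro y
    obtain ⟨θ, hθ, h⟩ := hcos y
    rw [kern, h]
    exact hB.nonneg _ (norm_nonneg _) _ ⟨Real.neg_one_le_cos _, Real.cos_le_one _⟩
  have hkz : ∀ y : Col, ‖y.1 - y.2.1‖ ≤ R₀ → kern B y = 0 := by
    intro y hy
    obtain ⟨θ, hθ, h⟩ := hcos y
    rw [kern, h]
    exact hR0 _ (norm_nonneg _) hy θ hθ
  -- By monotonicity `r φ(r) ≤ ∫₀ʳ φ`, which bounds the kernel at every point and not only almost
  -- everywhere.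
  have hφb : ∀ r, 0 < r → ENNReal.ofReal (φ r * r) ≤ ∫⁻ r in Ioi 0, Φ r := by
    intro r hr
    calc ENNReal.ofReal (φ r * r) = ∫⁻ s in Ioc 0 r, Φ r := by
          rw [setLIntegral_const, Real.volume_Ioc, sub_zero, ENNReal.ofReal_mul' hr.le]
          simp [hΦ, not_le.2 hr]
      _ ≤ ∫⁻ s in Ioc 0 r, Φ s := setLIntegral_mono' measurableSet_Ioc fun s hs => hΦa hs.2
      _ ≤ _ := lintegral_mono_set Ioc_subset_Ioi_self
  have hBb : ∀ r, 0 ≤ r → ∀ θ ∈ Icc (0:ℝ) Real.pi,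
      B r (Real.cos θ) ≤ (∫⁻ r in Ioi 0, Φ r).toReal := by
    intro r hr θ hθ
    rcases hr.eq_or_lt with rfl | hr
    · rw [hR0 0 le_rfl hR.le θ hθ]; exact ENNReal.toReal_nonneg
    · exact (hφ r hr θ hθ).trans ((ENNReal.ofReal_le_iff_le_toReal hΦi.ne).1 (hφb r hr))
  have hcrossE : ∀ r, 0 ≤ r → crossE B r =
      ENNReal.ofReal (2 * Real.pi * ∫ τ in (0 : ℝ)..Real.pi, B r (Real.cos τ) * Real.sin τ) := by
    intro r hr
    have hm : Measurable fun τ => B r (Real.cos τ) :=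
      hB.measurable.comp (f := fun τ : ℝ => (r, Real.cos τ)) (by fun_prop)
    have hsin : ∀ τ ∈ Ioc 0 Real.pi, 0 ≤ Real.sin τ := fun τ hτ =>
      Real.sin_nonneg_of_nonneg_of_le_pi hτ.1.le hτ.2
    have hcs : ∀ τ, 0 ≤ B r (Real.cos τ) := fun τ =>
      hB.nonneg _ hr _ ⟨Real.neg_one_le_cos _, Real.cos_le_one _⟩
    rw [crossE, ENNReal.ofReal_mul (p := 2 * Real.pi) (by positivity), intervalIntegral.integral_of_le Real.pi_pos.le,
      ofReal_integral_eq_lintegral_ofReal]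
    · rw [setLIntegral_congr Ioo_ae_eq_Ioc]
      congr 1
      refine setLIntegral_congr_fun measurableSet_Ioc fun τ hτ => ?_
      rw [mul_comm (B _ _), ENNReal.ofReal_mul (hsin τ hτ)]
    · refine Measure.integrableOn_of_bounded (M := (∫⁻ r in Ioi 0, Φ r).toReal) (by simp)
        (hm.mul Real.measurable_sin).aestronglyMeasurable ?_
      filter_upwards [ae_restrict_mem measurableSet_Ioc] with τ hτ
      rw [Real.norm_of_nonneg (mul_nonneg (hcs τ) (hsin τ hτ))]
      calc _ ≤ B r (Real.cos τ) * 1 :=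
            mul_le_mul_of_nonneg_left (Real.sin_le_one _) (hcs τ)
        _ ≤ _ := by rw [mul_one]; exact hBb r hr τ (Ioc_subset_Icc_self hτ)
    · filter_upwards [ae_restrict_mem measurableSet_Ioc] with τ hτ
      exact mul_nonneg (hcs τ) (hsin τ hτ)
  refine ⟨(∫⁻ r in Ioi 0, Φ r).toReal, R₀, δ, Φ, hB.measurable, hR, hδ,
    hΦa, hΦi, hk0, ?_, hkz, ?_, ?_, ?_⟩
  · intro y
    obtain ⟨θ, hθ, h⟩ := hcos y
    rw [kern, h]
    exact hBb _ (norm_nonneg _) θ hθ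
  · intro y
    rcases (norm_nonneg (y.1 - y.2.1)).eq_or_lt with h0 | h0
    · rw [kernE, hkz y (by rw [← h0]; exact hR.le)]; simp
    · obtain ⟨θ, hθ, h⟩ := hcos y
      have : Φ ‖y.1 - y.2.1‖ = ENNReal.ofReal (φ ‖y.1 - y.2.1‖) := by
        simp only [hΦ]; rw [if_neg (not_le.2 h0)]
      rw [this, ← ENNReal.ofReal_mul' h0.le, kernE, kern, h]
      exact ENNReal.ofReal_le_ofReal (hφ _ h0 θ hθ)
  · intro y
    obtain ⟨θ, hθ, h⟩ := hcos y
    rw [hcrossE _ (norm_nonneg _), kernE, kern, h, ← ENNReal.ofReal_mul hδ.le]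
    exact ENNReal.ofReal_le_ofReal (hδ' _ (norm_nonneg _) θ hθ)
  · intro v vs
    -- For `v = v⋆` there is no axis to which Archimedes' theorem could be applied, but both sides
    -- vanish by the cutoff.
    by_cases hv : v - vs = 0
    · have h1 : ∀ σ : Sph, kernE B (v, (vs, σ)) = 0 := fun σ => by
        rw [kernE, hkz _ (by simp [hv, hR.le])]; simp
      have h2 : crossE B ‖v - vs‖ = 0 := by
        rw [crossE, mul_eq_zero]
        right
        rw [setLIntegral_congr_fun (g := 0) measurableSet_Ioo]
        · simp
        · intro θ hθ
          simp only
          rw [hv, norm_zero, hR0 0 le_rfl hR.le θ (Ioo_subset_Icc_self hθ)]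
          simp
      rw [h2]; simp [h1]
    · have he : ‖‖v - vs‖⁻¹ • (v - vs)‖ = 1 := by simp [norm_smul, hv]
      exact lintegral_surf_inner _ he (fun ξ => ENNReal.ofReal (B ‖v - vs‖ ξ))
        (hB.measurable.comp (f := fun ξ : ℝ => (‖v - vs‖, ξ)) (by fun_prop)).ennreal_ofReal

namespace GoodKernel

variable {B : ℝ → ℝ → ℝ} {b R₀ δ : ℝ} {Φ : ℝ → ℝ≥0∞}

lemma kernE_le (hK : GoodKernel B b R₀ δ Φ) (y : Col) : kernE B y ≤ ENNReal.ofReal b := by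
  rw [kernE]
  exact ENNReal.ofReal_le_ofReal (hK.kern_le y)

lemma crossE_eq_zero (hK : GoodKernel B b R₀ δ Φ) {v vs : Vel} (h : ‖v - vs‖ ≤ R₀) :
    crossE B ‖v - vs‖ = 0 := by
  rw [← hK.lintegral_kernE]
  have : ∀ σ : Sph, kernE B (v, (vs, σ)) = 0 := fun σ => by
    rw [kernE, hK.kern_eq_zero (v, (vs, σ)) h, ENNReal.ofReal_zero]
  simp [this]

lemma crossE_le_majorant (hK : GoodKernel B b R₀ δ Φ) (v vs : Vel) :
    crossE B ‖v - vs‖ ≤ surf univ * (Φ ‖v - vs‖ * ENNReal.ofReal ‖v - vs‖) := by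
  rw [← hK.lintegral_kernE]
  refine (lintegral_mono fun σ => hK.kernE_le_majorant (v, (vs, σ))).trans ?_
  simp only [lintegral_const]
  rw [mul_comm]

lemma crossE_le (hK : GoodKernel B b R₀ δ Φ) (v vs : Vel) :
    crossE B ‖v - vs‖ ≤ surf univ * ENNReal.ofReal b := by
  rw [← hK.lintegral_kernE]
  refine (lintegral_mono fun σ => hK.kernE_le (v, (vs, σ))).trans ?_
  simp only [lintegral_const]
  rw [mul_comm]

end GoodKernel

/-! ### Bounds for the transported gain term -/

/-- The first component of a point of the sphere of centre `c` and radius `r / 2` has bounded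
density. -/
lemma lintegral_surf_affine_le (h : ℝ → ℝ≥0∞) (hh : Measurable h) (c r : ℝ) (hr : 0 < r) :
    ENNReal.ofReal r * ∫⁻ σ : Sph, h (c + r / 2 * (σ : Vel) 0) ∂surf ≤
      ENNReal.ofReal (4 * Real.pi) * ∫⁻ w in Icc (c - r / 2) (c + r / 2), h w := by
  rw [lintegral_surf_fst (fun z => h (c + r / 2 * z)) (by fun_prop)]
  -- The substitution `w = c + (r/2) cos θ` absorbs the weight `sin θ`: the law of `w` is uniform on
  -- an interval of length `r`.
  set F : ℝ → ℝ := fun θ => c + r / 2 * Real.cos θ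
  have hder : ∀ θ ∈ Ioo 0 Real.pi, HasDerivWithinAt F (r / 2 * -Real.sin θ) (Ioo 0 Real.pi) θ :=
    fun θ _ => (((Real.hasDerivAt_cos θ).const_mul _).const_add _).hasDerivWithinAt
  have hinj : InjOn F (Ioo 0 Real.pi) := by
    intro x hx y hy hxy
    have : Real.cos x = Real.cos y := by
      have : r / 2 * Real.cos x = r / 2 * Real.cos y := by simpa [F] using hxy
      exact mul_left_cancel₀ (by positivity) this
    exact Real.injOn_cos (Ioo_subset_Icc_self hx) (Ioo_subset_Icc_self hy) this
  have himg : F '' Ioo 0 Real.pi ⊆ Icc (c - r / 2) (c + r / 2) := by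
    rintro _ ⟨θ, -, rfl⟩
    have h1 := Real.neg_one_le_cos θ
    have h2 := Real.cos_le_one θ
    constructor <;> simp only [F] <;> nlinarith
  refine le_trans (le_of_eq ?_) (mul_le_mul_right (lintegral_mono_set himg) _)
  rw [lintegral_image_eq_lintegral_abs_deriv_mul measurableSet_Ioo hder hinj,
    ← mul_assoc, ← ENNReal.ofReal_mul hr.le, ← lintegral_const_mul _ (by fun_prop),
    ← lintegral_const_mul _ (by fun_prop)]
  refine setLIntegral_congr_fun measurableSet_Ioo fun θ hθ => ?_
  have hs := Real.sin_pos_of_mem_Ioo hθ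
  simp only [F]
  rw [← mul_assoc, ← mul_assoc, ← ENNReal.ofReal_mul (by positivity), mul_neg, abs_neg,
    abs_of_pos (by positivity), ← mul_assoc (ENNReal.ofReal (4 * Real.pi)),
    ← ENNReal.ofReal_mul (by positivity)]
  congr 2
  ring

lemma map_affine_volume (x : ℝ) {τ : ℝ} (hτ : 0 < τ) :
    Measure.map (fun w : ℝ => x - τ * w) volume = ENNReal.ofReal τ⁻¹ • volume := by
  have h1 : (fun w : ℝ => x - τ * w) = (fun w => x - w) ∘ (fun w => τ * w) := rfl
  rw [h1, ← Measure.map_map (by fun_prop) (by fun_prop), Real.map_volume_mul_left hτ.ne',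
    Measure.map_smul, (Measure.measurePreserving_sub_left (volume : Measure ℝ) x).map_eq,
    abs_of_pos (inv_pos.2 hτ)]

lemma lintegral_comp_affine (x : ℝ) {τ : ℝ} (hτ : 0 < τ) (g : ℝ → ℝ≥0∞) (hg : Measurable g) :
    ENNReal.ofReal τ * ∫⁻ w, g (x - τ * w) = ∫⁻ y, g y := by
  rw [← lintegral_map (f := g) (g := fun w : ℝ => x - τ * w) hg (by fun_prop),
    map_affine_volume x hτ, lintegral_smul_measure, smul_eq_mul, ← mul_assoc,
    ← ENNReal.ofReal_mul hτ.le, mul_inv_cancel₀ hτ.ne', ENNReal.ofReal_one, one_mul]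

lemma ae_comp_affine (x : ℝ) {τ : ℝ} (hτ : 0 < τ) {P : ℝ → Prop} (h : ∀ᵐ y, P y) :
    ∀ᵐ w, P (x - τ * w) := by
  have hq : Measure.QuasiMeasurePreserving (fun w : ℝ => x - τ * w) volume volume := by
    refine ⟨by fun_prop, ?_⟩
    rw [map_affine_volume x hτ]
    exact Measure.smul_absolutelyContinuous
  exact hq.ae h

/-- The gain part of the collision operator, for a non-negative density. -/
def gainE (B : ℝ → ℝ → ℝ) (e : Phase → ℝ≥0∞) (p : Phase) : ℝ≥0∞ :=
  ∫⁻ z : Vel × Sph, kernE B (p.2, z) *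
    (e (p.1, postVs p.2 z.1 z.2) * e (p.1, postV p.2 z.1 z.2)) ∂((volume : Measure Vel).prod surf)

/-- The total number of collisions. -/
def dissip (B : ℝ → ℝ → ℝ) (e : Phase → ℝ≥0∞) : ℝ≥0∞ :=
  ∫⁻ y : ℝ, ∫⁻ v : Vel, ∫⁻ vs : Vel, crossE B ‖v - vs‖ * (e (y, vs) * e (y, v))

lemma postV_zero (v vs : Vel) (σ : Vel) :
    postV v vs σ 0 = (v 0 + vs 0) / 2 + ‖v - vs‖ / 2 * σ 0 := by
  simp [postV]
  ring

section

variable {B : ℝ → ℝ → ℝ} {b R₀ δ : ℝ} {Φ : ℝ → ℝ≥0∞} {e : Phase → ℝ≥0∞}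

/-- The pre-post change of variables removes `σ` from the velocities of the two densities and puts
it into their common position, where averaging over the sphere can smooth. -/
lemma lintegral_gainE_eq (hB : Measurable (Function.uncurry B)) (he : Measurable e) (x τ : ℝ) :
    ∫⁻ v : Vel, gainE B e (x - τ * v 0, v) = ∫⁻ v : Vel, ∫⁻ vs : Vel, ∫⁻ σ,
      kernE B (v, (vs, σ)) * (e (x - τ * postV v vs σ 0, vs) * e (x - τ * postV v vs σ 0, v))
        ∂surf := by
  have hk := measurable_kernE hB
  have hm : Measurable fun y : Col => kernE B y * (e (x - τ * y.1 0, (collide y).2.1) *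
      e (x - τ * y.1 0, (collide y).1)) := by fun_prop
  have h1 : ∫⁻ v : Vel, gainE B e (x - τ * v 0, v) = ∫⁻ y, kernE B y *
      (e (x - τ * y.1 0, (collide y).2.1) * e (x - τ * y.1 0, (collide y).1)) ∂colMeas := by
    rw [lintegral_prod _ hm.aemeasurable]
    rfl
  rw [h1, ← lintegral_collide _ hm]
  have h2 : ∀ y, kernE B (collide y) = kernE B y := fun y => by rw [kernE, kern_collide, kernE]
  simp only [collide_collide, h2]
  rw [lintegral_prod _ (by fun_prop)]
  refine lintegral_congr fun v => ?_
  rw [lintegral_prod _ (by fun_prop)]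
  rfl

/-- Bounding the differential cross section by the total one takes the kernel out of the
`σ`-integral; what is left depends on `σ` through `σ₁` alone. -/
lemma GoodKernel.lintegral_gainE_le (hK : GoodKernel B b R₀ δ Φ) (he : Measurable e) (x τ : ℝ) :
    ENNReal.ofReal δ * ∫⁻ v : Vel, gainE B e (x - τ * v 0, v) ≤ ∫⁻ v : Vel, ∫⁻ vs : Vel,
      crossE B ‖v - vs‖ * ∫⁻ σ : Sph, (fun w => e (x - τ * w, vs) * e (x - τ * w, v))
        ((v 0 + vs 0) / 2 + ‖v - vs‖ / 2 * (σ : Vel) 0) ∂surf := by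
  rw [lintegral_gainE_eq hK.measurable he, ← lintegral_const_mul' _ _ ENNReal.ofReal_ne_top]
  refine lintegral_mono fun v => ?_
  simp only
  rw [← lintegral_const_mul' _ _ ENNReal.ofReal_ne_top]
  refine lintegral_mono fun vs => ?_
  simp only
  rw [← lintegral_const_mul' _ _ ENNReal.ofReal_ne_top, ← lintegral_const_mul _ (by fun_prop)]
  refine lintegral_mono fun σ => ?_
  simp only
  rw [← mul_assoc, postV_zero]
  exact mul_le_mul_left (hK.kernE_le_cross (v, (vs, σ))) _

/-- As `σ` varies, the position `x - τ v'₁` is uniform on an interval of length `τ |v - v⋆|`, which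
exceeds `τ R₀` wherever the kernel does not vanish. The spherical average is thus at most a multiple
of `1 / (τ R₀)` times the integral over all positions. -/
lemma GoodKernel.lintegral_gainE_le_dissip (hK : GoodKernel B b R₀ δ Φ) (he : Measurable e)
    (x : ℝ) {τ : ℝ} (hτ : 0 < τ) :
    ENNReal.ofReal (τ * R₀ * δ) * ∫⁻ v : Vel, gainE B e (x - τ * v 0, v) ≤
      ENNReal.ofReal (4 * Real.pi) * dissip B e := by
  have hc := measurable_crossE hK.measurable
  have h1 : ∀ v vs : Vel, ENNReal.ofReal (τ * R₀) * (crossE B ‖v - vs‖ * ∫⁻ σ : Sph,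
      (fun w => e (x - τ * w, vs) * e (x - τ * w, v))
        ((v 0 + vs 0) / 2 + ‖v - vs‖ / 2 * (σ : Vel) 0) ∂surf) ≤
      ENNReal.ofReal (4 * Real.pi) * (∫⁻ y : ℝ, crossE B ‖v - vs‖ * (e (y, vs) * e (y, v))) := by
    intro v vs
    rcases le_or_gt ‖v - vs‖ R₀ with h | h
    · simp [hK.crossE_eq_zero h]
    rw [ENNReal.ofReal_mul hτ.le, lintegral_const_mul _ (by fun_prop)]
    set I := ∫⁻ σ : Sph, (fun w => e (x - τ * w, vs) * e (x - τ * w, v))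
        ((v 0 + vs 0) / 2 + ‖v - vs‖ / 2 * (σ : Vel) 0) ∂surf with hI
    calc ENNReal.ofReal τ * ENNReal.ofReal R₀ * (crossE B ‖v - vs‖ * I)
        = crossE B ‖v - vs‖ * (ENNReal.ofReal τ * (ENNReal.ofReal R₀ * I)) := by ring
      _ ≤ crossE B ‖v - vs‖ * (ENNReal.ofReal τ * (ENNReal.ofReal ‖v - vs‖ * I)) := by
          gcongr
      _ ≤ crossE B ‖v - vs‖ * (ENNReal.ofReal τ * (ENNReal.ofReal (4 * Real.pi) *
            ∫⁻ w, (e (x - τ * w, vs) * e (x - τ * w, v)))) := by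
          refine mul_le_mul_right (mul_le_mul_right ?_ _) _
          refine (lintegral_surf_affine_le (fun w => e (x - τ * w, vs) * e (x - τ * w, v))
            (by fun_prop) _ _ (hK.R_pos.trans h)).trans ?_
          gcongr
          exact Measure.restrict_le_self
      _ = crossE B ‖v - vs‖ * (ENNReal.ofReal (4 * Real.pi) * (ENNReal.ofReal τ *
            ∫⁻ w, (e (x - τ * w, vs) * e (x - τ * w, v)))) := by ring
      _ = _ := by
          rw [lintegral_comp_affine x hτ (fun y => e (y, vs) * e (y, v)) (by fun_prop)]
          ring
  have h2 : dissip B e = ∫⁻ v : Vel, ∫⁻ vs : Vel, ∫⁻ y : ℝ,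
      crossE B ‖v - vs‖ * (e (y, vs) * e (y, v)) := by
    rw [dissip, lintegral_lintegral_swap]
    · refine lintegral_congr fun v => ?_
      rw [lintegral_lintegral_swap]
      exact Measurable.aemeasurable (by fun_prop)
    · exact (Measurable.lintegral_prod_right' (f := fun p : (ℝ × Vel) × Vel =>
        crossE B ‖p.1.2 - p.2‖ * (e (p.1.1, p.2) * e (p.1.1, p.1.2))) (by fun_prop)).aemeasurable
  have hδ := hK.delta_pos
  have hR := hK.R_pos
  calc _ = ENNReal.ofReal (τ * R₀) * (ENNReal.ofReal δ *
        ∫⁻ v : Vel, gainE B e (x - τ * v 0, v)) := by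
        rw [ENNReal.ofReal_mul (by positivity), mul_assoc]
    _ ≤ ENNReal.ofReal (τ * R₀) * _ := mul_le_mul_right (hK.lintegral_gainE_le he x τ) _
    _ ≤ ENNReal.ofReal (4 * Real.pi) * dissip B e := by
        rw [h2, ← lintegral_const_mul' _ _ ENNReal.ofReal_ne_top,
          ← lintegral_const_mul' _ _ ENNReal.ofReal_ne_top]
        refine lintegral_mono fun v => ?_
        simp only
        rw [← lintegral_const_mul' _ _ ENNReal.ofReal_ne_top,
          ← lintegral_const_mul' _ _ ENNReal.ofReal_ne_top]
        exact lintegral_mono fun vs => h1 v vs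

lemma lintegral_comp_abs (g : ℝ → ℝ≥0∞) :
    ∫⁻ u : ℝ, g |u| = 2 * ∫⁻ u in Ioi (0:ℝ), g u := by
  have h1 : ∫⁻ u in Iic (0:ℝ), g |u| = ∫⁻ u in Ioi (0:ℝ), g u := by
    rw [setLIntegral_congr Iio_ae_eq_Iic.symm,
      ← (Measure.measurePreserving_neg (volume : Measure ℝ)).setLIntegral_comp_preimage_emb
        (Homeomorph.neg ℝ).measurableEmbedding]
    simp only [Set.neg_preimage, Set.neg_Iio, neg_zero]
    exact setLIntegral_congr_fun measurableSet_Ioi fun u hu => by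
      simp [abs_of_pos (mem_Ioi.1 hu)]
  have h2 : ∫⁻ u in Ioi (0:ℝ), g |u| = ∫⁻ u in Ioi (0:ℝ), g u :=
    setLIntegral_congr_fun measurableSet_Ioi fun u hu => by simp [abs_of_pos (mem_Ioi.1 hu)]
  rw [← lintegral_add_compl _ (measurableSet_Ioi (a := (0:ℝ))), compl_Ioi, h1, h2, two_mul]

/-- The factor `r = |v - v⋆|` in the majorant `Φ(r) r` cancels the density `1 / r` of `v'₁`. The
remaining `Φ(r)` is at most `Φ(|w - v₁|)` for each value `w` of `v'₁`, which no longer involves `v⋆`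
and is integrable in `w`. Integrating in `v⋆` and then in `v` costs one factor `M` each, uniformly
in `τ`. -/
lemma GoodKernel.lintegral_gainE_le_sq (hK : GoodKernel B b R₀ δ Φ) (he : Measurable e)
    (x : ℝ) {τ : ℝ} (hτ : 0 < τ) {M : ℝ≥0∞} (h0 : ∀ᵐ y : ℝ, ∫⁻ v : Vel, e (y, v) ≤ M)
    (h1 : ∀ᵐ y : ℝ, ∫⁻ v : Vel, e (y - τ * v 0, v) ≤ M) :
    ENNReal.ofReal δ * ∫⁻ v : Vel, gainE B e (x - τ * v 0, v) ≤
      surf univ * ENNReal.ofReal (4 * Real.pi) * (2 * ∫⁻ r in Ioi (0:ℝ), Φ r) * M ^ 2 := by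
  have hΦ : Measurable Φ := hK.antitone.measurable
  have key : ∀ v vs : Vel, crossE B ‖v - vs‖ * ∫⁻ σ : Sph,
      (fun w => e (x - τ * w, vs) * e (x - τ * w, v))
        ((v 0 + vs 0) / 2 + ‖v - vs‖ / 2 * (σ : Vel) 0) ∂surf ≤
      surf univ * ENNReal.ofReal (4 * Real.pi) *
        ∫⁻ w, Φ |w - v 0| * (e (x - τ * w, vs) * e (x - τ * w, v)) := by
    intro v vs
    rcases le_or_gt ‖v - vs‖ R₀ with h | h
    · simp [hK.crossE_eq_zero h]
    set I := ∫⁻ σ : Sph, (fun w => e (x - τ * w, vs) * e (x - τ * w, v))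
        ((v 0 + vs 0) / 2 + ‖v - vs‖ / 2 * (σ : Vel) 0) ∂surf with hI
    calc crossE B ‖v - vs‖ * I
        ≤ surf univ * (Φ ‖v - vs‖ * ENNReal.ofReal ‖v - vs‖) * I :=
          mul_le_mul_left (hK.crossE_le_majorant v vs) _
      _ = surf univ * Φ ‖v - vs‖ * (ENNReal.ofReal ‖v - vs‖ * I) := by ring
      _ ≤ surf univ * Φ ‖v - vs‖ * (ENNReal.ofReal (4 * Real.pi) *
            ∫⁻ w in Icc ((v 0 + vs 0) / 2 - ‖v - vs‖ / 2) ((v 0 + vs 0) / 2 + ‖v - vs‖ / 2),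
              (e (x - τ * w, vs) * e (x - τ * w, v))) := by
          refine mul_le_mul_right ?_ _
          exact lintegral_surf_affine_le (fun w => e (x - τ * w, vs) * e (x - τ * w, v))
            (by fun_prop) _ _ (hK.R_pos.trans h)
      _ = surf univ * ENNReal.ofReal (4 * Real.pi) *
            ∫⁻ w in Icc ((v 0 + vs 0) / 2 - ‖v - vs‖ / 2) ((v 0 + vs 0) / 2 + ‖v - vs‖ / 2),
              Φ ‖v - vs‖ * (e (x - τ * w, vs) * e (x - τ * w, v)) := by
          rw [lintegral_const_mul _ (by fun_prop)]
          ring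
      _ ≤ surf univ * ENNReal.ofReal (4 * Real.pi) *
            ∫⁻ w in Icc ((v 0 + vs 0) / 2 - ‖v - vs‖ / 2) ((v 0 + vs 0) / 2 + ‖v - vs‖ / 2),
              Φ |w - v 0| * (e (x - τ * w, vs) * e (x - τ * w, v)) := by
          refine mul_le_mul_right ?_ _
          refine setLIntegral_mono' measurableSet_Icc fun w hw => ?_
          gcongr
          apply hK.antitone
          -- Both `w` and `v₁` lie within `|v - v⋆| / 2` of the midpoint `(v₁ + v⋆₁) / 2`.
          have h2 : |v 0 - vs 0| ≤ ‖v - vs‖ := by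
            have := PiLp.norm_apply_le (v - vs) 0
            simpa using this
          have h3 := abs_le.1 h2
          rw [abs_le]
          constructor <;> linarith [hw.1, hw.2, h3.1, h3.2]
      _ ≤ _ := by
          gcongr
          exact Measure.restrict_le_self
  refine (hK.lintegral_gainE_le he x τ).trans ?_
  refine (lintegral_mono fun v => lintegral_mono fun vs => key v vs).trans ?_
  have hS : surf univ * ENNReal.ofReal (4 * Real.pi) ≠ ⊤ :=
    ENNReal.mul_ne_top (measure_ne_top _ _) ENNReal.ofReal_ne_top
  simp only [lintegral_const_mul' _ _ hS]
  rw [mul_assoc (surf univ * ENNReal.ofReal (4 * Real.pi))]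
  refine mul_le_mul_right ?_ _
  have hw0 := ae_comp_affine x hτ h0
  have hw1 := ae_comp_affine x hτ h1
  calc ∫⁻ v : Vel, ∫⁻ vs : Vel, ∫⁻ w, Φ |w - v 0| * (e (x - τ * w, vs) * e (x - τ * w, v))
      = ∫⁻ v : Vel, ∫⁻ w, (∫⁻ vs : Vel, e (x - τ * w, vs)) *
          (Φ |w - v 0| * e (x - τ * w, v)) := by
        refine lintegral_congr fun v => ?_
        rw [lintegral_lintegral_swap (Measurable.aemeasurable (by fun_prop))]
        refine lintegral_congr fun w => ?_
        rw [← lintegral_mul_const _ (by fun_prop)]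
        refine lintegral_congr fun vs => ?_
        ring
    _ ≤ ∫⁻ v : Vel, ∫⁻ w, M * (Φ |w - v 0| * e (x - τ * w, v)) := by
        refine lintegral_mono fun v => lintegral_mono_ae ?_
        filter_upwards [hw0] with w hw
        gcongr
    _ = M * ∫⁻ v : Vel, ∫⁻ w, Φ |w - v 0| * e (x - τ * w, v) := by
        rw [← lintegral_const_mul]
        · refine lintegral_congr fun v => ?_
          rw [lintegral_const_mul _ (by fun_prop)]
        · exact Measurable.lintegral_prod_right' (f := fun p : Vel × ℝ =>
            Φ |p.2 - p.1 0| * e (x - τ * p.2, p.1)) (by fun_prop)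
    -- The shift `w = u + v₁` produces the transported density; bounding it is the reason for the
    -- supremum over transports in the norm of `X`.
    _ = M * ∫⁻ v : Vel, ∫⁻ u, Φ |u| * e (x - τ * u - τ * v 0, v) := by
        congr 1
        refine lintegral_congr fun v => ?_
        rw [← lintegral_add_right_eq_self _ (v 0)]
        refine lintegral_congr fun u => ?_
        simp only [add_sub_cancel_right, mul_add, sub_sub]
    _ = M * ∫⁻ u, Φ |u| * ∫⁻ v : Vel, e (x - τ * u - τ * v 0, v) := by
        rw [lintegral_lintegral_swap (Measurable.aemeasurable (by fun_prop))]
        congr 1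
        refine lintegral_congr fun u => ?_
        rw [lintegral_const_mul _ (by fun_prop)]
    _ ≤ M * ∫⁻ u, Φ |u| * M := by
        refine mul_le_mul_right ?_ _
        refine lintegral_mono_ae ?_
        filter_upwards [hw1] with u hu
        gcongr
    _ = _ := by
        rw [lintegral_mul_const _ (by fun_prop), lintegral_comp_abs Φ]
        ring

end

/-! ### Decay of free transport -/

/-- The free flow, run backwards for a time `q`. -/
def shear (q : ℝ) (p : Phase) : Phase := (p.1 - q * p.2 0, p.2)

@[fun_prop]
lemma measurable_shear {α : Type*} [MeasurableSpace α] {q : α → ℝ} {p : α → Phase}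
    (hq : Measurable q) (hp : Measurable p) : Measurable fun a => shear (q a) (p a) := by
  unfold shear; fun_prop

lemma measurePreserving_shear (q : ℝ) : MeasurePreserving (shear q) volume volume := by
  refine ⟨by fun_prop, Measure.ext_of_lintegral _ fun G hG => ?_⟩
  rw [lintegral_map hG (by fun_prop), Measure.volume_eq_prod, lintegral_prod_symm _ (by fun_prop),
    lintegral_prod_symm _ (by fun_prop)]
  refine lintegral_congr fun v => ?_
  exact lintegral_sub_right_eq_self (fun x => G (x, v)) (q * v 0)

lemma shear_shear (q r : ℝ) (p : Phase) : shear q (shear r p) = shear (q + r) p := by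
  simp only [shear, Prod.mk.injEq, and_true]
  ring

lemma shear_zero (p : Phase) : shear 0 p = p := by simp [shear]

lemma transport_apply (q : ℝ) (f : Phase → ℝ) (p : Phase) : transport q f p = f (shear q p) := rfl

/-- A smooth bump function on phase space, equal to `1` on the unit ball. -/
def phaseBump : ContDiffBump (0 : Phase) := ⟨1, 2, one_pos, one_lt_two⟩

/-- For a primitive `Ψ` of `ψ`, the function `q ψ(x + q v₁)` is the `v₁`-derivative of `Ψ(x + q
v₁)`. Integration by parts puts the derivative on `g`, and `0 ≤ Ψ ≤ ∫ ψ`. -/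
lemma weakDeriv_test_le {g w : Phase → ℝ} (hg : Integrable g) (hw : Integrable w)
    (hgw : HasWeakDeriv g (0, EuclideanSpace.single 0 1) w) {q : ℝ}
    {ψ : ℝ → ℝ} (hψ : ContDiff ℝ ∞ ψ) (hc : HasCompactSupport ψ) (h0 : ∀ u, 0 ≤ ψ u) :
    q * ∫ p : Phase, g p * ψ (p.1 + q * p.2 0) ≤ (∫ p, ‖w p‖) * ∫ u, ψ u := by
  obtain ⟨C, hC⟩ := hψ.continuous.bounded_above_of_compact_support hc
  have hψi : Integrable ψ := hψ.continuous.integrable_of_hasCompactSupport hc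
  set Ψ : ℝ → ℝ := fun u => ∫ s in Iic u, ψ s with hΨ
  have hΨd : ∀ u, HasDerivAt Ψ (ψ u) u := by
    intro u
    have h1 : Ψ = fun u => (∫ s in Iic 0, ψ s) + ∫ s in (0:ℝ)..u, ψ s := by
      ext u
      rw [← intervalIntegral.integral_Iic_sub_Iic hψi.integrableOn hψi.integrableOn]
      ring
    rw [h1]
    exact (intervalIntegral.integral_hasDerivAt_right (hψi.intervalIntegrable)
      hψ.continuous.stronglyMeasurable.stronglyMeasurableAtFilter
      hψ.continuous.continuousAt).const_add _
  have hΨs : ContDiff ℝ ∞ Ψ := by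
    rw [contDiff_infty_iff_deriv]
    exact ⟨fun u => (hΨd u).differentiableAt, by
      rw [show deriv Ψ = ψ from funext fun u => (hΨd u).deriv]; exact hψ⟩
  have hΨ0 : ∀ u, 0 ≤ Ψ u := fun u => integral_nonneg h0
  have hΨ1 : ∀ u, Ψ u ≤ ∫ s, ψ s := fun u =>
    setIntegral_le_integral hψi (Eventually.of_forall h0)
  set e1 : Phase := (0, EuclideanSpace.single 0 1) with he1
  set ℓ : Phase → ℝ := fun p => p.1 + q * p.2 0 with hℓ
  have hℓs : ContDiff ℝ ∞ ℓ := by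
    have : ContDiff ℝ ∞ fun p : Phase => p.2 0 := by
      exact (EuclideanSpace.proj (0 : Fin 3) : Vel →L[ℝ] ℝ).contDiff.comp contDiff_snd
    exact contDiff_fst.add (contDiff_const.mul this)
  have hℓd : ∀ p, fderiv ℝ ℓ p e1 = q := by
    intro p
    have h2 : HasFDerivAt ℓ (ContinuousLinearMap.fst ℝ ℝ Vel +
        q • ((EuclideanSpace.proj (0 : Fin 3) : Vel →L[ℝ] ℝ).comp
          (ContinuousLinearMap.snd ℝ ℝ Vel))) p :=
      (ContinuousLinearMap.fst ℝ ℝ Vel + q • ((EuclideanSpace.proj (0 : Fin 3) : Vel →L[ℝ] ℝ).comp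
          (ContinuousLinearMap.snd ℝ ℝ Vel))).hasFDerivAt
    rw [h2.fderiv]
    simp [he1]
  -- `Ψ(x + q v₁)` has no compact support. These cutoffs increase to the whole space, and their
  -- derivatives are of size `1 / (n + 1)`, so the error they cause disappears in the limit.
  set χ : ℕ → Phase → ℝ := fun n p => phaseBump (((n : ℝ) + 1)⁻¹ • p) with hχ
  have hχs : ∀ n, ContDiff ℝ ∞ (χ n) := fun n =>
    phaseBump.contDiff.comp (contDiff_const_smul _)
  have hχc : ∀ n, HasCompactSupport (χ n) := fun n =>
    phaseBump.hasCompactSupport.comp_smul (by positivity)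
  have hχ1 : ∀ n p, |χ n p| ≤ 1 := fun n p => by
    rw [abs_of_nonneg phaseBump.nonneg]; exact phaseBump.le_one
  have hbd : ContDiff ℝ ∞ (phaseBump : Phase → ℝ) := phaseBump.contDiff
  obtain ⟨D, hD⟩ := (hbd.continuous_fderiv (by simp)).bounded_above_of_compact_support
    (phaseBump.hasCompactSupport.fderiv ℝ)
  have hχd : ∀ n p, |fderiv ℝ (χ n) p e1| ≤ ((n : ℝ) + 1)⁻¹ * (D * ‖e1‖) := by
    intro n p
    have h3 : HasFDerivAt (χ n) ((fderiv ℝ phaseBump (((n : ℝ) + 1)⁻¹ • p)).comp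
        (((n : ℝ) + 1)⁻¹ • ContinuousLinearMap.id ℝ Phase)) p :=
      ((hbd.differentiable (by simp)) _).hasFDerivAt.comp p
        ((((n : ℝ) + 1)⁻¹ • ContinuousLinearMap.id ℝ Phase).hasFDerivAt)
    rw [h3.fderiv]
    simp only [ContinuousLinearMap.comp_apply, _root_.smul_apply,
      ContinuousLinearMap.id_apply, map_smul, smul_eq_mul, abs_mul]
    rw [abs_of_nonneg (by positivity : (0:ℝ) ≤ ((n : ℝ) + 1)⁻¹)]
    gcongr
    exact ((fderiv ℝ phaseBump (((n : ℝ) + 1)⁻¹ • p)).le_opNorm e1).trans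
      (mul_le_mul_of_nonneg_right (hD _) (norm_nonneg _))
  have hI0 : 0 ≤ ∫ s, ψ s := integral_nonneg h0
  have hb1 : ∀ n p, ‖ψ (ℓ p) * q * χ n p‖ ≤ C * |q| := fun n p => by
    rw [norm_mul, norm_mul, ← mul_one (C * |q|)]
    exact mul_le_mul (mul_le_mul_of_nonneg_right (hC _) (norm_nonneg q)) (hχ1 n p)
      (norm_nonneg _) (mul_nonneg ((norm_nonneg _).trans (hC 0)) (abs_nonneg q))
  have hb0 : ∀ p, ‖Ψ (ℓ p)‖ ≤ ∫ s, ψ s := fun p => by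
    rw [Real.norm_of_nonneg (hΨ0 _)]; exact hΨ1 _
  have hb2 : ∀ n p, ‖Ψ (ℓ p) * χ n p‖ ≤ ∫ s, ψ s := fun n p => by
    rw [norm_mul, ← mul_one (∫ s, ψ s)]
    exact mul_le_mul (hb0 p) (hχ1 n p) (norm_nonneg _) hI0
  have hb3 : ∀ n p, ‖Ψ (ℓ p) * fderiv ℝ (χ n) p e1‖ ≤
      (∫ s, ψ s) * (((n : ℝ) + 1)⁻¹ * (D * ‖e1‖)) := fun n p => by
    rw [norm_mul]
    exact mul_le_mul (hb0 p) (hχd n p) (norm_nonneg _) hI0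
  have hid : ∀ n : ℕ, (∫ p, g p * (ψ (ℓ p) * q * χ n p)) =
      - (∫ p, w p * (Ψ (ℓ p) * χ n p)) - ∫ p, g p * (Ψ (ℓ p) * fderiv ℝ (χ n) p e1) := by
    intro n
    have h4 := hgw.integral_eq (fun p => Ψ (ℓ p) * χ n p) ((hΨs.comp hℓs).mul (hχs n))
      ((hχc n).mul_left)
    rw [← h4, eq_sub_iff_add_eq, ← integral_add]
    · refine integral_congr_ae (Eventually.of_forall fun p => ?_)
      simp only
      have h5 : HasFDerivAt (fun p => Ψ (ℓ p)) (ψ (ℓ p) • fderiv ℝ ℓ p) p :=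
        (hΨd (ℓ p)).comp_hasFDerivAt p ((hℓs.differentiable (by simp)) p).hasFDerivAt
      have h6 : HasFDerivAt (fun p => Ψ (ℓ p) * χ n p) _ p :=
        h5.mul ((hχs n).differentiable (by simp) p).hasFDerivAt
      have h7 : fderiv ℝ (fun p => Ψ (ℓ p) * χ n p) p e1 =
          ψ (ℓ p) * q * χ n p + Ψ (ℓ p) * fderiv ℝ (χ n) p e1 := by
        rw [h6.fderiv]
        simp only [_root_.add_apply, _root_.smul_apply, smul_eq_mul,
          hℓd]
        ring
      rw [h7]; ring
    · refine hg.mul_bdd (c := C * |q|) ?_ ?_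
      · exact ((hψ.continuous.comp hℓs.continuous).mul continuous_const).mul
          (hχs n).continuous |>.aestronglyMeasurable
      · exact Eventually.of_forall fun p => hb1 n p
    · refine hg.mul_bdd (c := (∫ s, ψ s) * (((n : ℝ) + 1)⁻¹ * (D * ‖e1‖))) ?_ ?_
      · exact ((hΨs.continuous.comp hℓs.continuous).mul
          (((hχs n).continuous_fderiv (by simp)).clm_apply continuous_const)).aestronglyMeasurable
      · exact Eventually.of_forall fun p => hb3 n p
  have hle : ∀ n : ℕ, (∫ p, g p * (ψ (ℓ p) * q * χ n p)) ≤ (∫ p, ‖w p‖) * (∫ u, ψ u) +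
      (∫ p, ‖g p‖) * ((∫ u, ψ u) * (((n : ℝ) + 1)⁻¹ * (D * ‖e1‖))) := by
    intro n
    rw [hid n]
    have h8 : -(∫ p, w p * (Ψ (ℓ p) * χ n p)) ≤ (∫ p, ‖w p‖) * (∫ u, ψ u) := by
      refine (neg_le_abs _).trans ?_
      rw [← integral_mul_const]
      rw [← Real.norm_eq_abs]
      refine norm_integral_le_of_norm_le (hw.norm.mul_const _) (Eventually.of_forall fun p => ?_)
      rw [norm_mul]
      exact mul_le_mul_of_nonneg_left (hb2 n p) (norm_nonneg _)
    have h9 : -(∫ p, g p * (Ψ (ℓ p) * fderiv ℝ (χ n) p e1)) ≤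
        (∫ p, ‖g p‖) * ((∫ u, ψ u) * (((n : ℝ) + 1)⁻¹ * (D * ‖e1‖))) := by
      refine (neg_le_abs _).trans ?_
      rw [← integral_mul_const]
      rw [← Real.norm_eq_abs]
      refine norm_integral_le_of_norm_le (hg.norm.mul_const _) (Eventually.of_forall fun p => ?_)
      rw [norm_mul]
      exact mul_le_mul_of_nonneg_left (hb3 n p) (norm_nonneg _)
    linarith
  have hlim1 : Tendsto (fun n : ℕ => ∫ p, g p * (ψ (ℓ p) * q * χ n p)) atTop
      (𝓝 (∫ p, g p * (ψ (ℓ p) * q))) := by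
    refine tendsto_integral_of_dominated_convergence (fun p => ‖g p‖ * (C * |q|)) ?_
      (hg.norm.mul_const _) ?_ ?_
    · intro n
      exact hg.aestronglyMeasurable.mul (((hψ.continuous.comp hℓs.continuous).mul
        continuous_const).mul (hχs n).continuous).aestronglyMeasurable
    · intro n
      refine Eventually.of_forall fun p => ?_
      rw [norm_mul]
      exact mul_le_mul_of_nonneg_left (hb1 n p) (norm_nonneg _)
    · refine Eventually.of_forall fun p => ?_
      refine tendsto_const_nhds.congr' ?_
      obtain ⟨N, hN⟩ := exists_nat_ge ‖p‖
      filter_upwards [eventually_ge_atTop N] with n hn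
      have : χ n p = 1 := by
        refine phaseBump.one_of_mem_closedBall ?_
        rw [mem_closedBall_zero_iff, norm_smul, norm_inv, Real.norm_of_nonneg (by positivity)]
        change _ ≤ (1:ℝ)
        rw [inv_mul_le_iff₀ (by positivity), mul_one]
        have : (N : ℝ) ≤ n := by exact_mod_cast hn
        linarith
      rw [this, mul_one]
  have hlim2 : Tendsto (fun n : ℕ => (∫ p, ‖w p‖) * (∫ u, ψ u) +
      (∫ p, ‖g p‖) * ((∫ u, ψ u) * (((n : ℝ) + 1)⁻¹ * (D * ‖e1‖)))) atTop
      (𝓝 ((∫ p, ‖w p‖) * (∫ u, ψ u) + (∫ p, ‖g p‖) * ((∫ u, ψ u) * (0 * (D * ‖e1‖))))) := by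
    have : Tendsto (fun n : ℕ => ((n : ℝ) + 1)⁻¹) atTop (𝓝 0) := by
      simpa using tendsto_one_div_add_atTop_nhds_zero_nat (𝕜 := ℝ)
    exact ((((this.mul_const _).const_mul _).const_mul _).const_add _)
  have := le_of_tendsto_of_tendsto' hlim1 hlim2 hle
  rw [← integral_const_mul]
  simp only [zero_mul, mul_zero, add_zero] at this
  refine le_trans (le_of_eq ?_) this
  refine integral_congr_ae (Eventually.of_forall fun p => ?_)
  simp only [hℓ]
  ring

/-- Free transport of a density with an integrable weak derivative in the direction `v₁` decays. -/
lemma HasWeakDeriv.lintegral_shear_le {g w : Phase → ℝ} (hgm : Measurable g) (hg : Integrable g)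
    (hg0 : ∀ᵐ p, 0 ≤ g p) (hw : Integrable w)
    (hgw : HasWeakDeriv g (0, EuclideanSpace.single 0 1) w) {q : ℝ} (hq : 0 < q) :
    ∀ᵐ x : ℝ, ENNReal.ofReal q * ∫⁻ v : Vel, ‖g (shear q (x, v))‖ₑ ≤ ∫⁻ p, ‖w p‖ₑ := by
  have hgs : Integrable fun p => g (shear q p) :=
    (measurePreserving_shear q).integrable_comp_of_integrable hg
  have hgs' : Integrable (fun p : ℝ × Vel => g (shear q p))
    ((volume : Measure ℝ).prod (volume : Measure Vel)) := hgs
  have hgs0 : ∀ᵐ p, 0 ≤ g (shear q p) := (measurePreserving_shear q).quasiMeasurePreserving.ae hg0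
  have hae0 : ∀ᵐ x : ℝ, ∀ᵐ v : Vel, 0 ≤ g (shear q (x, v)) :=
    Measure.ae_ae_of_ae_prod (μ := (volume : Measure ℝ)) (ν := (volume : Measure Vel)) hgs0
  set G : ℝ → ℝ := fun x => ∫ v : Vel, g (shear q (x, v)) with hG
  have hGi : Integrable G := hgs'.integral_prod_left
  have htest : ∀ ψ : ℝ → ℝ, ContDiff ℝ ∞ ψ → HasCompactSupport ψ → (∀ u, 0 ≤ ψ u) →
      q * ∫ x, ψ x * G x ≤ (∫ p, ‖w p‖) * ∫ u, ψ u := by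
    intro ψ hψ hc h0
    obtain ⟨C, hC⟩ := hψ.continuous.bounded_above_of_compact_support hc
    refine le_trans (le_of_eq ?_) (weakDeriv_test_le (q := q) hg hw hgw hψ hc h0)
    have h1 : ∫ p : Phase, g p * ψ (p.1 + q * p.2 0) = ∫ p : Phase, g (shear q p) * ψ p.1 := by
      have hm : AEStronglyMeasurable (fun p : Phase => g p * ψ (p.1 + q * p.2 0)) volume := by
        have := hψ.continuous.measurable
        exact Measurable.aestronglyMeasurable (by fun_prop)
      have h2 := integral_map (μ := (volume : Measure Phase)) (φ := shear q)
        (f := fun p => g p * ψ (p.1 + q * p.2 0)) (by fun_prop)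
        (by rw [(measurePreserving_shear q).map_eq]; exact hm)
      rw [(measurePreserving_shear q).map_eq] at h2
      rw [h2]
      simp [shear]
    rw [h1, Measure.volume_eq_prod, integral_prod]
    · congr 1
      refine integral_congr_ae (Eventually.of_forall fun x => ?_)
      simp only [hG]
      rw [integral_mul_const, mul_comm]
    · exact hgs'.mul_bdd (c := C) (hψ.continuous.comp continuous_fst).aestronglyMeasurable
        (Eventually.of_forall fun p => hC _)
  -- Testing with mollifiers of mass one centred at `x` and shrinking to it recovers the pointwise
  -- bound at almost every `x`. The fixed ratio `2` of outer to inner radius is what the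
  -- differentiation theorem asks for.
  let φ : ℕ → ContDiffBump (0 : ℝ) := fun n =>
    ⟨((n : ℝ) + 1)⁻¹, 2 * ((n : ℝ) + 1)⁻¹, by positivity, by
      have : (0:ℝ) < ((n : ℝ) + 1)⁻¹ := by positivity
      linarith⟩
  have hφ0 : Tendsto (fun n => (φ n).rOut) atTop (𝓝 0) := by
    have : Tendsto (fun n : ℕ => ((n : ℝ) + 1)⁻¹) atTop (𝓝 0) := by
      simpa using tendsto_one_div_add_atTop_nhds_zero_nat (𝕜 := ℝ)
    simpa using this.const_mul 2
  have hconv := ContDiffBump.ae_convolution_tendsto_right_of_locallyIntegrable (μ := volume)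
    (K := 2) hφ0 (Eventually.of_forall fun n => le_rfl) hGi.locallyIntegrable
  filter_upwards [hconv, hae0, hgs'.prod_right_ae] with x hx hx0 hxi
  have hle : q * G x ≤ ∫ p, ‖w p‖ := by
    refine le_of_tendsto (hx.const_mul q) (Eventually.of_forall fun n => ?_)
    have h3 : (convolution ((φ n).normed volume) G (ContinuousLinearMap.lsmul ℝ ℝ) volume) x =
        ∫ y, (φ n).normed volume (x - y) * G y := by
      rw [convolution_eq_swap]
      rfl
    rw [h3]
    have h4 := htest (fun y => (φ n).normed volume (x - y))
      ((φ n).contDiff_normed.comp (contDiff_const.sub contDiff_id))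
      ((φ n).hasCompactSupport_normed.comp_homeomorph (Homeomorph.subLeft x))
      (fun y => (φ n).nonneg_normed _)
    rwa [integral_sub_left_eq_self (fun y => (φ n).normed volume y) volume x,
      (φ n).integral_normed, mul_one] at h4
  have h5 : ∫⁻ v : Vel, ‖g (shear q (x, v))‖ₑ = ENNReal.ofReal (G x) := by
    rw [hG, ofReal_integral_eq_lintegral_ofReal hxi hx0]
    refine lintegral_congr_ae ?_
    filter_upwards [hx0] with v hv
    rw [Real.enorm_eq_ofReal hv]
  rw [h5, ← ENNReal.ofReal_mul hq.le, ← ofReal_integral_norm_eq_lintegral_enorm hw]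
  exact ENNReal.ofReal_le_ofReal hle

/-! ### The collision operator in phase space and its weak form -/

/-- Parameters `((x, v), (v⋆, σ))` of a collision at the position `x`. -/
abbrev ColX : Type := Phase × (Vel × Sph)

/-- The measure `dx dv dv⋆ dσ`. -/
abbrev colXMeas : Measure ColX := (volume : Measure Phase).prod ((volume : Measure Vel).prod surf)

/-- The pre-post collisional change of variables at a fixed position. -/
def collideX (Y : ColX) : ColX :=
  ((Y.1.1, (collide (Y.1.2, Y.2)).1), (collide (Y.1.2, Y.2)).2)

/-- Exchange of the two colliding particles at a fixed position. -/
def exchangeX (Y : ColX) : ColX :=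
  ((Y.1.1, (exchange (Y.1.2, Y.2)).1), (exchange (Y.1.2, Y.2)).2)

@[fun_prop]
lemma measurable_collideX : Measurable collideX := by unfold collideX; fun_prop

@[fun_prop]
lemma measurable_exchangeX : Measurable exchangeX := by unfold exchangeX; fun_prop

lemma collideX_collideX (Y : ColX) : collideX (collideX Y) = Y := by
  simp only [collideX, Prod.mk.eta, collide_collide]

lemma lintegral_colX (G : ColX → ℝ≥0∞) (hG : Measurable G) :
    ∫⁻ Y, G Y ∂colXMeas = ∫⁻ x : ℝ, ∫⁻ y : Col, G ((x, y.1), y.2) ∂colMeas := by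
  have hm : Measurable fun p : Phase => ∫⁻ z, G (p, z) ∂((volume : Measure Vel).prod surf) :=
    Measurable.lintegral_prod_right' hG
  rw [lintegral_prod _ hG.aemeasurable, Measure.volume_eq_prod, lintegral_prod _ hm.aemeasurable]
  refine lintegral_congr fun x => ?_
  rw [lintegral_prod _ (by fun_prop)]

lemma measurePreserving_collideX : MeasurePreserving collideX colXMeas colXMeas := by
  refine ⟨measurable_collideX, Measure.ext_of_lintegral _ fun G hG => ?_⟩
  rw [lintegral_map hG measurable_collideX, lintegral_colX _ (by fun_prop), lintegral_colX _ hG]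
  refine lintegral_congr fun x => ?_
  exact lintegral_collide (fun y => G ((x, y.1), y.2)) (by fun_prop)

lemma measurePreserving_exchangeX : MeasurePreserving exchangeX colXMeas colXMeas := by
  refine ⟨measurable_exchangeX, Measure.ext_of_lintegral _ fun G hG => ?_⟩
  rw [lintegral_map hG measurable_exchangeX, lintegral_colX _ (by fun_prop), lintegral_colX _ hG]
  refine lintegral_congr fun x => ?_
  exact lintegral_exchange (fun y => G ((x, y.1), y.2)) (by fun_prop)

/-- The collisions of a density `F`. -/
def collisions (B : ℝ → ℝ → ℝ) (F : Phase → ℝ) (Y : ColX) : ℝ :=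
  kern B (Y.1.2, Y.2) * (F (Y.1.1, Y.2.1) * F Y.1)

lemma collisions_exchangeX (B : ℝ → ℝ → ℝ) (F : Phase → ℝ) (Y : ColX) :
    collisions B F (exchangeX Y) = collisions B F Y := by
  simp only [collisions, exchangeX, Prod.mk.eta, kern_exchange]
  simp only [exchange]
  ring

lemma collisions_collideX (B : ℝ → ℝ → ℝ) (F : Phase → ℝ) (Y : ColX) :
    collisions B F (collideX Y) = kern B (Y.1.2, Y.2) *
      (F (Y.1.1, postVs Y.1.2 Y.2.1 Y.2.2) * F (Y.1.1, postV Y.1.2 Y.2.1 Y.2.2)) := by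
  simp only [collisions, collideX, Prod.mk.eta, kern_collide]
  rfl

/-- The gain is the loss composed with the collision map, so that all symmetries of the operator
become measure-preserving changes of variables. -/
lemma collisionPhase_eq (B : ℝ → ℝ → ℝ) (F : Phase → ℝ) (p : Phase) :
    collisionPhase B F F p = ∫ z, (collisions B F (collideX (p, z)) - collisions B F (p, z))
      ∂((volume : Measure Vel).prod surf) := by
  have h : ∀ z, collisions B F (collideX (p, z)) - collisions B F (p, z) =
      kern B (p.2, z) * (F (p.1, postVs p.2 z.1 z.2) * F (p.1, postV p.2 z.1 z.2) -
        F (p.1, z.1) * F p) := fun z => by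
    rw [collisions_collideX, collisions, ← mul_sub]
  simp only [h]
  rfl

/-- The weight `1 + |v|²`. -/
def wt (v : Vel) : ℝ := 1 + ‖v‖ ^ 2

lemma wt_pos (v : Vel) : 0 < wt v := by unfold wt; positivity

lemma one_le_wt (v : Vel) : 1 ≤ wt v := by unfold wt; nlinarith [norm_nonneg v]

@[fun_prop]
lemma measurable_wt {α : Type*} [MeasurableSpace α] {g : α → Vel} (hg : Measurable g) :
    Measurable fun a => wt (g a) := by unfold wt; fun_prop

/-- The weight of a collision. -/
def wtX (Y : ColX) : ℝ := wt Y.1.2 + wt Y.2.1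

@[fun_prop]
lemma measurable_wtX : Measurable wtX := by unfold wtX; fun_prop

lemma wtX_pos (Y : ColX) : 0 < wtX Y := add_pos (wt_pos _) (wt_pos _)

lemma norm_postV_add (v vs : Vel) (σ : Sph) :
    ‖postV v vs σ‖ ^ 2 + ‖postVs v vs σ‖ ^ 2 = ‖v‖ ^ 2 + ‖vs‖ ^ 2 := by
  have h1 := parallelogram_law_with_norm ℝ ((1 / 2 : ℝ) • (v + vs)) ((‖v - vs‖ / 2) • (σ : Vel))
  have h2 := parallelogram_law_with_norm ℝ v vs
  have h3 : ‖(1 / 2 : ℝ) • (v + vs)‖ = 1 / 2 * ‖v + vs‖ := by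
    rw [norm_smul, Real.norm_of_nonneg (by norm_num)]
  have h4 : ‖(‖v - vs‖ / 2) • (σ : Vel)‖ = ‖v - vs‖ / 2 := by
    rw [norm_smul, Real.norm_of_nonneg (by positivity)]
    simp
  rw [h3, h4] at h1
  simp only [postV, postVs]
  nlinarith

/-- Conservation of energy: gain and loss may be estimated with the same weight. -/
lemma wtX_collideX (Y : ColX) : wtX (collideX Y) = wtX Y := by
  have := norm_postV_add Y.1.2 Y.2.1 Y.2.2
  simp only [wtX, collideX, collide, wt]
  linarith

/-- A density at a fixed time, with the bounds of the solution. -/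
structure Slice (F : Phase → ℝ) (M E : ℝ≥0∞) : Prop where
  measurable : Measurable F
  M_lt : M < ⊤
  E_lt : E < ⊤
  density : ∀ᵐ y : ℝ, ∫⁻ v : Vel, ‖F (y, v)‖ₑ ≤ M
  moment : ∫⁻ p : Phase, ENNReal.ofReal (wt p.2) * ‖F p‖ₑ ≤ E

section

variable {B : ℝ → ℝ → ℝ} {b R₀ δ : ℝ} {Φ : ℝ → ℝ≥0∞} {F : Phase → ℝ} {M E : ℝ≥0∞}

lemma measurable_collisions (hB : Measurable (Function.uncurry B)) (hF : Measurable F) :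
    Measurable (collisions B F) := by
  have := measurable_kern hB
  unfold collisions
  fun_prop

lemma GoodKernel.enorm_kern (hK : GoodKernel B b R₀ δ Φ) (y : Col) :
    ‖kern B y‖ₑ = kernE B y := by
  rw [kernE, Real.enorm_eq_ofReal (hK.kern_nonneg y)]

/-- A bilinear bound for the number of collisions, one density being controlled uniformly in
space and the other one in mean. -/
lemma GoodKernel.lintegral_pair_le (hK : GoodKernel B b R₀ δ Φ) {e g : Phase → ℝ≥0∞}
    (he : Measurable e) (hg : Measurable g) (hM : ∀ᵐ y : ℝ, ∫⁻ v : Vel, e (y, v) ≤ M) :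
    ∫⁻ Y : ColX, kernE B (Y.1.2, Y.2) * (e (Y.1.1, Y.2.1) * g Y.1) ∂colXMeas ≤
      ENNReal.ofReal b * surf univ * M * ∫⁻ p, g p := by
  have hk := measurable_kernE hK.measurable
  calc ∫⁻ Y : ColX, kernE B (Y.1.2, Y.2) * (e (Y.1.1, Y.2.1) * g Y.1) ∂colXMeas
      ≤ ∫⁻ Y : ColX, ENNReal.ofReal b * (e (Y.1.1, Y.2.1) * g Y.1) ∂colXMeas := by
        refine lintegral_mono fun Y => ?_
        gcongr
        exact hK.kernE_le _
    _ = ∫⁻ p : Phase, ENNReal.ofReal b * surf univ * (∫⁻ vs : Vel, e (p.1, vs)) * g p := by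
        rw [lintegral_prod _ (by fun_prop)]
        refine lintegral_congr fun p => ?_
        rw [lintegral_prod _ (by fun_prop)]
        simp only [lintegral_const]
        rw [lintegral_mul_const _ (by fun_prop), lintegral_const_mul _ (by fun_prop),
          lintegral_mul_const _ (by fun_prop)]
        ring
    _ ≤ ∫⁻ p : Phase, ENNReal.ofReal b * surf univ * M * g p := by
        refine lintegral_mono_ae ?_
        have := (Measure.quasiMeasurePreserving_fst (μ := (volume : Measure ℝ))
          (ν := (volume : Measure Vel))).ae hM
        filter_upwards [this] with p hp
        gcongr
    _ = _ := by rw [lintegral_const_mul _ (by fun_prop)]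

/-- The weight is a sum over the two particles and `exchangeX` swaps its terms. In each of them the
unweighted particle is controlled by the density bound and the weighted one by the moment. -/
lemma GoodKernel.lintegral_collisions_le (hK : GoodKernel B b R₀ δ Φ) (hF : Slice F M E) :
    ∫⁻ Y, ENNReal.ofReal (wtX Y) * ‖collisions B F Y‖ₑ ∂colXMeas ≤
      2 * (ENNReal.ofReal b * surf univ * M * E) := by
  have hFm := hF.measurable
  have hk := measurable_kernE hK.measurable
  set g : Phase → ℝ≥0∞ := fun p => ENNReal.ofReal (wt p.2) * ‖F p‖ₑ with hg
  have h1 : ∀ Y : ColX, ENNReal.ofReal (wtX Y) * ‖collisions B F Y‖ₑ =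
      kernE B (Y.1.2, Y.2) * (‖F (Y.1.1, Y.2.1)‖ₑ * g Y.1) +
      kernE B ((exchangeX Y).1.2, (exchangeX Y).2) *
        (‖F ((exchangeX Y).1.1, (exchangeX Y).2.1)‖ₑ * g (exchangeX Y).1) := by
    intro Y
    have h2 : kernE B ((exchangeX Y).1.2, (exchangeX Y).2) = kernE B (Y.1.2, Y.2) := by
      simp only [kernE, exchangeX, Prod.mk.eta, kern_exchange]
    rw [h2, wtX, collisions, ENNReal.ofReal_add (wt_pos _).le (wt_pos _).le, enorm_mul, enorm_mul,
      hK.enorm_kern]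
    simp only [hg, exchangeX, exchange]
    ring
  rw [lintegral_congr h1, lintegral_add_left (by fun_prop),
    measurePreserving_exchangeX.lintegral_comp
      (f := fun Y : ColX => kernE B (Y.1.2, Y.2) * (‖F (Y.1.1, Y.2.1)‖ₑ * g Y.1)) (by fun_prop),
    ← two_mul]
  refine mul_le_mul_right ?_ _
  refine (hK.lintegral_pair_le (e := fun p => ‖F p‖ₑ) (by fun_prop) (by fun_prop)
    hF.density).trans ?_
  gcongr
  exact hF.moment

/-- The bound for the weighted number of collisions. -/
def colBound (b : ℝ) (M E : ℝ≥0∞) : ℝ≥0∞ := 2 * (ENNReal.ofReal b * surf univ * M * E)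

lemma colBound_lt_top (hM : M < ⊤) (hE : E < ⊤) : colBound b M E < ⊤ := by
  unfold colBound
  have : surf univ < ⊤ := measure_lt_top _ _
  finiteness

lemma GoodKernel.integrable_wtX_collisions (hK : GoodKernel B b R₀ δ Φ) (hF : Slice F M E) :
    Integrable (fun Y => wtX Y * collisions B F Y) colXMeas := by
  refine ⟨((measurable_wtX.mul (measurable_collisions hK.measurable
    hF.measurable))).aestronglyMeasurable, ?_⟩
  refine lt_of_le_of_lt (le_of_eq_of_le ?_ (hK.lintegral_collisions_le hF))
    (colBound_lt_top hF.M_lt hF.E_lt)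
  refine lintegral_congr fun Y => ?_
  rw [enorm_mul, Real.enorm_eq_ofReal (wtX_pos Y).le]

lemma GoodKernel.integrable_collisions_mul (hK : GoodKernel B b R₀ δ Φ) (hF : Slice F M E)
    {ζ : ColX → ℝ} (hζ : Measurable ζ) {C : ℝ} (hC : ∀ Y, |ζ Y| ≤ C * wtX Y) :
    Integrable (fun Y => collisions B F Y * ζ Y) colXMeas := by
  refine ((hK.integrable_wtX_collisions hF).const_mul C).mono
    ((measurable_collisions hK.measurable hF.measurable).mul hζ).aestronglyMeasurable
    (Eventually.of_forall fun Y => ?_)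
  rw [norm_mul, norm_mul, norm_mul, mul_comm]
  calc ‖ζ Y‖ * ‖collisions B F Y‖ ≤ (C * wtX Y) * ‖collisions B F Y‖ :=
        mul_le_mul_of_nonneg_right (hC Y) (norm_nonneg _)
    _ ≤ (‖C‖ * ‖wtX Y‖) * ‖collisions B F Y‖ := by
        refine mul_le_mul_of_nonneg_right ?_ (norm_nonneg _)
        rw [← norm_mul]
        exact le_abs_self _
    _ = _ := by ring

lemma GoodKernel.integrable_collisions_collideX_mul (hK : GoodKernel B b R₀ δ Φ)
    (hF : Slice F M E) {ζ : ColX → ℝ} (hζ : Measurable ζ) {C : ℝ}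
    (hC : ∀ Y, |ζ Y| ≤ C * wtX Y) :
    Integrable (fun Y => collisions B F (collideX Y) * ζ Y) colXMeas := by
  have h := hK.integrable_collisions_mul hF (ζ := fun Y => ζ (collideX Y)) (by fun_prop) (C := C)
    (fun Y => by rw [← wtX_collideX]; exact hC _)
  have h2 := measurePreserving_collideX.integrable_comp_of_integrable h
  simpa only [Function.comp_def, collideX_collideX] using h2

lemma measurable_collisionPhase (hB : Measurable (Function.uncurry B)) (hF : Measurable F) :
    Measurable (collisionPhase B F F) := by
  have h : (collisionPhase B F F) = fun p => ∫ z, (collisions B F (collideX (p, z)) -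
      collisions B F (p, z)) ∂((volume : Measure Vel).prod surf) :=
    funext fun p => collisionPhase_eq B F p
  rw [h]
  have hm := measurable_collisions hB hF
  have h2 : Measurable fun Y : ColX => collisions B F (collideX Y) - collisions B F Y := by
    fun_prop
  exact h2.stronglyMeasurable.integral_prod_right.measurable

lemma GoodKernel.lintegral_collisionPhase_le (hK : GoodKernel B b R₀ δ Φ) (hF : Slice F M E) :
    ∫⁻ p : Phase, ENNReal.ofReal (wt p.2) * ‖collisionPhase B F F p‖ₑ ≤ 2 * colBound b M E := by
  have hm := measurable_collisions hK.measurable hF.measurable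
  calc ∫⁻ p : Phase, ENNReal.ofReal (wt p.2) * ‖collisionPhase B F F p‖ₑ
      ≤ ∫⁻ p : Phase, ∫⁻ z, ENNReal.ofReal (wt p.2) * (‖collisions B F (collideX (p, z))‖ₑ +
          ‖collisions B F (p, z)‖ₑ) ∂((volume : Measure Vel).prod surf) := by
        refine lintegral_mono fun p => ?_
        simp only
        rw [lintegral_const_mul _ (by fun_prop)]
        gcongr
        rw [collisionPhase_eq]
        refine (enorm_integral_le_lintegral_enorm _).trans (lintegral_mono fun z => ?_)
        exact enorm_sub_le
    _ = ∫⁻ Y : ColX, ENNReal.ofReal (wt Y.1.2) * (‖collisions B F (collideX Y)‖ₑ +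
          ‖collisions B F Y‖ₑ) ∂colXMeas := (lintegral_prod (f := fun Y : ColX =>
            ENNReal.ofReal (wt Y.1.2) * (‖collisions B F (collideX Y)‖ₑ +
          ‖collisions B F Y‖ₑ)) (by fun_prop)).symm
    _ ≤ ∫⁻ Y : ColX, (ENNReal.ofReal (wtX (collideX Y)) * ‖collisions B F (collideX Y)‖ₑ +
          ENNReal.ofReal (wtX Y) * ‖collisions B F Y‖ₑ) ∂colXMeas := by
        refine lintegral_mono fun Y => ?_
        rw [wtX_collideX, ← mul_add]
        gcongr
        exact le_add_of_nonneg_right (wt_pos _).le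
    _ ≤ colBound b M E + colBound b M E := by
        rw [lintegral_add_left (by fun_prop), measurePreserving_collideX.lintegral_comp
          (f := fun Y : ColX => ENNReal.ofReal (wtX Y) * ‖collisions B F Y‖ₑ) (by fun_prop)]
        exact add_le_add (hK.lintegral_collisions_le hF) (hK.lintegral_collisions_le hF)
    _ = _ := (two_mul _).symm

/-- The weak form of the collision operator. -/
lemma GoodKernel.integral_collisionPhase_mul (hK : GoodKernel B b R₀ δ Φ) (hF : Slice F M E)
    {χ : Phase → ℝ} (hχ : Measurable χ) {C : ℝ} (hC : ∀ p, |χ p| ≤ C * wt p.2) :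
    ∫ p, collisionPhase B F F p * χ p =
      ∫ Y, collisions B F Y * (χ (collideX Y).1 - χ Y.1) ∂colXMeas := by
  have hm := measurable_collisions hK.measurable hF.measurable
  have hC0 : 0 ≤ C := by
    have := (abs_nonneg _).trans (hC 0)
    exact nonneg_of_mul_nonneg_left this (wt_pos _)
  have hb1 : ∀ Y : ColX, |χ Y.1| ≤ C * wtX Y := fun Y => (hC Y.1).trans
    (mul_le_mul_of_nonneg_left (le_add_of_nonneg_right (wt_pos _).le) hC0)
  have hi1 := hK.integrable_collisions_collideX_mul hF (ζ := fun Y => χ Y.1) (by fun_prop) hb1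
  have hi2 := hK.integrable_collisions_mul hF (ζ := fun Y => χ Y.1) (by fun_prop) hb1
  have hi3 := hK.integrable_collisions_mul hF (ζ := fun Y => χ (collideX Y).1) (by fun_prop)
    (C := C) (fun Y => by rw [← wtX_collideX]; exact hb1 _)
  have h1 : ∫ p, collisionPhase B F F p * χ p = ∫ Y, (collisions B F (collideX Y) * χ Y.1 -
      collisions B F Y * χ Y.1) ∂colXMeas := by
    rw [integral_prod (fun Y : ColX => collisions B F (collideX Y) * χ Y.1 -
      collisions B F Y * χ Y.1) (hi1.sub hi2)]
    refine integral_congr_ae (Eventually.of_forall fun p => ?_)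
    simp only
    rw [collisionPhase_eq, ← integral_mul_const]
    simp only [sub_mul]
  have h2 : ∫ Y, collisions B F (collideX Y) * χ Y.1 ∂colXMeas =
      ∫ Y, collisions B F Y * χ (collideX Y).1 ∂colXMeas := by
    have h3 := integral_map (μ := colXMeas) (φ := collideX)
      (f := fun Y => collisions B F (collideX Y) * χ Y.1) (by fun_prop)
      (by fun_prop)
    rw [measurePreserving_collideX.map_eq] at h3
    rw [h3]
    simp only [collideX_collideX]
  rw [h1, integral_sub hi1 hi2, h2, ← integral_sub hi3 hi2]
  simp only [mul_sub]

lemma integral_collisions_exchangeX (hB : Measurable (Function.uncurry B)) (hF : Measurable F)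
    {ζ : ColX → ℝ} (hζ : Measurable ζ) :
    ∫ Y, collisions B F Y * ζ Y ∂colXMeas = ∫ Y, collisions B F Y * ζ (exchangeX Y) ∂colXMeas := by
  have hm := measurable_collisions hB hF
  have h3 := integral_map (μ := colXMeas) (φ := exchangeX)
      (f := fun Y => collisions B F Y * ζ Y) (by fun_prop) (by fun_prop)
  rw [measurePreserving_exchangeX.map_eq] at h3
  rw [h3]
  simp only [collisions_exchangeX]

end

/-! ### Evolution along free trajectories -/

/-- The integral of the derivative of a product of two indefinite integrals and a `C¹` function. -/
lemma integral_deriv_mul_mul {T : ℝ} {a₁ a₂ k k' : ℝ → ℝ} {A₁ A₂ : ℝ}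
    (h₁ : IntervalIntegrable a₁ volume 0 T) (h₂ : IntervalIntegrable a₂ volume 0 T)
    (hk : ∀ s, HasDerivAt k (k' s) s) (hk' : Continuous k') :
    (A₁ + ∫ s in (0:ℝ)..T, a₁ s) * (A₂ + ∫ s in (0:ℝ)..T, a₂ s) * k T - A₁ * A₂ * k 0 =
      ∫ s in (0:ℝ)..T, ((a₁ s * (A₂ + ∫ r in (0:ℝ)..s, a₂ r) +
        (A₁ + ∫ r in (0:ℝ)..s, a₁ r) * a₂ s) * k s +
        (A₁ + ∫ r in (0:ℝ)..s, a₁ r) * (A₂ + ∫ r in (0:ℝ)..s, a₂ r) * k' s) := by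
  have hac : ∀ {a : ℝ → ℝ} (A : ℝ), IntervalIntegrable a volume 0 T →
      AbsolutelyContinuousOnInterval (fun s => A + ∫ r in (0:ℝ)..s, a r) 0 T := fun A h =>
    ((contDiff_const (c := A)).contDiffOn.absolutelyContinuousOnInterval).add
      (h.absolutelyContinuousOnInterval_intervalIntegral (by simp))
  have hkac : AbsolutelyContinuousOnInterval k 0 T := by
    refine ContDiffOn.absolutelyContinuousOnInterval (ContDiff.contDiffOn ?_)
    rw [contDiff_one_iff_deriv]
    exact ⟨fun s => (hk s).differentiableAt, by
      rw [show deriv k = k' from funext fun s => (hk s).deriv]; exact hk'⟩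
  have hprod := ((hac A₁ h₁).fun_mul (hac A₂ h₂)).fun_mul hkac
  have h := hprod.integral_deriv_eq_sub
  simp only [intervalIntegral.integral_same, add_zero] at h
  rw [← h]
  apply intervalIntegral.integral_congr_ae
  filter_upwards [h₁.ae_hasDerivAt_integral, h₂.ae_hasDerivAt_integral] with s hs₁ hs₂ hs
  have hs' : s ∈ uIcc 0 T := uIoc_subset_uIcc hs
  have d₁ := (hs₁ hs' 0 (by simp)).const_add A₁
  have d₂ := (hs₂ hs' 0 (by simp)).const_add A₂
  exact ((d₁.fun_mul d₂).fun_mul (hk s)).deriv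

/-- The collision operator along free trajectories. -/
def rate (B : ℝ → ℝ → ℝ) (f : ℝ → Phase → ℝ) (s : ℝ) (p : Phase) : ℝ :=
  collisionPhase B (f s) (f s) (shear (-s) p)

/-- The density along free trajectories. -/
def along (f : ℝ → Phase → ℝ) (s : ℝ) (p : Phase) : ℝ := f s (shear (-s) p)

/-- The absolutely continuous representative of the density along free trajectories. -/
def path (B : ℝ → ℝ → ℝ) (f : ℝ → Phase → ℝ) (t : ℝ) (p : Phase) : ℝ :=
  f 0 p + ∫ s in (0:ℝ)..t, rate B f s p

/-- What is used of the solution. -/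
structure Sol (B : ℝ → ℝ → ℝ) (f : ℝ → Phase → ℝ) (b R₀ δ : ℝ) (Φ : ℝ → ℝ≥0∞) (M E : ℝ≥0∞) :
    Prop where
  kernel : GoodKernel B b R₀ δ Φ
  measurable : Measurable (Function.uncurry f)
  M_lt : M < ⊤
  E_lt : E < ⊤
  density : ∀ᵐ s : ℝ, 0 ≤ s → ∀ τ, 0 ≤ τ → ∀ᵐ y : ℝ, ∫⁻ v : Vel, ‖f s (shear τ (y, v))‖ₑ ≤ M
  moment : ∀ t, 0 ≤ t → ∫⁻ p : Phase, ENNReal.ofReal (wt p.2) * ‖f t p‖ₑ ≤ E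
  initial_nonneg : ∀ᵐ p, 0 ≤ f 0 p
  duhamel : ∀ t, 0 ≤ t → ∀ᵐ p, along f t p = path B f t p

/-- Following the free flow turns Duhamel's formula into an indefinite integral in time at a fixed
label `p`. At `t = 0` it identifies `f 0` with the initial datum. The constants `M` and `E` are the
two norms, in time, of the solution. -/
lemma exists_sol {B : ℝ → ℝ → ℝ} (hB : IsCollisionKernel B) (hH1 : HypH1 B) (hH2 : HypH2 B)
    {fin : Phase → ℝ} {f : ℝ → Phase → ℝ} (hf : IsMildSolution B fin f) (hX : BoundedInX f)
    (hL : BoundedContinuousIn normL12 f) : ∃ b R₀ δ Φ M E, Sol B f b R₀ δ Φ M E := by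
  obtain ⟨b, R₀, δ, Φ, hK⟩ := exists_goodKernel hB hH1 hH2
  have h0 : f 0 =ᵐ[volume] fin := by
    filter_upwards [hf.duhamel 0 le_rfl] with p hp
    rw [hp, transport_apply, shear_zero, intervalIntegral.integral_same, add_zero]
  refine ⟨b, R₀, δ, Φ, _, _, hK, hf.measurable, hX, hL.bounded, ?_, ?_, ?_, ?_⟩
  · have := ENNReal.ae_le_essSup (μ := volume.restrict (Ici (0:ℝ))) (fun t => normX (f t))
    rw [ae_restrict_iff' measurableSet_Ici] at this
    filter_upwards [this] with s hs hs0 τ hτ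
    have h1 : essSup (fun x : ℝ => ∫⁻ v : Vel, ‖transport τ (f s) (x, v)‖ₑ) volume ≤
        essSup (fun t => normX (f t)) (volume.restrict (Ici (0 : ℝ))) :=
      (le_iSup₂ (f := fun (q : ℝ) (_ : 0 ≤ q) =>
        essSup (fun x : ℝ => ∫⁻ v : Vel, ‖transport q (f s) (x, v)‖ₑ) volume) τ hτ).trans (hs hs0)
    filter_upwards [ENNReal.ae_le_essSup
      (fun x : ℝ => ∫⁻ v : Vel, ‖transport τ (f s) (x, v)‖ₑ)] with y hy
    exact hy.trans h1
  · intro t ht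
    refine le_trans (le_of_eq ?_) (le_iSup₂ (f := fun (t : ℝ) (_ : 0 ≤ t) => normL12 (f t)) t ht)
    refine lintegral_congr fun p => ?_
    rw [← Real.enorm_eq_ofReal (wt_pos _).le, ← enorm_mul]
    rfl
  · filter_upwards [h0, hf.initial_nonneg] with p hp hp0
    rwa [hp]
  · intro t ht
    filter_upwards [(measurePreserving_shear (-t)).quasiMeasurePreserving.ae (hf.duhamel t ht), h0]
      with p hp hp0
    rw [along, hp, path, hp0, transport_apply, shear_shear, add_neg_cancel, shear_zero]
    congr 1
    refine intervalIntegral.integral_congr fun s _ => ?_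
    simp only [transport_apply, shear_shear, rate]
    congr 2
    ring

namespace Sol

variable {B : ℝ → ℝ → ℝ} {f : ℝ → Phase → ℝ} {b R₀ δ : ℝ} {Φ : ℝ → ℝ≥0∞} {M E : ℝ≥0∞}

lemma measurable_comp (h : Sol B f b R₀ δ Φ M E) {α : Type*} [MeasurableSpace α] {t : α → ℝ}
    {p : α → Phase} (ht : Measurable t) (hp : Measurable p) : Measurable fun a => f (t a) (p a) :=
  h.measurable.comp (ht.prodMk hp)

lemma measurable_slice (h : Sol B f b R₀ δ Φ M E) (t : ℝ) : Measurable (f t) :=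
  h.measurable_comp measurable_const measurable_id

lemma slice (h : Sol B f b R₀ δ Φ M E) : ∀ᵐ s : ℝ, 0 ≤ s → Slice (f s) M E := by
  filter_upwards [h.density] with s hs hs0
  refine ⟨h.measurable_slice s, h.M_lt, h.E_lt, ?_, h.moment s hs0⟩
  simpa only [shear_zero] using hs hs0 0 le_rfl

lemma measurable_collisions (h : Sol B f b R₀ δ Φ M E) :
    Measurable fun a : ℝ × ColX => collisions B (f a.1) a.2 := by
  have hk := measurable_kern h.kernel.measurable
  have h1 : Measurable fun a : ℝ × ColX => f a.1 (a.2.1.1, a.2.2.1) :=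
    h.measurable_comp (by fun_prop) (by fun_prop)
  have h2 : Measurable fun a : ℝ × ColX => f a.1 a.2.1 :=
    h.measurable_comp (by fun_prop) (by fun_prop)
  exact (hk.comp (f := fun a : ℝ × ColX => (a.2.1.2, a.2.2)) (by fun_prop)).mul (h1.mul h2)

lemma measurable_collisionPhase (h : Sol B f b R₀ δ Φ M E) :
    Measurable fun a : ℝ × Phase => collisionPhase B (f a.1) (f a.1) a.2 := by
  simp only [collisionPhase_eq]
  have hm := h.measurable_collisions
  have h1 : Measurable fun c : (ℝ × Phase) × (Vel × Sph) =>
      collisions B (f c.1.1) (collideX (c.1.2, c.2)) :=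
    hm.comp (f := fun c : (ℝ × Phase) × (Vel × Sph) => (c.1.1, collideX (c.1.2, c.2)))
      (by fun_prop)
  have h2 : Measurable fun c : (ℝ × Phase) × (Vel × Sph) =>
      collisions B (f c.1.1) (c.1.2, c.2) :=
    hm.comp (f := fun c : (ℝ × Phase) × (Vel × Sph) => (c.1.1, (c.1.2, c.2))) (by fun_prop)
  exact (h1.sub h2).stronglyMeasurable.integral_prod_right.measurable

lemma measurable_rate (h : Sol B f b R₀ δ Φ M E) {α : Type*} [MeasurableSpace α] {t : α → ℝ}
    {p : α → Phase} (ht : Measurable t) (hp : Measurable p) :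
    Measurable fun a => rate B f (t a) (p a) :=
  h.measurable_collisionPhase.comp (f := fun a => (t a, shear (-t a) (p a))) (by fun_prop)

lemma measurable_along (h : Sol B f b R₀ δ Φ M E) {α : Type*} [MeasurableSpace α] {t : α → ℝ}
    {p : α → Phase} (ht : Measurable t) (hp : Measurable p) :
    Measurable fun a => along f (t a) (p a) :=
  h.measurable_comp ht (by fun_prop)

lemma lintegral_along_le (h : Sol B f b R₀ δ Φ M E) {t : ℝ} (ht : 0 ≤ t) :
    ∫⁻ p : Phase, ENNReal.ofReal (wt p.2) * ‖along f t p‖ₑ ≤ E := by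
  have hm := h.measurable_slice t
  refine le_of_eq_of_le ?_ (h.moment t ht)
  exact (measurePreserving_shear (-t)).lintegral_comp
    (f := fun p : Phase => ENNReal.ofReal (wt p.2) * ‖f t p‖ₑ) (by fun_prop)

lemma lintegral_rate_le (h : Sol B f b R₀ δ Φ M E) : ∀ᵐ s : ℝ, 0 ≤ s →
    ∫⁻ p : Phase, ENNReal.ofReal (wt p.2) * ‖rate B f s p‖ₑ ≤ 2 * colBound b M E := by
  filter_upwards [h.slice] with s hs hs0
  have hm := Boltzmann1D.measurable_collisionPhase h.kernel.measurable (h.measurable_slice s)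
  refine le_of_eq_of_le ?_ (h.kernel.lintegral_collisionPhase_le (hs hs0))
  exact (measurePreserving_shear (-s)).lintegral_comp
    (f := fun p : Phase => ENNReal.ofReal (wt p.2) * ‖collisionPhase B (f s) (f s) p‖ₑ)
    (by fun_prop)

lemma integrable_rate (h : Sol B f b R₀ δ Φ M E) (T : ℝ) :
    Integrable (fun a : ℝ × Phase => wt a.2.2 * rate B f a.1 a.2)
      ((volume.restrict (Ioc 0 T)).prod volume) := by
  have hm := h.measurable_rate (t := fun a : ℝ × Phase => a.1) (p := fun a => a.2)
    (by fun_prop) (by fun_prop)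
  refine ⟨(Measurable.mul (by fun_prop) hm).aestronglyMeasurable, ?_⟩
  rw [hasFiniteIntegral_iff_enorm, lintegral_prod _ (by fun_prop)]
  calc _ ≤ ∫⁻ s in Ioc 0 T, 2 * colBound b M E := by
        refine lintegral_mono_ae ?_
        refine (ae_restrict_iff' measurableSet_Ioc).2 ?_
        filter_upwards [h.lintegral_rate_le] with s hs hs0
        refine le_of_eq_of_le (lintegral_congr fun p => ?_) (hs hs0.1.le)
        rw [enorm_mul, Real.enorm_eq_ofReal (wt_pos _).le]
    _ < ⊤ := by
        rw [setLIntegral_const]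
        have := colBound_lt_top (b := b) h.M_lt h.E_lt
        have : volume (Ioc 0 T) < ⊤ := measure_Ioc_lt_top
        finiteness

lemma intervalIntegrable_rate (h : Sol B f b R₀ δ Φ M E) {T : ℝ} (hT : 0 ≤ T) :
    ∀ᵐ p, IntervalIntegrable (fun s => rate B f s p) volume 0 T := by
  have h1 := (h.integrable_rate T).prod_left_ae
  filter_upwards [h1] with p hp
  rw [intervalIntegrable_iff_integrableOn_Ioc_of_le hT]
  refine (hp.const_mul (wt p.2)⁻¹).congr (Eventually.of_forall fun s => ?_)
  simp only
  rw [← mul_assoc, inv_mul_cancel₀ (wt_pos _).ne', one_mul]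

lemma measurable_path (h : Sol B f b R₀ δ Φ M E) :
    Measurable fun a : ℝ × Phase => f 0 a.2 + ∫ s in Ioc 0 a.1, rate B f s a.2 := by
  have h0 := h.measurable_slice 0
  have h1 : ∀ a : ℝ × Phase, ∫ s in Ioc 0 a.1, rate B f s a.2 =
      ∫ s, {c : (ℝ × Phase) × ℝ | 0 < c.2 ∧ c.2 ≤ c.1.1}.indicator
        (fun c => rate B f c.2 c.1.2) (a, s) := by
    intro a
    rw [← integral_indicator measurableSet_Ioc]
    rfl
  simp only [h1]
  refine Measurable.add (by fun_prop) ?_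
  have h2 : Measurable ({c : (ℝ × Phase) × ℝ | 0 < c.2 ∧ c.2 ≤ c.1.1}.indicator
        (fun c => rate B f c.2 c.1.2)) := by
    refine (h.measurable_rate (by fun_prop) (by fun_prop)).indicator ?_
    exact (measurableSet_lt measurable_const measurable_snd).inter
      (measurableSet_le measurable_snd (by fun_prop))
  exact h2.stronglyMeasurable.integral_prod_right'.measurable

/-- Duhamel's formula holds for each time off a null set depending on that time. Fubini exchanges
the quantifiers, so that for almost every trajectory it can be used under a time integral. -/
lemma along_eq_path (h : Sol B f b R₀ δ Φ M E) (T : ℝ) :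
    ∀ᵐ p, ∀ᵐ s ∂(volume.restrict (Ioc 0 T)), along f s p = path B f s p := by
  have hpath : ∀ (s : ℝ) p, 0 < s → path B f s p = f 0 p + ∫ r in Ioc 0 s, rate B f r p := by
    intro s p hs
    rw [path, intervalIntegral.integral_of_le hs.le]
  have h1 : ∀ᵐ p, ∀ᵐ s ∂(volume.restrict (Ioc 0 T)),
      along f s p = f 0 p + ∫ r in Ioc 0 s, rate B f r p := by
    rw [← Measure.ae_ae_comm (p := fun s p =>
      along f s p = f 0 p + ∫ r in Ioc 0 s, rate B f r p)]
    · rw [ae_restrict_iff' measurableSet_Ioc]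
      refine Eventually.of_forall fun s hs => ?_
      filter_upwards [h.duhamel s hs.1.le] with p hp
      rw [hp, hpath s p hs.1]
    · exact measurableSet_eq_fun (h.measurable_along (by fun_prop) (by fun_prop)) h.measurable_path
  filter_upwards [h1] with p hp
  filter_upwards [hp, ae_restrict_mem measurableSet_Ioc] with s hs hs0
  rw [hs, hpath s p hs0.1]

/-- Evolution along a trajectory, with a weight. -/
lemma evolution (h : Sol B f b R₀ δ Φ M E) {T : ℝ} (hT : 0 ≤ T) : ∀ᵐ p, ∀ k k' : ℝ → ℝ,
    (∀ s, HasDerivAt k (k' s) s) → Continuous k' →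
    along f T p * k T - f 0 p * k 0 =
      ∫ s in Ioc 0 T, (rate B f s p * k s + along f s p * k' s) := by
  filter_upwards [h.intervalIntegrable_rate hT, h.along_eq_path T, h.duhamel T hT]
    with p hp1 hp2 hp3 k k' hk hk'
  -- The second factor of the product is taken to be the constant one.
  have := integral_deriv_mul_mul (A₁ := f 0 p) (A₂ := 1) hp1
    (a₂ := fun _ => 0) intervalIntegrable_const hk hk'
  simp only [intervalIntegral.integral_zero, add_zero, mul_one, mul_zero] at this
  rw [hp3, path, this, intervalIntegral.integral_of_le hT]
  refine integral_congr_ae ?_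
  filter_upwards [hp2] with s hs
  rw [hs, path]

/-- Evolution of a product along a pair of trajectories, with a weight. -/
lemma evolution_pair (h : Sol B f b R₀ δ Φ M E) {T : ℝ} (hT : 0 ≤ T) :
    ∀ᵐ P : Phase × Phase, ∀ k k' : ℝ → ℝ, (∀ s, HasDerivAt k (k' s) s) → Continuous k' →
    along f T P.1 * along f T P.2 * k T - f 0 P.1 * f 0 P.2 * k 0 =
      ∫ s in Ioc 0 T, ((rate B f s P.1 * along f s P.2 + along f s P.1 * rate B f s P.2) * k s +
        along f s P.1 * along f s P.2 * k' s) := by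
  have h1 : ∀ᵐ p, IntervalIntegrable (fun s => rate B f s p) volume 0 T ∧
      (∀ᵐ s ∂(volume.restrict (Ioc 0 T)), along f s p = path B f s p) ∧
      along f T p = path B f T p := by
    filter_upwards [h.intervalIntegrable_rate hT, h.along_eq_path T, h.duhamel T hT]
      with p hp1 hp2 hp3 using ⟨hp1, hp2, hp3⟩
  have hfst := (Measure.quasiMeasurePreserving_fst (μ := (volume : Measure Phase))
    (ν := (volume : Measure Phase))).ae h1
  have hsnd := (Measure.quasiMeasurePreserving_snd (μ := (volume : Measure Phase))
    (ν := (volume : Measure Phase))).ae h1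
  -- The null set is fixed before the weight is chosen; so the weight may depend on the pair `P`, as
  -- Bony's does.
  filter_upwards [hfst, hsnd] with P hP1 hP2 k k' hk hk'
  obtain ⟨p1, p2, p3⟩ := hP1
  obtain ⟨q1, q2, q3⟩ := hP2
  have := integral_deriv_mul_mul (A₁ := f 0 P.1) (A₂ := f 0 P.2) p1 q1 hk hk'
  rw [p3, q3, path, path, this, intervalIntegral.integral_of_le hT]
  refine integral_congr_ae ?_
  filter_upwards [p2, q2] with s hs hs'
  rw [hs, hs', path, path]

end Sol

/-! ### Non-negativity of the solution -/

lemma ofReal_integral_le_lintegral {α : Type*} [MeasurableSpace α] {μ : Measure α} (g : α → ℝ) :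
    ENNReal.ofReal (∫ a, g a ∂μ) ≤ ∫⁻ a, ENNReal.ofReal (g a) ∂μ := by
  by_cases hg : Integrable g μ
  · have h1 : ∫ a, g a ∂μ ≤ ∫ a, max (g a) 0 ∂μ :=
      integral_mono hg hg.pos_part fun a => le_max_left _ _
    refine (ENNReal.ofReal_le_ofReal h1).trans (le_of_eq ?_)
    rw [ofReal_integral_eq_lintegral_ofReal hg.pos_part
      (Eventually.of_forall fun a => le_max_right _ _)]
    refine lintegral_congr fun a => ?_
    rcases le_total (g a) 0 with h | h
    · simp [h, ENNReal.ofReal_of_nonpos h]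
    · simp [h]
  · simp [integral_undef hg]

/-- A product is negative only if exactly one factor is, so its negative part is linear in negative
parts. This is what makes Gronwall's lemma applicable to a quadratic operator. -/
lemma ofReal_neg_mul_le (a c : ℝ) : ENNReal.ofReal (-(a * c)) ≤
    ‖a‖ₑ * ENNReal.ofReal (-c) + ENNReal.ofReal (-a) * ‖c‖ₑ := by
  rcases le_total 0 a with ha | ha
  · rw [show -(a * c) = a * -c by ring, ENNReal.ofReal_mul ha, ← Real.enorm_eq_ofReal ha]
    exact le_self_add
  · rcases le_total 0 c with hc | hc
    · rw [show -(a * c) = -a * c by ring, ENNReal.ofReal_mul (neg_nonneg.2 ha),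
        ← Real.enorm_eq_ofReal hc]
      exact le_add_self
    · rw [ENNReal.ofReal_of_nonpos (by nlinarith)]
      exact zero_le

/-- Gronwall's lemma for a bounded function. -/
lemma eq_zero_of_le_lintegral {N : ℝ → ℝ≥0∞} {K : ℝ≥0∞} {c T : ℝ} (hc : 0 ≤ c) (hK : K ≠ ⊤)
    (hb : ∀ t ∈ Icc 0 T, N t ≤ K)
    (h : ∀ t ∈ Icc 0 T, N t ≤ ENNReal.ofReal c * ∫⁻ s in Ioc 0 t, N s) :
    ∀ t ∈ Icc 0 T, N t = 0 := by
  -- Iterating the integral inequality gains one power of `c t` and one factor of the factorial each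
  -- time.
  have key : ∀ n : ℕ, ∀ t ∈ Icc 0 T, N t ≤ K * ENNReal.ofReal ((c * t) ^ n / n.factorial) := by
    intro n
    induction n with
    | zero => intro t ht; simpa using hb t ht
    | succ n ih =>
      intro t ht
      calc N t ≤ ENNReal.ofReal c * ∫⁻ s in Ioc 0 t, N s := h t ht
        _ ≤ ENNReal.ofReal c * ∫⁻ s in Ioc 0 t,
              K * ENNReal.ofReal ((c * s) ^ n / n.factorial) := by
            refine mul_le_mul_right (setLIntegral_mono' measurableSet_Ioc fun s hs => ?_) _
            exact ih s ⟨hs.1.le, hs.2.trans ht.2⟩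
        _ = K * ENNReal.ofReal (c * ∫ s in (0:ℝ)..t, (c * s) ^ n / n.factorial) := by
            rw [lintegral_const_mul' _ _ hK, ENNReal.ofReal_mul hc,
              intervalIntegral.integral_of_le ht.1, ofReal_integral_eq_lintegral_ofReal]
            · ring
            · exact Continuous.integrableOn_Ioc (by fun_prop)
            · filter_upwards [ae_restrict_mem measurableSet_Ioc] with s hs
              have := hs.1.le
              positivity
        _ = _ := by
            congr 2
            simp only [mul_pow, intervalIntegral.integral_div, intervalIntegral.integral_const_mul,
              integral_pow, Nat.factorial_succ]
            push_cast
            have : (n.factorial : ℝ) ≠ 0 := by positivity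
            field_simp
            simp
            ring
  intro t ht
  refine le_antisymm ?_ (zero_le)
  have h1 := FloorSemiring.tendsto_pow_div_factorial_atTop (c * t)
  have h2 : Tendsto (fun n : ℕ => K * ENNReal.ofReal ((c * t) ^ n / n.factorial)) atTop
      (𝓝 (K * ENNReal.ofReal 0)) :=
    ENNReal.Tendsto.const_mul (ENNReal.tendsto_ofReal h1) (Or.inr hK)
  simpa using ge_of_tendsto' h2 fun n => key n t ht

section

variable {B : ℝ → ℝ → ℝ} {b R₀ δ : ℝ} {Φ : ℝ → ℝ≥0∞} {F : Phase → ℝ} {M E : ℝ≥0∞}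

lemma GoodKernel.integrable_collisions (hK : GoodKernel B b R₀ δ Φ) (hF : Slice F M E) :
    Integrable (collisions B F) colXMeas := by
  have := hK.integrable_collisions_mul hF (ζ := fun _ => 1) measurable_const (C := 1) fun Y => by
    rw [abs_one, one_mul, wtX]
    linarith [one_le_wt Y.1.2, wt_pos Y.2.1]
  simpa using this

/-- A bound for the collision frequency. -/
def freq (b : ℝ) (M : ℝ≥0∞) : ℝ := (ENNReal.ofReal b * surf univ * M).toReal

lemma ofReal_freq (hM : M < ⊤) : ENNReal.ofReal (freq b M) = ENNReal.ofReal b * surf univ * M := by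
  have : surf univ < ⊤ := measure_lt_top _ _
  exact ENNReal.ofReal_toReal (by finiteness)

/-- The operator is the gain minus `L F` with `|L| ≤ freq b M`. Adding `freq b M * F` leaves the
coefficient `freq b M - L ∈ [0, 2 freq b M]` in front of `F`, so that term contributes at most `2
freq b M` times the negative part of `F`. The negative part of the gain contributes as much again,
once for each colliding particle; hence the `4`. -/
lemma GoodKernel.lintegral_neg_part_le (hK : GoodKernel B b R₀ δ Φ) (hF : Slice F M E) :
    ∫⁻ p, ENNReal.ofReal (-(collisionPhase B F F p + freq b M * F p)) ≤
      ENNReal.ofReal (4 * freq b M) * ∫⁻ p, ENNReal.ofReal (-F p) := by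
  have hFm := hF.measurable
  have hm := measurable_collisions hK.measurable hFm
  have hk := measurable_kernE hK.measurable
  have hlam0 : 0 ≤ freq b M := ENNReal.toReal_nonneg
  have hi := hK.integrable_collisions hF
  have hi' := measurePreserving_collideX.integrable_comp_of_integrable hi
  set n : Phase → ℝ≥0∞ := fun p => ENNReal.ofReal (-F p) with hn
  have hnm : Measurable n := by fun_prop
  have hdens : ∀ᵐ p : Phase, ∫⁻ vs : Vel, ‖F (p.1, vs)‖ₑ ≤ M :=
    (Measure.quasiMeasurePreserving_fst (μ := (volume : Measure ℝ))
      (ν := (volume : Measure Vel))).ae hF.density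
  have hpt : ∀ᵐ p, ENNReal.ofReal (-(collisionPhase B F F p + freq b M * F p)) ≤
      (∫⁻ z, ENNReal.ofReal (-collisions B F (collideX (p, z)))
        ∂((volume : Measure Vel).prod surf)) + ENNReal.ofReal (2 * freq b M) * n p := by
    filter_upwards [hi.prod_right_ae, hi'.prod_right_ae, hdens] with p hp hp' hpd
    set L : ℝ := ∫ z : Vel × Sph, kern B (p.2, z) * F (p.1, z.1)
      ∂((volume : Measure Vel).prod surf) with hL
    have hL1 : |L| ≤ freq b M := by
      rw [← Real.norm_eq_abs, ← ENNReal.ofReal_le_ofReal_iff hlam0, ofReal_norm, ofReal_freq hF.M_lt]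
      refine (enorm_integral_le_lintegral_enorm _).trans ?_
      calc ∫⁻ z : Vel × Sph, ‖kern B (p.2, z) * F (p.1, z.1)‖ₑ ∂((volume : Measure Vel).prod surf)
          ≤ ∫⁻ z : Vel × Sph, ENNReal.ofReal b * ‖F (p.1, z.1)‖ₑ
              ∂((volume : Measure Vel).prod surf) := by
            refine lintegral_mono fun z => ?_
            rw [enorm_mul, hK.enorm_kern]
            gcongr
            exact hK.kernE_le _
        _ = ENNReal.ofReal b * surf univ * ∫⁻ vs : Vel, ‖F (p.1, vs)‖ₑ := by
            rw [lintegral_prod _ (by fun_prop)]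
            simp only [lintegral_const]
            rw [lintegral_mul_const _ (by fun_prop), lintegral_const_mul _ (by fun_prop)]
            ring
        _ ≤ _ := by gcongr
    have hQ : collisionPhase B F F p = (∫ z, collisions B F (collideX (p, z))
        ∂((volume : Measure Vel).prod surf)) - L * F p := by
      have := integral_sub hp' hp
      simp only [Function.comp_apply] at this
      rw [collisionPhase_eq, this, hL, ← integral_mul_const]
      congr 1
      refine integral_congr_ae (Eventually.of_forall fun z => ?_)
      simp only [collisions]
      ring
    have h1 : -(collisionPhase B F F p + freq b M * F p) =
        (∫ z, -collisions B F (collideX (p, z)) ∂((volume : Measure Vel).prod surf)) +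
          (freq b M - L) * (-F p) := by
      rw [hQ, integral_neg]; ring
    rw [h1]
    refine ENNReal.ofReal_add_le.trans (add_le_add (ofReal_integral_le_lintegral _) ?_)
    rw [ENNReal.ofReal_mul (by linarith [(abs_le.1 hL1).2])]
    gcongr
    linarith [(abs_le.1 hL1).1]
  have hneg : ∫⁻ Y, ENNReal.ofReal (-collisions B F Y) ∂colXMeas ≤
      2 * (ENNReal.ofReal b * surf univ * M * ∫⁻ p, n p) := by
    set g : ColX → ℝ≥0∞ := fun Y => kernE B (Y.1.2, Y.2) * (‖F (Y.1.1, Y.2.1)‖ₑ * n Y.1) with hg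
    have hgm : Measurable g := by fun_prop
    have h2 : ∀ Y, ENNReal.ofReal (-collisions B F Y) ≤ g Y + g (exchangeX Y) := by
      intro Y
      have h3 : kernE B ((exchangeX Y).1.2, (exchangeX Y).2) = kernE B (Y.1.2, Y.2) := by
        simp only [kernE, exchangeX, Prod.mk.eta, kern_exchange]
      simp only [hg, h3]
      rw [collisions, ← mul_neg, ENNReal.ofReal_mul (hK.kern_nonneg _), ← kernE, ← mul_add]
      refine mul_le_mul_right ((ofReal_neg_mul_le _ _).trans (le_of_eq ?_)) _
      simp only [hn, exchangeX, exchange]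
      ring
    refine (lintegral_mono h2).trans ?_
    rw [lintegral_add_left hgm, measurePreserving_exchangeX.lintegral_comp hgm, ← two_mul]
    exact mul_le_mul_right (hK.lintegral_pair_le (e := fun p => ‖F p‖ₑ) (by fun_prop) hnm
      hF.density) _
  refine (lintegral_mono_ae hpt).trans ?_
  rw [lintegral_add_right _ (by fun_prop), lintegral_const_mul _ hnm]
  have h4 : ∫⁻ p : Phase, ∫⁻ z, ENNReal.ofReal (-collisions B F (collideX (p, z)))
        ∂((volume : Measure Vel).prod surf) = ∫⁻ Y, ENNReal.ofReal (-collisions B F Y) ∂colXMeas := by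
    rw [← measurePreserving_collideX.lintegral_comp
      (f := fun Y => ENNReal.ofReal (-collisions B F Y)) (by fun_prop)]
    exact (lintegral_prod (f := fun Y : ColX => ENNReal.ofReal (-collisions B F (collideX Y)))
      (by fun_prop)).symm
  rw [h4]
  refine (add_le_add_left hneg _).trans (le_of_eq ?_)
  rw [← ofReal_freq hF.M_lt, ← mul_assoc, ← add_mul]
  congr 1
  rw [show (2 : ℝ≥0∞) = ENNReal.ofReal 2 by simp, ← ENNReal.ofReal_mul (by norm_num),
    ← ENNReal.ofReal_add (by positivity) (by positivity)]
  congr 1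
  ring

end

namespace Sol

variable {B : ℝ → ℝ → ℝ} {f : ℝ → Phase → ℝ} {b R₀ δ : ℝ} {Φ : ℝ → ℝ≥0∞} {M E : ℝ≥0∞}

lemma lintegral_enorm_le (h : Sol B f b R₀ δ Φ M E) {t : ℝ} (ht : 0 ≤ t) :
    ∫⁻ p, ‖f t p‖ₑ ≤ E := by
  refine le_trans (lintegral_mono fun p => ?_) (h.moment t ht)
  refine le_mul_of_one_le_left (zero_le) ?_
  rw [← ENNReal.ofReal_one]
  exact ENNReal.ofReal_le_ofReal (one_le_wt _)

/-- The solution stays non-negative. -/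
lemma nonneg (h : Sol B f b R₀ δ Φ M E) {T : ℝ} (hT : 0 ≤ T) : ∀ᵐ p, 0 ≤ f T p := by
  -- The integrating factor `exp (lam t)` adds `lam f` to the collision term, as
  -- `GoodKernel.lintegral_neg_part_le` requires.
  set lam := freq b M with hlam
  have hlam0 : 0 ≤ lam := ENNReal.toReal_nonneg
  set N : ℝ → ℝ≥0∞ := fun t => ENNReal.ofReal (Real.exp (lam * t)) *
    ∫⁻ p, ENNReal.ofReal (-f t p) with hN
  have hNneg : ∀ t, 0 ≤ t → ∫⁻ p, ENNReal.ofReal (-f t p) ≤ E := fun t ht =>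
    (lintegral_mono fun p => by
      rw [← ofReal_norm]; exact ENNReal.ofReal_le_ofReal (neg_le_abs _)).trans
      (h.lintegral_enorm_le ht)
  have hb : ∀ t ∈ Icc 0 T, N t ≤ ENNReal.ofReal (Real.exp (lam * T)) * E := by
    intro t ht
    refine mul_le_mul' (ENNReal.ofReal_le_ofReal (Real.exp_le_exp.2 ?_)) (hNneg t ht.1)
    exact mul_le_mul_of_nonneg_left ht.2 hlam0
  have hG : ∀ t ∈ Icc 0 T, N t ≤ ENNReal.ofReal (4 * lam) * ∫⁻ s in Ioc 0 t, N s := by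
    intro t ht
    have hev := h.evolution ht.1
    have hmr := h.measurable_rate (t := fun a : Phase × ℝ => a.2) (p := fun a => a.1)
      (by fun_prop) (by fun_prop)
    have hma := h.measurable_along (t := fun a : Phase × ℝ => a.2) (p := fun a => a.1)
      (by fun_prop) (by fun_prop)
    have h1 : N t = ∫⁻ p, ENNReal.ofReal (-(along f t p * Real.exp (lam * t))) := by
      have hm := h.measurable_slice t
      have h2 : ∫⁻ p, ENNReal.ofReal (-f t p) = ∫⁻ p, ENNReal.ofReal (-along f t p) :=
        ((measurePreserving_shear (-t)).lintegral_comp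
          (f := fun p : Phase => ENNReal.ofReal (-f t p)) (by fun_prop)).symm
      simp only [hN]
      rw [h2, ← lintegral_const_mul' _ _ ENNReal.ofReal_ne_top]
      refine lintegral_congr fun p => ?_
      rw [← ENNReal.ofReal_mul (Real.exp_pos _).le]
      congr 1
      ring
    rw [h1]
    calc ∫⁻ p, ENNReal.ofReal (-(along f t p * Real.exp (lam * t)))
        ≤ ∫⁻ p, ∫⁻ s in Ioc 0 t, ENNReal.ofReal (Real.exp (lam * s)) *
            ENNReal.ofReal (-(rate B f s p + lam * along f s p)) := by
          refine lintegral_mono_ae ?_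
          filter_upwards [hev, h.initial_nonneg] with p hp hp0
          have h3 := hp (fun s => Real.exp (lam * s)) (fun s => Real.exp (lam * s) * lam)
            (fun s => by simpa using ((hasDerivAt_id s).const_mul lam).exp) (by fun_prop)
          have h4 : -(along f t p * Real.exp (lam * t)) ≤ ∫ s in Ioc 0 t,
              -(rate B f s p * Real.exp (lam * s) + along f s p * (Real.exp (lam * s) * lam)) := by
            rw [integral_neg, ← h3]
            simp only [mul_zero, Real.exp_zero, mul_one]
            linarith
          refine (ENNReal.ofReal_le_ofReal h4).trans ((ofReal_integral_le_lintegral _).trans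
            (le_of_eq (lintegral_congr fun s => ?_)))
          rw [← ENNReal.ofReal_mul (Real.exp_pos _).le]
          congr 1
          ring
      _ = ∫⁻ s in Ioc 0 t, ENNReal.ofReal (Real.exp (lam * s)) *
            ∫⁻ p, ENNReal.ofReal (-(rate B f s p + lam * along f s p)) := by
          rw [lintegral_lintegral_swap (by simp only [Function.uncurry_def]; fun_prop)]
          refine lintegral_congr fun s => ?_
          rw [lintegral_const_mul' _ _ ENNReal.ofReal_ne_top]
      _ ≤ ∫⁻ s in Ioc 0 t, ENNReal.ofReal (4 * lam) * N s := by
          refine lintegral_mono_ae ((ae_restrict_iff' measurableSet_Ioc).2 ?_)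
          filter_upwards [h.slice] with s hs hs0
          have hsl := hs hs0.1.le
          have h5 := h.kernel.lintegral_neg_part_le hsl
          have hmf := h.measurable_slice s
          have hmQ := Boltzmann1D.measurable_collisionPhase h.kernel.measurable hmf
          have h6 : ∫⁻ p, ENNReal.ofReal (-(rate B f s p + lam * along f s p)) =
              ∫⁻ p, ENNReal.ofReal (-(collisionPhase B (f s) (f s) p + lam * f s p)) :=
            (measurePreserving_shear (-s)).lintegral_comp (f := fun p : Phase =>
              ENNReal.ofReal (-(collisionPhase B (f s) (f s) p + lam * f s p))) (by fun_prop)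
          simp only [hN]
          rw [h6]
          refine (mul_le_mul_right h5 _).trans (le_of_eq ?_)
          ring
      _ = _ := lintegral_const_mul' _ _ ENNReal.ofReal_ne_top
  have h0 := eq_zero_of_le_lintegral (by positivity) (ENNReal.mul_ne_top ENNReal.ofReal_ne_top
    h.E_lt.ne) hb hG T ⟨hT, le_rfl⟩
  have hm := h.measurable_slice T
  have h7 : ∫⁻ p, ENNReal.ofReal (-f T p) = 0 := by
    rcases mul_eq_zero.1 h0 with h8 | h8
    · exact absurd h8 (ENNReal.ofReal_pos.2 (Real.exp_pos _)).ne'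
    · exact h8
  rw [lintegral_eq_zero_iff (by fun_prop)] at h7
  filter_upwards [h7] with p hp
  simpa using hp

end Sol

/-! ### Bony's functional -/

/-- Bony's weight for a pair of trajectories. -/
def bonyWt (ε s : ℝ) (P : Phase × Phase) : ℝ :=
  (P.2.2 0 - P.1.2 0) * Real.arctan ((P.2.1 - P.1.1 + s * (P.2.2 0 - P.1.2 0)) / ε)

/-- The time derivative of Bony's weight. -/
def bonyWt' (ε s : ℝ) (P : Phase × Phase) : ℝ :=
  (P.2.2 0 - P.1.2 0) ^ 2 *
    (ε⁻¹ * (1 + ((P.2.1 - P.1.1 + s * (P.2.2 0 - P.1.2 0)) / ε) ^ 2)⁻¹)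

/-- The arctangent is a smooth bounded substitute for the sign of the distance between the particles
at time `s`. Its derivative is a non-negative kernel concentrating, as `ε → 0`, on pairs at the same
place. -/
lemma hasDerivAt_bonyWt (ε s : ℝ) (P : Phase × Phase) :
    HasDerivAt (fun s => bonyWt ε s P) (bonyWt' ε s P) s := by
  have h1 : HasDerivAt (fun s => (P.2.1 - P.1.1 + s * (P.2.2 0 - P.1.2 0)) / ε)
      ((1 * (P.2.2 0 - P.1.2 0)) / ε) s :=
    (((hasDerivAt_id s).mul_const _).const_add _).div_const _
  refine (h1.arctan.const_mul (P.2.2 0 - P.1.2 0)).congr_deriv ?_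
  rw [bonyWt']
  ring

lemma continuous_bonyWt' (ε : ℝ) (P : Phase × Phase) : Continuous fun s => bonyWt' ε s P := by
  unfold bonyWt'
  refine continuous_const.mul (continuous_const.mul (Continuous.inv₀ (by fun_prop) fun s => ?_))
  positivity

@[fun_prop]
lemma measurable_bonyWt {α : Type*} [MeasurableSpace α] (ε : ℝ) {s : α → ℝ} {P : α → Phase × Phase}
    (hs : Measurable s) (hP : Measurable P) : Measurable fun a => bonyWt ε (s a) (P a) := by
  unfold bonyWt; fun_prop

@[fun_prop]
lemma measurable_bonyWt' {α : Type*} [MeasurableSpace α] (ε : ℝ) {s : α → ℝ}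
    {P : α → Phase × Phase} (hs : Measurable s) (hP : Measurable P) :
    Measurable fun a => bonyWt' ε (s a) (P a) := by
  unfold bonyWt'; fun_prop

lemma abs_coord_le (v : Vel) : |v 0| ≤ ‖v‖ := by
  simpa using PiLp.norm_apply_le v 0

lemma abs_sub_coord_le (v w : Vel) : |w 0 - v 0| ≤ wt v * wt w := by
  have h1 := abs_coord_le v
  have h2 := abs_coord_le w
  have h3 := abs_sub (w 0) (v 0)
  unfold wt
  nlinarith [sq_nonneg (‖v‖ - 1), sq_nonneg (‖w‖ - 1), mul_nonneg (sq_nonneg ‖v‖) (sq_nonneg ‖w‖)]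

lemma sq_sub_coord_le (v w : Vel) : (w 0 - v 0) ^ 2 ≤ 2 * (wt v * wt w) := by
  have h1 := sq_le_sq' (abs_le.1 (abs_coord_le v)).1 (abs_le.1 (abs_coord_le v)).2
  have h2 := sq_le_sq' (abs_le.1 (abs_coord_le w)).1 (abs_le.1 (abs_coord_le w)).2
  unfold wt
  nlinarith [sq_nonneg (v 0 + w 0), mul_nonneg (sq_nonneg ‖v‖) (sq_nonneg ‖w‖)]

lemma abs_arctan_le (x : ℝ) : |Real.arctan x| ≤ Real.pi / 2 :=
  abs_le.2 ⟨(Real.neg_pi_div_two_lt_arctan x).le, (Real.arctan_lt_pi_div_two x).le⟩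

lemma abs_bonyWt_le (ε s : ℝ) (P : Phase × Phase) :
    |bonyWt ε s P| ≤ Real.pi / 2 * (wt P.1.2 * wt P.2.2) := by
  rw [bonyWt, abs_mul, mul_comm]
  exact mul_le_mul (abs_arctan_le _) (abs_sub_coord_le _ _) (abs_nonneg _) (by positivity)

lemma bonyWt'_nonneg {ε : ℝ} (hε : 0 < ε) (s : ℝ) (P : Phase × Phase) : 0 ≤ bonyWt' ε s P := by
  unfold bonyWt'; positivity

lemma abs_bonyWt'_le {ε : ℝ} (hε : 0 < ε) (s : ℝ) (P : Phase × Phase) :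
    |bonyWt' ε s P| ≤ 2 * ε⁻¹ * (wt P.1.2 * wt P.2.2) := by
  rw [abs_of_nonneg (bonyWt'_nonneg hε s P), bonyWt']
  have h1 : (1 + ((P.2.1 - P.1.1 + s * (P.2.2 0 - P.1.2 0)) / ε) ^ 2)⁻¹ ≤ 1 :=
    inv_le_one_of_one_le₀ (by nlinarith [sq_nonneg ((P.2.1 - P.1.1 +
      s * (P.2.2 0 - P.1.2 0)) / ε)])
  calc _ ≤ (2 * (wt P.1.2 * wt P.2.2)) * (ε⁻¹ * 1) := by
        refine mul_le_mul (sq_sub_coord_le _ _) ?_ (by positivity) ?_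
        · gcongr
        · have := wt_pos P.1.2
          have := wt_pos P.2.2
          positivity
    _ = _ := by ring

lemma bonyWt_swap (ε s : ℝ) (P : Phase × Phase) : bonyWt ε s P.swap = bonyWt ε s P := by
  have : (P.1.1 - P.2.1 + s * (P.1.2 0 - P.2.2 0)) / ε =
      -((P.2.1 - P.1.1 + s * (P.2.2 0 - P.1.2 0)) / ε) := by ring
  simp only [bonyWt, Prod.fst_swap, Prod.snd_swap, this, Real.arctan_neg]
  ring

lemma bonyWt_shear (ε s : ℝ) (p p' : Phase) : bonyWt ε s (p, p') =
    bonyWt ε 0 (shear (-s) p, shear (-s) p') := by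
  simp only [bonyWt, shear]
  congr 3
  ring

lemma bonyWt'_shear (ε s : ℝ) (p p' : Phase) : bonyWt' ε s (p, p') =
    bonyWt' ε 0 (shear (-s) p, shear (-s) p') := by
  simp only [bonyWt', shear]
  congr 5
  ring

section

variable {B : ℝ → ℝ → ℝ} {b R₀ δ : ℝ} {Φ : ℝ → ℝ≥0∞} {F : Phase → ℝ} {M E : ℝ≥0∞}

/-- Conservation of mass and of the first component of momentum. -/
lemma GoodKernel.integral_collisionPhase_bonyWt (hK : GoodKernel B b R₀ δ Φ) (hF : Slice F M E)
    (ε : ℝ) (p' : Phase) : ∫ p, collisionPhase B F F p * bonyWt ε 0 (p, p') = 0 := by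
  set η : ℝ → ℝ := fun x => Real.arctan ((p'.1 - x) / ε) with hη
  have hηm : Measurable η := by fun_prop
  have h1 := hK.integral_collisionPhase_mul hF (χ := fun p => bonyWt ε 0 (p, p')) (by fun_prop)
    (C := Real.pi / 2 * wt p'.2) fun p => (abs_bonyWt_le ε 0 (p, p')).trans (le_of_eq (by ring))
  rw [h1]
  -- At a fixed position the weight is affine in `v₁`, so a collision changes it only through the
  -- change of momentum.
  have h2 : ∀ Y : ColX, bonyWt ε 0 ((collideX Y).1, p') - bonyWt ε 0 (Y.1, p') =
      (Y.1.2 0 - postV Y.1.2 Y.2.1 Y.2.2 0) * η Y.1.1 := by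
    intro Y
    simp only [bonyWt, collideX, collide, zero_mul, add_zero, hη]
    ring
  simp only [h2]
  have h3 := integral_collisions_exchangeX hK.measurable hF.measurable
    (ζ := fun Y => (Y.1.2 0 - postV Y.1.2 Y.2.1 Y.2.2 0) * η Y.1.1) (by fun_prop)
  -- The two particles of a collision change their momenta by opposite amounts, so the integrand is
  -- odd under exchange.
  have h4 : ∀ Y : ColX, ((exchangeX Y).1.2 0 -
      postV (exchangeX Y).1.2 (exchangeX Y).2.1 (exchangeX Y).2.2 0) * η (exchangeX Y).1.1 =
      -((Y.1.2 0 - postV Y.1.2 Y.2.1 Y.2.2 0) * η Y.1.1) := by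
    intro Y
    simp only [exchangeX, exchange, postV_zero, norm_sub_rev Y.2.1 Y.1.2]
    simp
    ring
  simp only [h4, mul_neg, integral_neg] at h3
  linarith

end

lemma lintegral_pair_mul_le {A C : Phase → ℝ} (hA : Measurable A) (hC : Measurable C) {K₁ K₂ : ℝ≥0∞}
    (h1 : ∫⁻ p, ENNReal.ofReal (wt p.2) * ‖A p‖ₑ ≤ K₁)
    (h2 : ∫⁻ p, ENNReal.ofReal (wt p.2) * ‖C p‖ₑ ≤ K₂) {κ : Phase × Phase → ℝ} {c : ℝ}
    (hc : ∀ P, |κ P| ≤ c * (wt P.1.2 * wt P.2.2)) :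
    ∫⁻ P : Phase × Phase, ‖A P.1 * C P.2 * κ P‖ₑ ≤ ENNReal.ofReal c * (K₁ * K₂) := by
  calc ∫⁻ P : Phase × Phase, ‖A P.1 * C P.2 * κ P‖ₑ
      ≤ ∫⁻ P : Phase × Phase, ENNReal.ofReal c * ((ENNReal.ofReal (wt P.1.2) * ‖A P.1‖ₑ) *
          (ENNReal.ofReal (wt P.2.2) * ‖C P.2‖ₑ)) := by
        refine lintegral_mono fun P => ?_
        have h3 : ‖κ P‖ₑ ≤ ENNReal.ofReal c * (ENNReal.ofReal (wt P.1.2) *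
            ENNReal.ofReal (wt P.2.2)) := by
          rw [← ofReal_norm, ← ENNReal.ofReal_mul (wt_pos _).le, ← ENNReal.ofReal_mul'
            (mul_pos (wt_pos _) (wt_pos _)).le]
          exact ENNReal.ofReal_le_ofReal (hc P)
        rw [enorm_mul, enorm_mul]
        exact (mul_le_mul_right h3 _).trans (le_of_eq (by ring))
    _ = ENNReal.ofReal c * ((∫⁻ p, ENNReal.ofReal (wt p.2) * ‖A p‖ₑ) *
          ∫⁻ p, ENNReal.ofReal (wt p.2) * ‖C p‖ₑ) := by
        rw [lintegral_const_mul' _ _ ENNReal.ofReal_ne_top]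
        congr 1
        exact lintegral_prod_mul (μ := (volume : Measure Phase)) (ν := (volume : Measure Phase))
          (f := fun p : Phase => ENNReal.ofReal (wt p.2) * ‖A p‖ₑ)
          (g := fun p : Phase => ENNReal.ofReal (wt p.2) * ‖C p‖ₑ) (by fun_prop) (by fun_prop)
    _ ≤ _ := by gcongr

lemma integrable_pair {μ : Measure ℝ} [IsFiniteMeasure μ] {A C : ℝ → Phase → ℝ}
    (hA : Measurable (Function.uncurry A)) (hC : Measurable (Function.uncurry C)) {K₁ K₂ : ℝ≥0∞}
    (hK₁ : K₁ < ⊤) (hK₂ : K₂ < ⊤)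
    (h1 : ∀ᵐ s ∂μ, ∫⁻ p, ENNReal.ofReal (wt p.2) * ‖A s p‖ₑ ≤ K₁)
    (h2 : ∀ᵐ s ∂μ, ∫⁻ p, ENNReal.ofReal (wt p.2) * ‖C s p‖ₑ ≤ K₂)
    {κ : ℝ → Phase × Phase → ℝ} (hκ : Measurable (Function.uncurry κ)) {c : ℝ}
    (hc : ∀ s P, |κ s P| ≤ c * (wt P.1.2 * wt P.2.2)) :
    Integrable (fun a : ℝ × (Phase × Phase) => A a.1 a.2.1 * C a.1 a.2.2 * κ a.1 a.2)
      (μ.prod volume) := by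
  have hm1 : Measurable fun a : ℝ × (Phase × Phase) => A a.1 a.2.1 :=
    hA.comp (f := fun a : ℝ × (Phase × Phase) => (a.1, a.2.1)) (by fun_prop)
  have hm2 : Measurable fun a : ℝ × (Phase × Phase) => C a.1 a.2.2 :=
    hC.comp (f := fun a : ℝ × (Phase × Phase) => (a.1, a.2.2)) (by fun_prop)
  have hm3 : Measurable fun a : ℝ × (Phase × Phase) => κ a.1 a.2 := hκ
  refine ⟨((hm1.mul hm2).mul hm3).aestronglyMeasurable, ?_⟩
  rw [hasFiniteIntegral_iff_enorm, lintegral_prod _ (by fun_prop)]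
  calc _ ≤ ∫⁻ s, ENNReal.ofReal c * (K₁ * K₂) ∂μ := by
        refine lintegral_mono_ae ?_
        filter_upwards [h1, h2] with s hs1 hs2
        exact lintegral_pair_mul_le (hA.comp (measurable_const.prodMk measurable_id))
          (hC.comp (measurable_const.prodMk measurable_id)) hs1 hs2 (hc s)
    _ < ⊤ := by
        rw [lintegral_const]
        have : μ univ < ⊤ := measure_lt_top _ _
        finiteness

namespace Sol

variable {B : ℝ → ℝ → ℝ} {f : ℝ → Phase → ℝ} {b R₀ δ : ℝ} {Φ : ℝ → ℝ≥0∞} {M E : ℝ≥0∞}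

lemma integral_rate_bonyWt (h : Sol B f b R₀ δ Φ M E) (ε : ℝ) : ∀ᵐ s : ℝ, 0 ≤ s →
    ∀ p', ∫ p, rate B f s p * bonyWt ε s (p, p') = 0 := by
  filter_upwards [h.slice] with s hs hs0 p'
  have hm := Boltzmann1D.measurable_collisionPhase h.kernel.measurable (h.measurable_slice s)
  rw [← h.kernel.integral_collisionPhase_bonyWt (hs hs0) ε (shear (-s) p')]
  simp only [bonyWt_shear ε s, rate]
  have h3 := integral_map (μ := (volume : Measure Phase)) (φ := shear (-s))
      (f := fun p => collisionPhase B (f s) (f s) p * bonyWt ε 0 (p, shear (-s) p'))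
      (by fun_prop) (by fun_prop)
  rw [(measurePreserving_shear (-s)).map_eq] at h3
  rw [h3]

/-- Bony's functional inequality, regularized. -/
lemma lintegral_bonyWt'_le (h : Sol B f b R₀ δ Φ M E) {T : ℝ} (hT : 0 ≤ T) {ε : ℝ} (hε : 0 < ε) :
    ∫⁻ s in Ioc 0 T, ∫⁻ P : Phase × Phase,
      ENNReal.ofReal (along f s P.1 * along f s P.2 * bonyWt' ε s P) ≤
      ENNReal.ofReal Real.pi * (E * E) := by
  have hmr : Measurable (Function.uncurry (rate B f)) :=
    h.measurable_rate (t := fun a : ℝ × Phase => a.1) (p := fun a => a.2) (by fun_prop) (by fun_prop)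
  have hma : Measurable (Function.uncurry (along f)) :=
    h.measurable_along (t := fun a : ℝ × Phase => a.1) (p := fun a => a.2) (by fun_prop) (by fun_prop)
  have hmat : ∀ t, Measurable (along f t) := fun t => hma.comp (measurable_const.prodMk measurable_id)
  set μ : Measure ℝ := volume.restrict (Ioc 0 T) with hμ
  have hpos : ∀ᵐ s ∂μ, 0 ≤ s := by
    filter_upwards [ae_restrict_mem measurableSet_Ioc] with s hs using hs.1.le
  have hK := colBound_lt_top (b := b) h.M_lt h.E_lt
  have hR : ∀ᵐ s ∂μ, ∫⁻ p : Phase, ENNReal.ofReal (wt p.2) * ‖rate B f s p‖ₑ ≤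
      2 * colBound b M E := by
    filter_upwards [ae_restrict_of_ae h.lintegral_rate_le, hpos] with s hs hs0 using hs hs0
  have hA : ∀ᵐ s ∂μ, ∫⁻ p : Phase, ENNReal.ofReal (wt p.2) * ‖along f s p‖ₑ ≤ E := by
    filter_upwards [hpos] with s hs using h.lintegral_along_le hs
  have hκ : Measurable (Function.uncurry (bonyWt ε)) := by
    simp only [Function.uncurry_def]; fun_prop
  have hκ' : Measurable (Function.uncurry (bonyWt' ε)) := by
    simp only [Function.uncurry_def]; fun_prop
  have i1 := integrable_pair (μ := μ) hmr hma (by finiteness) h.E_lt hR hA hκ (abs_bonyWt_le ε)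
  have i2 := integrable_pair (μ := μ) hma hmr h.E_lt (by finiteness) hA hR hκ (abs_bonyWt_le ε)
  have i3 := integrable_pair (μ := μ) hma hma h.E_lt h.E_lt hA hA hκ' (abs_bonyWt'_le hε)
  have hev := h.evolution_pair hT
  set L : Phase × Phase → ℝ := fun P => along f T P.1 * along f T P.2 * bonyWt ε T P -
    f 0 P.1 * f 0 P.2 * bonyWt ε 0 P with hL
  -- The functional changes only through the time derivative of the weight: the two collision terms
  -- vanish, the first by conservation for each fixed second particle, the other by symmetry of the
  -- weight.
  have hLeq : ∫ P, L P = ∫ s, (∫ P : Phase × Phase,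
      along f s P.1 * along f s P.2 * bonyWt' ε s P) ∂μ := by
    have e1 : ∫ P, L P = ∫ P : Phase × Phase, ∫ s, ((rate B f s P.1 * along f s P.2 * bonyWt ε s P +
        along f s P.1 * rate B f s P.2 * bonyWt ε s P) +
        along f s P.1 * along f s P.2 * bonyWt' ε s P) ∂μ := by
      refine integral_congr_ae ?_
      filter_upwards [hev] with P hP
      simp only [hL]
      rw [hP (fun s => bonyWt ε s P) (fun s => bonyWt' ε s P) (hasDerivAt_bonyWt ε · P)
        (continuous_bonyWt' ε P)]
      refine integral_congr_ae (Eventually.of_forall fun s => ?_)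
      simp only
      ring
    rw [e1, integral_integral_swap]
    swap
    · exact ((i1.add i2).add i3).swap
    refine integral_congr_ae ?_
    filter_upwards [i1.prod_right_ae, i2.prod_right_ae, i3.prod_right_ae,
      ae_restrict_of_ae (h.integral_rate_bonyWt ε), hpos] with s j1 j2 j3 hz hs0
    have z1 : ∫ P : Phase × Phase, rate B f s P.1 * along f s P.2 * bonyWt ε s P = 0 := by
      refine (integral_prod_symm _ j1).trans ?_
      have : ∀ p' : Phase, ∫ p : Phase, rate B f s p * along f s p' * bonyWt ε s (p, p') = 0 := by
        intro p'
        rw [← zero_mul (along f s p'), ← hz hs0 p', ← integral_mul_const]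
        refine integral_congr_ae (Eventually.of_forall fun p => ?_)
        simp only
        ring
      simp only [this, integral_zero]
    have z2 : ∫ P : Phase × Phase, along f s P.1 * rate B f s P.2 * bonyWt ε s P = 0 := by
      rw [← z1]
      refine Eq.trans ?_ (integral_prod_swap (μ := (volume : Measure Phase))
        (ν := (volume : Measure Phase))
        (fun P : Phase × Phase => rate B f s P.1 * along f s P.2 * bonyWt ε s P))
      refine integral_congr_ae (Eventually.of_forall fun P => ?_)
      simp only [bonyWt_swap, Prod.fst_swap, Prod.snd_swap]
      ring
    have := integral_add (j1.add j2) j3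
    have := integral_add j1 j2
    simp only [Pi.add_apply] at *
    linarith
  -- The bound `π / 2` for the arctangent enters once for each end of the time interval.
  have hLle : ENNReal.ofReal (∫ P, L P) ≤ ENNReal.ofReal Real.pi * (E * E) := by
    refine (ENNReal.ofReal_le_ofReal (le_abs_self _)).trans ?_
    rw [← Real.norm_eq_abs, ofReal_norm]
    refine (enorm_integral_le_lintegral_enorm _).trans ?_
    have hmf := h.measurable_slice 0
    have hmT := hmat T
    calc ∫⁻ P, ‖L P‖ₑ ≤ ∫⁻ P : Phase × Phase, (‖along f T P.1 * along f T P.2 * bonyWt ε T P‖ₑ +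
          ‖f 0 P.1 * f 0 P.2 * bonyWt ε 0 P‖ₑ) := lintegral_mono fun P => enorm_sub_le
      _ ≤ ENNReal.ofReal (Real.pi / 2) * (E * E) + ENNReal.ofReal (Real.pi / 2) * (E * E) := by
          rw [lintegral_add_right _ (by fun_prop)]
          exact add_le_add (lintegral_pair_mul_le hmT hmT (h.lintegral_along_le hT)
            (h.lintegral_along_le hT) (abs_bonyWt_le ε T))
            (lintegral_pair_mul_le hmf hmf (h.moment 0 le_rfl) (h.moment 0 le_rfl)
              (abs_bonyWt_le ε 0))
      _ = _ := by
          rw [← add_mul, ← ENNReal.ofReal_add (by positivity) (by positivity), add_halves]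
  have hnn : ∀ s, 0 ≤ s → ∀ᵐ P : Phase × Phase,
      0 ≤ along f s P.1 * along f s P.2 * bonyWt' ε s P := by
    intro s hs
    have h1 : ∀ᵐ p, 0 ≤ along f s p :=
      (measurePreserving_shear (-s)).quasiMeasurePreserving.ae (h.nonneg hs)
    filter_upwards [(Measure.quasiMeasurePreserving_fst (μ := (volume : Measure Phase))
      (ν := (volume : Measure Phase))).ae h1, (Measure.quasiMeasurePreserving_snd
      (μ := (volume : Measure Phase)) (ν := (volume : Measure Phase))).ae h1] with P hP1 hP2
    exact mul_nonneg (mul_nonneg hP1 hP2) (bonyWt'_nonneg hε s P)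
  refine le_trans (le_of_eq ?_) hLle
  rw [hLeq, ofReal_integral_eq_lintegral_ofReal i3.integral_prod_left]
  · refine lintegral_congr_ae ?_
    filter_upwards [i3.prod_right_ae, hpos] with s j3 hs0
    exact (ofReal_integral_eq_lintegral_ofReal j3 (hnn s hs0)).symm
  · filter_upwards [hpos] with s hs0
    exact integral_nonneg_of_ae (hnn s hs0)

end Sol

/-! ### Removing the regularization -/

/-- The spread of the first component of the velocities of pairs of particles at the same place. -/
def spread (e : Phase → ℝ≥0∞) : ℝ≥0∞ :=
  ∫⁻ p : Phase, ∫⁻ w : Vel, ENNReal.ofReal ((p.2 0 - w 0) ^ 2) * (e p * e (p.1, w))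

/-- A normalized indicator function of the pairs of points at distance at most `ε`. -/
def near (ε x y : ℝ) : ℝ≥0∞ := if |y - x| ≤ ε then (ENNReal.ofReal (2 * ε))⁻¹ else 0

@[fun_prop]
lemma measurable_near {α : Type*} [MeasurableSpace α] (ε : ℝ) {x y : α → ℝ}
    (hx : Measurable x) (hy : Measurable y) : Measurable fun a => near ε (x a) (y a) :=
  Measurable.ite (measurableSet_le (by fun_prop) measurable_const) measurable_const measurable_const

/-- At distance at most `ε` the kernel `ε⁻¹ (1 + (·/ε)²)⁻¹` is at least `1 / (2 ε)`, which is
exactly the height of `near`. -/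
lemma near_mul_le {ε : ℝ} (hε : 0 < ε) (p p' : Phase) :
    near ε p.1 p'.1 * ENNReal.ofReal ((p.2 0 - p'.2 0) ^ 2) ≤
      ENNReal.ofReal (bonyWt' ε 0 (p, p')) := by
  rw [near]
  split_ifs with h
  · rw [← ENNReal.ofReal_inv_of_pos (by positivity), ← ENNReal.ofReal_mul (by positivity)]
    refine ENNReal.ofReal_le_ofReal ?_
    have h1 : ((p'.1 - p.1) / ε) ^ 2 ≤ 1 := by
      rw [sq_le_one_iff_abs_le_one, abs_div, abs_of_pos hε]
      exact (div_le_one hε).2 h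
    have h2 : (2:ℝ)⁻¹ ≤ (1 + ((p'.1 - p.1) / ε) ^ 2)⁻¹ :=
      inv_anti₀ (by positivity) (by linarith)
    simp only [bonyWt', zero_mul, add_zero]
    calc (2 * ε)⁻¹ * (p.2 0 - p'.2 0) ^ 2 = (p'.2 0 - p.2 0) ^ 2 * (ε⁻¹ * 2⁻¹) := by
          rw [mul_inv]; ring
      _ ≤ _ := by gcongr
  · simp

lemma ae_tendsto_lintegral_near {G : ℝ → ℝ≥0∞} (hG : Measurable G) (hi : ∫⁻ y, G y ≠ ⊤)
    {ε : ℕ → ℝ} (hε : Tendsto ε atTop (𝓝[>] 0)) :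
    ∀ᵐ x, Tendsto (fun n => ∫⁻ y, near (ε n) x y * G y) atTop (𝓝 (G x)) := by
  filter_upwards [(Besicovitch.vitaliFamily (volume : Measure ℝ)).ae_tendsto_lintegral_div
    hG.aemeasurable hi] with x hx
  have h1 := (hx.comp (Besicovitch.tendsto_filterAt volume x)).comp hε
  refine h1.congr fun n => ?_
  simp only [Function.comp_apply, Real.volume_closedBall]
  rw [ENNReal.div_eq_inv_mul, ← lintegral_indicator measurableSet_closedBall,
    ← lintegral_const_mul _ (hG.indicator measurableSet_closedBall)]
  refine lintegral_congr fun y => ?_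
  by_cases h : |y - x| ≤ ε n
  · simp [near, h, Real.dist_eq]
  · simp [near, h, Real.dist_eq]

lemma mul_spread_eq_lintegral_near {e : Phase → ℝ≥0∞} (he : Measurable e) (p : Phase) (ε : ℝ) :
    ∫⁻ p' : Phase, near ε p.1 p'.1 * (ENNReal.ofReal ((p.2 0 - p'.2 0) ^ 2) * (e p * e p')) =
      e p * ∫⁻ y, near ε p.1 y * ∫⁻ w : Vel, ENNReal.ofReal ((p.2 0 - w 0) ^ 2) * e (y, w) := by
  have hm : Measurable fun y => ∫⁻ w : Vel, ENNReal.ofReal ((p.2 0 - w 0) ^ 2) * e (y, w) :=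
    Measurable.lintegral_prod_right'
      (f := fun q : ℝ × Vel => ENNReal.ofReal ((p.2 0 - q.2 0) ^ 2) * e (q.1, q.2)) (by fun_prop)
  rw [Measure.volume_eq_prod, lintegral_prod _ (by fun_prop), ← lintegral_const_mul _ (by fun_prop)]
  refine lintegral_congr fun y => ?_
  rw [← mul_assoc, ← lintegral_const_mul _ (by fun_prop)]
  refine lintegral_congr fun w => ?_
  ring

/-- Lebesgue differentiation is applied in `x` for each fixed `v`, because the function being
averaged depends on `v₁`; it is integrable by the moment bound. Hence the position is integrated
first. -/
lemma spread_le_lintegral_liminf {e : Phase → ℝ≥0∞} (he : Measurable e) (htop : ∀ p, e p ≠ ⊤)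
    (hm : ∫⁻ p, ENNReal.ofReal (wt p.2) * e p ≠ ⊤) {ε : ℕ → ℝ} (hε : Tendsto ε atTop (𝓝[>] 0)) :
    spread e ≤ ∫⁻ p : Phase, liminf (fun n => ∫⁻ p' : Phase, near (ε n) p.1 p'.1 *
      (ENNReal.ofReal ((p.2 0 - p'.2 0) ^ 2) * (e p * e p'))) atTop := by
  have hmeas : ∀ n, Measurable fun p : Phase => ∫⁻ p' : Phase, near (ε n) p.1 p'.1 *
      (ENNReal.ofReal ((p.2 0 - p'.2 0) ^ 2) * (e p * e p')) := fun n =>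
    Measurable.lintegral_prod_right' (f := fun P : Phase × Phase => near (ε n) P.1.1 P.2.1 *
      (ENNReal.ofReal ((P.1.2 0 - P.2.2 0) ^ 2) * (e P.1 * e P.2))) (by fun_prop)
  have hmeas2 : Measurable fun p : Phase => ∫⁻ w : Vel, ENNReal.ofReal ((p.2 0 - w 0) ^ 2) *
      (e p * e (p.1, w)) :=
    Measurable.lintegral_prod_right' (f := fun P : Phase × Vel =>
      ENNReal.ofReal ((P.1.2 0 - P.2 0) ^ 2) * (e P.1 * e (P.1.1, P.2))) (by fun_prop)
  refine (lintegral_prod_symm _ hmeas2.aemeasurable).trans_le (le_trans ?_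
    (lintegral_prod_symm _ (Measurable.liminf hmeas).aemeasurable).ge)
  refine lintegral_mono fun v => lintegral_mono_ae ?_
  set G : ℝ → ℝ≥0∞ := fun y => ∫⁻ w : Vel, ENNReal.ofReal ((v 0 - w 0) ^ 2) * e (y, w) with hG
  have hGm : Measurable G := Measurable.lintegral_prod_right'
      (f := fun q : ℝ × Vel => ENNReal.ofReal ((v 0 - q.2 0) ^ 2) * e (q.1, q.2)) (by fun_prop)
  have hGi : ∫⁻ y, G y ≠ ⊤ := by
    refine ne_top_of_le_ne_top (ENNReal.mul_ne_top (ENNReal.ofReal_ne_top (r := 2 * wt v)) hm) ?_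
    rw [← lintegral_const_mul _ (by fun_prop), Measure.volume_eq_prod,
      lintegral_prod _ (by fun_prop)]
    refine lintegral_mono fun y => lintegral_mono fun w => ?_
    simp only
    rw [← mul_assoc, ← ENNReal.ofReal_mul' (wt_pos _).le]
    refine mul_le_mul_left (ENNReal.ofReal_le_ofReal ((sq_sub_coord_le w v).trans
      (le_of_eq (by ring)))) _
  filter_upwards [ae_tendsto_lintegral_near hGm hGi hε] with x hx
  have h1 : Tendsto (fun n => ∫⁻ p' : Phase, near (ε n) x p'.1 *
      (ENNReal.ofReal ((v 0 - p'.2 0) ^ 2) * (e (x, v) * e p'))) atTop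
      (𝓝 (e (x, v) * G x)) := by
    have h2 := ENNReal.Tendsto.const_mul hx (Or.inr (htop (x, v)))
    refine h2.congr fun n => ?_
    exact (mul_spread_eq_lintegral_near he (x, v) (ε n)).symm
  rw [h1.liminf_eq, hG, ← lintegral_const_mul _ (by fun_prop)]
  refine le_of_eq (lintegral_congr fun w => ?_)
  simp only
  ring

/-- Fatou's lemma is used twice, in phase space and in time, so no domination uniform in `ε` is
needed. -/
lemma lintegral_spread_le {μ : Measure ℝ} [SFinite μ] {e : ℝ → Phase → ℝ≥0∞}
    (he : Measurable (Function.uncurry e)) (htop : ∀ s p, e s p ≠ ⊤)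
    (hm : ∀ᵐ s ∂μ, ∫⁻ p, ENNReal.ofReal (wt p.2) * e s p ≠ ⊤) {K : ℝ≥0∞}
    (hK : ∀ ε : ℝ, 0 < ε → ∫⁻ s, (∫⁻ P : Phase × Phase,
      e s P.1 * e s P.2 * ENNReal.ofReal (bonyWt' ε 0 P)) ∂μ ≤ K) :
    ∫⁻ s, spread (e s) ∂μ ≤ K := by
  set ε : ℕ → ℝ := fun n => 1 / ((n : ℝ) + 1) with hε
  have hε0 : ∀ n, 0 < ε n := fun n => by positivity
  have hlim : Tendsto ε atTop (𝓝[>] 0) :=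
    tendsto_nhdsWithin_iff.2 ⟨tendsto_one_div_add_atTop_nhds_zero_nat, Eventually.of_forall hε0⟩
  set H : ℕ → ℝ → Phase → ℝ≥0∞ := fun n s p => ∫⁻ p' : Phase, near (ε n) p.1 p'.1 *
      (ENNReal.ofReal ((p.2 0 - p'.2 0) ^ 2) * (e s p * e s p')) with hH
  have hes : ∀ s, Measurable (e s) := fun s => he.comp (measurable_const.prodMk measurable_id)
  have hHm : ∀ n, Measurable (Function.uncurry (H n)) := by
    intro n
    have h1 : Measurable fun a : (ℝ × Phase) × Phase => e a.1.1 a.1.2 :=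
      he.comp (f := fun a : (ℝ × Phase) × Phase => (a.1.1, a.1.2)) (by fun_prop)
    have h2 : Measurable fun a : (ℝ × Phase) × Phase => e a.1.1 a.2 :=
      he.comp (f := fun a : (ℝ × Phase) × Phase => (a.1.1, a.2)) (by fun_prop)
    exact Measurable.lintegral_prod_right' (f := fun a : (ℝ × Phase) × Phase =>
      near (ε n) a.1.2.1 a.2.1 * (ENNReal.ofReal ((a.1.2.2 0 - a.2.2 0) ^ 2) *
        (e a.1.1 a.1.2 * e a.1.1 a.2))) (by fun_prop)
  have hHs : ∀ n s, Measurable (H n s) := fun n s =>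
    (hHm n).comp (measurable_const.prodMk measurable_id)
  have hHi : ∀ n, Measurable fun s => ∫⁻ p, H n s p := fun n =>
    Measurable.lintegral_prod_right' (hHm n)
  have hle : ∀ n, ∫⁻ s, (∫⁻ p, H n s p) ∂μ ≤ K := by
    intro n
    refine le_trans (lintegral_mono fun s => ?_) (hK (ε n) (hε0 n))
    have := hes s
    rw [Measure.volume_eq_prod Phase, lintegral_prod _ (by fun_prop)]
    refine lintegral_mono fun p => lintegral_mono fun p' => ?_
    simp only
    rw [← mul_assoc, mul_comm]
    exact mul_le_mul_right (near_mul_le (hε0 n) p p') _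
  calc ∫⁻ s, spread (e s) ∂μ ≤ ∫⁻ s, liminf (fun n => ∫⁻ p, H n s p) atTop ∂μ := by
        refine lintegral_mono_ae ?_
        filter_upwards [hm] with s hs
        exact (spread_le_lintegral_liminf (hes s) (htop s) hs hlim).trans
          (lintegral_liminf_le fun n => hHs n s)
    _ ≤ liminf (fun n => ∫⁻ s, (∫⁻ p, H n s p) ∂μ) atTop := lintegral_liminf_le hHi
    _ ≤ liminf (fun _ : ℕ => K) atTop := liminf_le_liminf (Eventually.of_forall hle)
    _ = K := liminf_const K

namespace Sol

variable {B : ℝ → ℝ → ℝ} {f : ℝ → Phase → ℝ} {b R₀ δ : ℝ} {Φ : ℝ → ℝ≥0∞} {M E : ℝ≥0∞}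

/-- Bony's functional inequality. -/
lemma lintegral_spread_le (h : Sol B f b R₀ δ Φ M E) {T : ℝ} (hT : 0 ≤ T) :
    ∫⁻ s in Ioc 0 T, spread (fun p => ‖f s p‖ₑ) ≤ ENNReal.ofReal Real.pi * (E * E) := by
  have hfm := h.measurable
  refine Boltzmann1D.lintegral_spread_le (e := fun s p => ‖f s p‖ₑ)
    (by simp only [Function.uncurry_def]; exact hfm.enorm) (fun s p => enorm_ne_top) ?_ ?_
  · filter_upwards [ae_restrict_mem measurableSet_Ioc] with s hs
    exact ((h.moment s hs.1.le).trans_lt h.E_lt).ne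
  · intro ε hε
    refine le_trans (lintegral_mono_ae ?_) (h.lintegral_bonyWt'_le hT hε)
    filter_upwards [ae_restrict_mem measurableSet_Ioc] with s hs
    have hs0 := hs.1.le
    have hm := h.measurable_slice s
    have h1 := h.nonneg hs0
    -- Moving both particles along the flow returns from labels to positions at time `s`, where the
    -- kernel is the one at time zero.
    have hmp : MeasurePreserving (Prod.map (shear (-s)) (shear (-s)))
        (volume : Measure (Phase × Phase)) volume :=
      (measurePreserving_shear (-s)).prod (measurePreserving_shear (-s))
    have h2 := hmp.lintegral_comp (f := fun P : Phase × Phase =>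
      ENNReal.ofReal (f s P.1 * f s P.2 * bonyWt' ε 0 P)) (by fun_prop)
    refine le_of_eq ?_
    calc ∫⁻ P : Phase × Phase, ‖f s P.1‖ₑ * ‖f s P.2‖ₑ * ENNReal.ofReal (bonyWt' ε 0 P)
        = ∫⁻ P : Phase × Phase, ENNReal.ofReal (f s P.1 * f s P.2 * bonyWt' ε 0 P) := by
          refine lintegral_congr_ae ?_
          filter_upwards [(Measure.quasiMeasurePreserving_fst (μ := (volume : Measure Phase))
            (ν := (volume : Measure Phase))).ae h1, (Measure.quasiMeasurePreserving_snd
            (μ := (volume : Measure Phase)) (ν := (volume : Measure Phase))).ae h1] with P hP1 hP2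
          rw [ENNReal.ofReal_mul (mul_nonneg hP1 hP2), ENNReal.ofReal_mul hP1,
            Real.enorm_eq_ofReal hP1, Real.enorm_eq_ofReal hP2]
      _ = _ := by
          rw [← h2]
          refine lintegral_congr fun P => ?_
          rw [← Prod.mk.eta (p := P), bonyWt'_shear ε s]
          rfl

end Sol

/-! ### Production of the second moment and the total number of collisions -/

/-- This is `lintegral_surf_affine_le` for the unit sphere itself: centre `0` and diameter `2`. -/
lemma surf_band_le (η : ℝ) :
    ∫⁻ σ : Sph, (Icc (-η) η).indicator 1 ((σ : Vel) 0) ∂surf ≤ ENNReal.ofReal (4 * Real.pi * η) := by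
  have h := lintegral_surf_affine_le ((Icc (-η) η).indicator (1 : ℝ → ℝ≥0∞))
    (measurable_one.indicator measurableSet_Icc) 0 2 two_pos
  simp only [zero_add, div_self (two_ne_zero' ℝ), one_mul] at h
  have h2 : ∫⁻ w in Icc (0 - 1 : ℝ) 1, (Icc (-η) η).indicator (1 : ℝ → ℝ≥0∞) w ≤
      ENNReal.ofReal (2 * η) := by
    refine (setLIntegral_le_lintegral _ _).trans ?_
    rw [lintegral_indicator_one measurableSet_Icc, Real.volume_Icc]
    exact ENNReal.ofReal_le_ofReal (by linarith)
  have h3 := h.trans (mul_le_mul_right h2 _)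
  rw [← ENNReal.ofReal_mul (by positivity), show 4 * Real.pi * (2 * η) = 2 * (4 * Real.pi * η) by
    ring, ENNReal.ofReal_mul two_pos.le] at h3
  exact (ENNReal.mul_le_mul_iff_right (by simp) ENNReal.ofReal_ne_top).1 h3

section

variable {B : ℝ → ℝ → ℝ} {b R₀ δ : ℝ} {Φ : ℝ → ℝ≥0∞} {F : Phase → ℝ} {M E : ℝ≥0∞}

/-- The width of an equatorial band that carries at most half of the collisions. -/
def band (δ : ℝ) : ℝ := δ / (8 * Real.pi)

/-- Collisions spread out in the first direction. -/
lemma GoodKernel.crossE_le_lintegral_sq (hK : GoodKernel B b R₀ δ Φ) (v vs : Vel) :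
    ENNReal.ofReal (band δ ^ 2) * crossE B ‖v - vs‖ ≤
      2 * ∫⁻ σ : Sph, kernE B (v, (vs, σ)) * ENNReal.ofReal ((σ : Vel) 0 ^ 2) ∂surf := by
  have hk := measurable_kernE hK.measurable
  have hδ := hK.delta_pos
  have hη : 0 < band δ := by unfold band; positivity
  set η := band δ with hηd
  set I : Sph → ℝ≥0∞ := fun σ => (Icc (-η) η).indicator 1 ((σ : Vel) 0) with hI
  have hIm : Measurable I :=
    (measurable_one.indicator measurableSet_Icc).comp (by fun_prop : Measurable fun σ : Sph => (σ : Vel) 0)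
  set J : Sph → ℝ≥0∞ := fun σ => (Icc (-η) η)ᶜ.indicator 1 ((σ : Vel) 0) with hJ
  have hJm : Measurable J :=
    (measurable_one.indicator measurableSet_Icc.compl).comp
      (by fun_prop : Measurable fun σ : Sph => (σ : Vel) 0)
  set c := crossE B ‖v - vs‖ with hc
  set X := ∫⁻ σ : Sph, kernE B (v, (vs, σ)) * I σ ∂surf with hX
  set Z := ∫⁻ σ : Sph, kernE B (v, (vs, σ)) * J σ ∂surf with hZ
  set d := ENNReal.ofReal (δ / 2) with hd
  have hd2 : ENNReal.ofReal δ = d + d := by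
    rw [hd, ← ENNReal.ofReal_add (by positivity) (by positivity), add_halves]
  have hctop : c ≠ ⊤ := by
    have : surf univ < ⊤ := measure_lt_top _ _
    exact ne_top_of_le_ne_top (by finiteness) (hK.crossE_le v vs)
  have h1 : c = X + Z := by
    rw [hX, hZ, ← lintegral_add_left (by fun_prop), hc, ← hK.lintegral_kernE]
    refine lintegral_congr fun σ => ?_
    rw [← mul_add, hI, hJ]
    have := congrFun (indicator_self_add_compl (Icc (-η) η) (1 : ℝ → ℝ≥0∞)) ((σ : Vel) 0)
    simp only [Pi.add_apply, Pi.one_apply] at this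
    simp only [this, mul_one]
  -- Since `δ B` is at most the total cross section, the share of the band is at most `4 π η / δ`;
  -- the width `η = δ / (8 π)` makes this one half. Outside the band `σ₁² ≥ η²`.
  have h2 : (d + d) * X ≤ d * c := by
    rw [← hd2, hX, ← lintegral_const_mul _ (by fun_prop)]
    calc ∫⁻ σ : Sph, ENNReal.ofReal δ * (kernE B (v, (vs, σ)) * I σ) ∂surf
        ≤ ∫⁻ σ : Sph, c * I σ ∂surf := by
          refine lintegral_mono fun σ => ?_
          rw [← mul_assoc]
          exact mul_le_mul_left (hK.kernE_le_cross (v, (vs, σ))) _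
      _ ≤ c * ENNReal.ofReal (4 * Real.pi * η) := by
          rw [lintegral_const_mul _ hIm]
          exact mul_le_mul_right (surf_band_le η) _
      _ = d * c := by
          rw [mul_comm, hd, hηd, band]
          congr 2
          field_simp
          norm_num
  have h3 : d * c ≤ (d + d) * Z := by
    have h4 : d * c + d * c ≤ d * c + (d + d) * Z := by
      calc d * c + d * c = (d + d) * X + (d + d) * Z := by rw [← add_mul, h1, mul_add]
        _ ≤ _ := add_le_add_left h2 _
    exact (ENNReal.add_le_add_iff_left (ENNReal.mul_ne_top ENNReal.ofReal_ne_top hctop)).1 h4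
  have h5 : c ≤ 2 * Z := by
    rw [← two_mul, mul_comm (2:ℝ≥0∞) d, mul_assoc] at h3
    refine (ENNReal.mul_le_mul_iff_right ?_ ENNReal.ofReal_ne_top).1 h3
    exact (ENNReal.ofReal_pos.2 (by positivity)).ne'
  refine (mul_le_mul_right h5 _).trans ?_
  rw [mul_left_comm]
  refine mul_le_mul_right ?_ _
  rw [hZ, ← lintegral_const_mul _ (by fun_prop)]
  refine lintegral_mono fun σ => ?_
  simp only
  rw [mul_left_comm]
  refine mul_le_mul_right ?_ _
  simp only [hJ]
  by_cases h : (σ : Vel) 0 ∈ Icc (-η) η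
  · simp [h]
  · rw [indicator_of_mem (show (σ : Vel) 0 ∈ (Icc (-η) η)ᶜ from h), Pi.one_apply, mul_one]
    refine ENNReal.ofReal_le_ofReal ?_
    rw [← sq_abs ((σ : Vel) 0)]
    have : η ≤ |(σ : Vel) 0| := by
      by_contra hlt
      exact h (abs_le.1 (not_le.1 hlt).le)
    gcongr

/-- The square of the first component of the relative velocity after a collision. -/
def sqPost (Y : ColX) : ℝ := ‖Y.1.2 - Y.2.1‖ ^ 2 * (Y.2.2 : Vel) 0 ^ 2

/-- The square of the first component of the relative velocity before a collision. -/
def sqPre (Y : ColX) : ℝ := (Y.1.2 0 - Y.2.1 0) ^ 2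

@[fun_prop]
lemma measurable_sqPost : Measurable sqPost := by unfold sqPost; fun_prop

@[fun_prop]
lemma measurable_sqPre : Measurable sqPre := by unfold sqPre; fun_prop

lemma sqPost_nonneg (Y : ColX) : 0 ≤ sqPost Y := by unfold sqPost; positivity

lemma sqPre_nonneg (Y : ColX) : 0 ≤ sqPre Y := sq_nonneg _

lemma sqPost_le (Y : ColX) : |sqPost Y| ≤ 2 * wtX Y := by
  rw [abs_of_nonneg (sqPost_nonneg Y), sqPost, wtX, wt, wt]
  have h1 : (Y.2.2 : Vel) 0 ^ 2 ≤ 1 := by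
    rw [sq_le_one_iff_abs_le_one]
    exact (abs_coord_le _).trans (by simp)
  have h2 : ‖Y.1.2 - Y.2.1‖ ^ 2 ≤ (‖Y.1.2‖ + ‖Y.2.1‖) ^ 2 := by
    gcongr
    exact norm_sub_le _ _
  nlinarith [sq_nonneg (‖Y.1.2‖ - ‖Y.2.1‖), sq_nonneg ‖Y.1.2 - Y.2.1‖]

lemma sqPre_le (Y : ColX) : |sqPre Y| ≤ 2 * wtX Y := by
  rw [abs_of_nonneg (sqPre_nonneg Y), sqPre, wtX, wt, wt]
  have h1 := sq_le_sq' (abs_le.1 (abs_coord_le Y.1.2)).1 (abs_le.1 (abs_coord_le Y.1.2)).2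
  have h2 := sq_le_sq' (abs_le.1 (abs_coord_le Y.2.1)).1 (abs_le.1 (abs_coord_le Y.2.1)).2
  nlinarith [sq_nonneg (Y.1.2 0 + Y.2.1 0)]

lemma sq_coord_le (v : Vel) : |v 0 ^ 2| ≤ 1 * wt v := by
  rw [abs_of_nonneg (sq_nonneg _), one_mul, wt]
  linarith [sq_le_sq' (abs_le.1 (abs_coord_le v)).1 (abs_le.1 (abs_coord_le v)).2]

/-- The production of `∫ v₁² f` by the collisions. -/
lemma GoodKernel.integral_collisionPhase_sq (hK : GoodKernel B b R₀ δ Φ) (hF : Slice F M E) :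
    4 * ∫ p, collisionPhase B F F p * p.2 0 ^ 2 =
      (∫ Y, collisions B F Y * sqPost Y ∂colXMeas) - ∫ Y, collisions B F Y * sqPre Y ∂colXMeas := by
  have i1 := hK.integrable_collisions_mul hF measurable_sqPost sqPost_le
  have i2 := hK.integrable_collisions_mul hF measurable_sqPre sqPre_le
  have h1 := hK.integral_collisionPhase_mul hF (χ := fun p => p.2 0 ^ 2) (by fun_prop)
    (C := 1) fun p => sq_coord_le p.2
  set ζ : ColX → ℝ := fun Y => (collideX Y).1.2 0 ^ 2 - Y.1.2 0 ^ 2 with hζ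
  have hζm : Measurable ζ := by fun_prop
  have hζC : ∀ Y, |ζ Y| ≤ 2 * wtX Y := by
    intro Y
    have a1 := sq_coord_le (collideX Y).1.2
    have a2 := sq_coord_le Y.1.2
    have a3 : wt (collideX Y).1.2 ≤ wtX Y := by
      rw [← wtX_collideX]; exact le_add_of_nonneg_right (wt_pos _).le
    have a4 : wt Y.1.2 ≤ wtX Y := le_add_of_nonneg_right (wt_pos _).le
    have := abs_sub ((collideX Y).1.2 0 ^ 2) (Y.1.2 0 ^ 2)
    simp only [hζ]
    linarith
  have i3 := hK.integrable_collisions_mul hF hζm hζC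
  have i4 : Integrable (fun Y => collisions B F Y * ζ (exchangeX Y)) colXMeas :=
    hK.integrable_collisions_mul hF (by fun_prop) (C := 2) fun Y => by
      have := hζC (exchangeX Y)
      have h : wtX (exchangeX Y) = wtX Y := by
        simp only [wtX, exchangeX, exchange]; ring
      rwa [h] at this
  have h2 := integral_collisions_exchangeX hK.measurable hF.measurable hζm
  -- Since `v₁ + v⋆₁` is conserved, the change of `v₁² + v⋆₁²` is half the change of `(v₁ - v⋆₁)²`.
  -- Symmetrization gives another factor two, hence the `4`.
  have h3 : ∀ Y : ColX, collisions B F Y * ζ Y + collisions B F Y * ζ (exchangeX Y) =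
      2⁻¹ * (collisions B F Y * sqPost Y - collisions B F Y * sqPre Y) := by
    intro Y
    simp only [hζ, exchangeX, exchange, collideX, collide, postV_zero, sqPost, sqPre,
      norm_sub_rev Y.2.1 Y.1.2]
    simp
    ring
  have h4 := integral_add i3 i4
  have h5 := integral_sub i1 i2
  simp only [h3, integral_const_mul] at h4
  rw [h5, ← h2] at h4
  rw [h1]
  simp only [hζ] at h4
  linarith

/-- A lower bound for the rate of spreading. -/
lemma GoodKernel.dissip_le (hK : GoodKernel B b R₀ δ Φ) (hF : Measurable F) :
    ENNReal.ofReal (band δ ^ 2 * R₀ ^ 2) * dissip B (fun p => ‖F p‖ₑ) ≤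
      2 * ∫⁻ Y, ‖collisions B F Y‖ₑ * ENNReal.ofReal (sqPost Y) ∂colXMeas := by
  have hk := measurable_kernE hK.measurable
  have hcm := measurable_crossE hK.measurable
  have hm := measurable_collisions hK.measurable hF
  have hm1 : Measurable fun p : Phase => ∫⁻ vs : Vel, crossE B ‖p.2 - vs‖ *
      (‖F (p.1, vs)‖ₑ * ‖F p‖ₑ) :=
    Measurable.lintegral_prod_right' (f := fun q : Phase × Vel => crossE B ‖q.1.2 - q.2‖ *
      (‖F (q.1.1, q.2)‖ₑ * ‖F q.1‖ₑ)) (by fun_prop)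
  have hd : dissip B (fun p => ‖F p‖ₑ) = ∫⁻ p : Phase, ∫⁻ vs : Vel, crossE B ‖p.2 - vs‖ *
      (‖F (p.1, vs)‖ₑ * ‖F p‖ₑ) := by
    rw [Measure.volume_eq_prod, lintegral_prod _ hm1.aemeasurable]
    rfl
  rw [hd, lintegral_prod _ (by fun_prop), ← lintegral_const_mul _ hm1, ← lintegral_const_mul' _ _
    (by simp)]
  refine lintegral_mono fun p => ?_
  simp only
  rw [lintegral_prod _ (by fun_prop), ← lintegral_const_mul _ (by fun_prop),
    ← lintegral_const_mul' _ _ (by simp)]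
  refine lintegral_mono fun vs => ?_
  simp only [collisions, enorm_mul, hK.enorm_kern, sqPost]
  have h1 : ∀ σ : Sph, kernE B (p.2, vs, σ) * (‖F (p.1, vs)‖ₑ * ‖F p‖ₑ) *
      ENNReal.ofReal (‖p.2 - vs‖ ^ 2 * (σ : Vel) 0 ^ 2) =
      (ENNReal.ofReal (‖p.2 - vs‖ ^ 2) * (‖F (p.1, vs)‖ₑ * ‖F p‖ₑ)) *
        (kernE B (p.2, vs, σ) * ENNReal.ofReal ((σ : Vel) 0 ^ 2)) := by
    intro σ
    rw [ENNReal.ofReal_mul (by positivity)]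
    ring
  simp only [h1]
  rw [lintegral_const_mul _ (by fun_prop), mul_left_comm (2 : ℝ≥0∞)]
  refine le_trans ?_ (mul_le_mul_right (hK.crossE_le_lintegral_sq p.2 vs) _)
  -- Whenever the cross section is not zero, the relative speed exceeds `R₀`, which bounds the
  -- factor `|v - v⋆|²` from below.
  rcases le_total ‖p.2 - vs‖ R₀ with h | h
  · simp [hK.crossE_eq_zero h]
  · calc _ = ENNReal.ofReal (R₀ ^ 2) * (‖F (p.1, vs)‖ₑ * ‖F p‖ₑ) *
          (ENNReal.ofReal (band δ ^ 2) * crossE B ‖p.2 - vs‖) := by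
          rw [ENNReal.ofReal_mul (by positivity)]; ring
      _ ≤ _ := by
          refine mul_le_mul_left (mul_le_mul_left (ENNReal.ofReal_le_ofReal ?_) _) _
          have := hK.R_pos
          gcongr

/-- This lets Bony's inequality pay for the negative term in the balance of `∫ v₁² f`. -/
lemma GoodKernel.lintegral_sqPre_le (hK : GoodKernel B b R₀ δ Φ) (hF : Measurable F) :
    ∫⁻ Y, ‖collisions B F Y‖ₑ * ENNReal.ofReal (sqPre Y) ∂colXMeas ≤
      ENNReal.ofReal b * surf univ * spread (fun p => ‖F p‖ₑ) := by
  have hk := measurable_kernE hK.measurable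
  have hm := measurable_collisions hK.measurable hF
  rw [lintegral_prod _ (by fun_prop), spread, ← lintegral_const_mul' _ _ (by
    have : surf univ < ⊤ := measure_lt_top _ _
    finiteness)]
  refine lintegral_mono fun p => ?_
  simp only
  rw [lintegral_prod _ (by fun_prop), ← lintegral_const_mul _ (by fun_prop)]
  refine lintegral_mono fun w => ?_
  simp only [collisions, enorm_mul, hK.enorm_kern, sqPre]
  calc ∫⁻ σ : Sph, kernE B (p.2, w, σ) * (‖F (p.1, w)‖ₑ * ‖F p‖ₑ) *
        ENNReal.ofReal ((p.2 0 - w 0) ^ 2) ∂surf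
      ≤ ∫⁻ σ : Sph, ENNReal.ofReal b * (‖F (p.1, w)‖ₑ * ‖F p‖ₑ) *
        ENNReal.ofReal ((p.2 0 - w 0) ^ 2) ∂surf := by
        refine lintegral_mono fun σ => ?_
        gcongr
        exact hK.kernE_le _
    _ = _ := by
        rw [lintegral_const]
        ring

end

namespace Sol

variable {B : ℝ → ℝ → ℝ} {f : ℝ → Phase → ℝ} {b R₀ δ : ℝ} {Φ : ℝ → ℝ≥0∞} {M E : ℝ≥0∞}

lemma integrable_collisions_mul (h : Sol B f b R₀ δ Φ M E) (T : ℝ) {ζ : ColX → ℝ}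
    (hζ : Measurable ζ) {C : ℝ} (hC : ∀ Y, |ζ Y| ≤ C * wtX Y) :
    Integrable (fun a : ℝ × ColX => collisions B (f a.1) a.2 * ζ a.2)
      ((volume.restrict (Ioc 0 T)).prod colXMeas) := by
  have hm := h.measurable_collisions
  refine ⟨(hm.mul (by fun_prop)).aestronglyMeasurable, ?_⟩
  rw [hasFiniteIntegral_iff_enorm, lintegral_prod _ (by fun_prop)]
  calc _ ≤ ∫⁻ s in Ioc 0 T, ENNReal.ofReal C * colBound b M E := by
        refine lintegral_mono_ae ((ae_restrict_iff' measurableSet_Ioc).2 ?_)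
        filter_upwards [h.slice] with s hs hs0
        refine le_trans ?_ (mul_le_mul_right (h.kernel.lintegral_collisions_le (hs hs0.1.le)) _)
        have hms := Boltzmann1D.measurable_collisions h.kernel.measurable (h.measurable_slice s)
        rw [← lintegral_const_mul _ (by fun_prop)]
        refine lintegral_mono fun Y => ?_
        simp only
        rw [enorm_mul, mul_comm, ← mul_assoc, ← ENNReal.ofReal_mul' (wtX_pos Y).le]
        refine mul_le_mul_left ?_ _
        rw [← ofReal_norm]
        exact ENNReal.ofReal_le_ofReal (hC Y)
    _ < ⊤ := by
        rw [setLIntegral_const]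
        have := colBound_lt_top (b := b) h.M_lt h.E_lt
        have : volume (Ioc 0 T) < ⊤ := measure_Ioc_lt_top
        finiteness

lemma integrable_along_sq (h : Sol B f b R₀ δ Φ M E) {t : ℝ} (ht : 0 ≤ t) :
    Integrable fun p : Phase => along f t p * p.2 0 ^ 2 := by
  have hm : Measurable (along f t) := h.measurable_along measurable_const measurable_id
  refine ⟨(hm.mul (by fun_prop)).aestronglyMeasurable, ?_⟩
  refine lt_of_le_of_lt (lintegral_mono fun p => ?_) ((h.lintegral_along_le ht).trans_lt h.E_lt)
  rw [enorm_mul, mul_comm]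
  refine mul_le_mul_left ?_ _
  rw [← ofReal_norm]
  exact ENNReal.ofReal_le_ofReal ((sq_coord_le p.2).trans (le_of_eq (one_mul _)))

lemma ofReal_integral_along_le (h : Sol B f b R₀ δ Φ M E) {t : ℝ} (ht : 0 ≤ t) :
    ENNReal.ofReal (∫ p : Phase, along f t p * p.2 0 ^ 2) ≤ E := by
  refine (ofReal_integral_le_lintegral _).trans (le_trans (lintegral_mono fun p => ?_)
    (h.lintegral_along_le ht))
  rw [mul_comm, ENNReal.ofReal_mul (sq_nonneg _)]
  refine mul_le_mul' (ENNReal.ofReal_le_ofReal ?_) ?_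
  · exact (le_abs_self _).trans ((sq_coord_le p.2).trans (le_of_eq (one_mul _)))
  · rw [← ofReal_norm]
    exact ENNReal.ofReal_le_ofReal (le_abs_self _)

/-- The evolution of `∫ v₁² f`. -/
lemma integral_sq_evolution (h : Sol B f b R₀ δ Φ M E) {T : ℝ} (hT : 0 ≤ T) :
    (∫ p : Phase, along f T p * p.2 0 ^ 2) - ∫ p : Phase, along f 0 p * p.2 0 ^ 2 =
      ∫ s in Ioc 0 T, ∫ p, collisionPhase B (f s) (f s) p * p.2 0 ^ 2 := by
  have hmr := h.measurable_rate (t := fun a : ℝ × Phase => a.1) (p := fun a => a.2)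
    (by fun_prop) (by fun_prop)
  have hi : Integrable (fun a : ℝ × Phase => rate B f a.1 a.2 * a.2.2 0 ^ 2)
      ((volume.restrict (Ioc 0 T)).prod volume) := by
    refine (h.integrable_rate T).mono (hmr.mul (by fun_prop)).aestronglyMeasurable
      (Eventually.of_forall fun a => ?_)
    rw [norm_mul, norm_mul, mul_comm]
    refine mul_le_mul_of_nonneg_right ?_ (norm_nonneg _)
    rw [Real.norm_of_nonneg (wt_pos _).le]
    exact (sq_coord_le a.2.2).trans (le_of_eq (one_mul _))
  rw [← integral_sub (h.integrable_along_sq hT) (h.integrable_along_sq le_rfl)]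
  have e1 : ∫ p : Phase, (along f T p * p.2 0 ^ 2 - along f 0 p * p.2 0 ^ 2) =
      ∫ p : Phase, ∫ s in Ioc 0 T, rate B f s p * p.2 0 ^ 2 := by
    refine integral_congr_ae ?_
    filter_upwards [h.evolution hT] with p hp
    have := hp (fun _ => p.2 0 ^ 2) (fun _ => 0) (fun s => hasDerivAt_const s _) continuous_const
    simp only [mul_zero, add_zero] at this
    rw [← this, along, along, neg_zero, shear_zero]
  rw [e1, integral_integral_swap]
  swap
  · exact hi.swap
  refine integral_congr_ae (Eventually.of_forall fun s => ?_)
  have hm := Boltzmann1D.measurable_collisionPhase h.kernel.measurable (h.measurable_slice s)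
  have h3 := integral_map (μ := (volume : Measure Phase)) (φ := shear (-s))
      (f := fun p : Phase => collisionPhase B (f s) (f s) p * p.2 0 ^ 2)
      (by fun_prop) (by fun_prop)
  rw [(measurePreserving_shear (-s)).map_eq] at h3
  exact h3.symm

lemma collisions_nonneg (h : Sol B f b R₀ δ Φ M E) {t : ℝ} (ht : 0 ≤ t) :
    ∀ᵐ Y ∂colXMeas, 0 ≤ collisions B (f t) Y := by
  have h1 : ∀ᵐ Y ∂colXMeas, 0 ≤ f t Y.1 :=
    (Measure.quasiMeasurePreserving_fst (μ := (volume : Measure Phase))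
      (ν := (volume : Measure Vel).prod surf)).ae (h.nonneg ht)
  have h2 : ∀ᵐ Y ∂colXMeas, 0 ≤ f t (exchangeX Y).1 :=
    measurePreserving_exchangeX.quasiMeasurePreserving.ae h1
  filter_upwards [h1, h2] with Y hY1 hY2
  exact mul_nonneg (h.kernel.kern_nonneg _) (mul_nonneg hY2 hY1)

lemma ofReal_integral_collisions (h : Sol B f b R₀ δ Φ M E) {t : ℝ} (ht : 0 ≤ t) {ζ : ColX → ℝ}
    (h0 : ∀ Y, 0 ≤ ζ Y) (hi : Integrable (fun Y => collisions B (f t) Y * ζ Y) colXMeas) :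
    ENNReal.ofReal (∫ Y, collisions B (f t) Y * ζ Y ∂colXMeas) =
      ∫⁻ Y, ‖collisions B (f t) Y‖ₑ * ENNReal.ofReal (ζ Y) ∂colXMeas := by
  have hn := h.collisions_nonneg ht
  rw [ofReal_integral_eq_lintegral_ofReal hi]
  · refine lintegral_congr_ae ?_
    filter_upwards [hn] with Y hY
    rw [ENNReal.ofReal_mul hY, Real.enorm_eq_ofReal hY]
  · filter_upwards [hn] with Y hY using mul_nonneg hY (h0 Y)

/-- The bound for the total number of collisions. -/
def dissipBound (b : ℝ) (E : ℝ≥0∞) : ℝ≥0∞ :=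
  2 * (4 * E + ENNReal.ofReal b * surf univ * (ENNReal.ofReal Real.pi * (E * E)))

/-- In the balance of `∫ v₁² f` the end moment is at most `E`, the initial one has the favourable
sign, and the pre-collisional term is controlled by Bony's inequality. So the post-collisional term,
which dominates the number of collisions, has a bound independent of `T`. -/
lemma lintegral_Ioc_dissip_le (h : Sol B f b R₀ δ Φ M E) {T : ℝ} (hT : 0 ≤ T) :
    ENNReal.ofReal (band δ ^ 2 * R₀ ^ 2) *
      ∫⁻ s in Ioc 0 T, dissip B (fun p => ‖f s p‖ₑ) ≤ dissipBound b E := by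
  have hpos : ∀ᵐ s ∂(volume.restrict (Ioc 0 T)), 0 ≤ s := by
    filter_upwards [ae_restrict_mem measurableSet_Ioc] with s hs using hs.1.le
  have i1 := h.integrable_collisions_mul T measurable_sqPost sqPost_le
  have i2 := h.integrable_collisions_mul T measurable_sqPre sqPre_le
  have j1 := i1.integral_prod_left
  have j2 := i2.integral_prod_left
  have hsurf : surf univ < ⊤ := measure_lt_top _ _
  have n1 : ∀ᵐ s ∂(volume.restrict (Ioc 0 T)),
      0 ≤ ∫ Y, collisions B (f s) Y * sqPost Y ∂colXMeas := by
    filter_upwards [hpos] with s hs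
    refine integral_nonneg_of_ae ?_
    filter_upwards [h.collisions_nonneg hs] with Y hY using mul_nonneg hY (sqPost_nonneg Y)
  have n2 : ∀ᵐ s ∂(volume.restrict (Ioc 0 T)),
      0 ≤ ∫ Y, collisions B (f s) Y * sqPre Y ∂colXMeas := by
    filter_upwards [hpos] with s hs
    refine integral_nonneg_of_ae ?_
    filter_upwards [h.collisions_nonneg hs] with Y hY using mul_nonneg hY (sqPre_nonneg Y)
  have hbal : (∫ s in Ioc 0 T, ∫ Y, collisions B (f s) Y * sqPost Y ∂colXMeas) =
      4 * ((∫ p : Phase, along f T p * p.2 0 ^ 2) - ∫ p : Phase, along f 0 p * p.2 0 ^ 2) +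
      ∫ s in Ioc 0 T, ∫ Y, collisions B (f s) Y * sqPre Y ∂colXMeas := by
    rw [h.integral_sq_evolution hT, ← sub_eq_iff_eq_add, ← integral_sub j1 j2,
      ← integral_const_mul]
    refine integral_congr_ae ((ae_restrict_iff' measurableSet_Ioc).2 ?_)
    filter_upwards [h.slice] with s hs hs0
    exact (h.kernel.integral_collisionPhase_sq (hs hs0.1.le)).symm
  have h0 : 0 ≤ ∫ p : Phase, along f 0 p * p.2 0 ^ 2 := by
    refine integral_nonneg_of_ae ?_
    filter_upwards [h.initial_nonneg] with p hp
    rw [Pi.zero_apply, along, neg_zero, shear_zero]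
    exact mul_nonneg hp (sq_nonneg _)
  have hpre : ENNReal.ofReal (∫ s in Ioc 0 T, ∫ Y, collisions B (f s) Y * sqPre Y ∂colXMeas) ≤
      ENNReal.ofReal b * surf univ * (ENNReal.ofReal Real.pi * (E * E)) := by
    rw [ofReal_integral_eq_lintegral_ofReal j2 n2]
    refine le_trans ?_ (mul_le_mul_right (h.lintegral_spread_le hT) _)
    rw [← lintegral_const_mul' _ _ (by finiteness)]
    refine lintegral_mono_ae ?_
    filter_upwards [hpos, i2.prod_right_ae] with s hs his
    rw [h.ofReal_integral_collisions hs sqPre_nonneg his]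
    exact h.kernel.lintegral_sqPre_le (h.measurable_slice s)
  have hpost : ENNReal.ofReal (∫ s in Ioc 0 T, ∫ Y, collisions B (f s) Y * sqPost Y ∂colXMeas) ≤
      4 * E + ENNReal.ofReal b * surf univ * (ENNReal.ofReal Real.pi * (E * E)) := by
    rw [hbal]
    refine ENNReal.ofReal_add_le.trans (add_le_add ?_ hpre)
    rw [ENNReal.ofReal_mul (by norm_num), ENNReal.ofReal_ofNat]
    refine mul_le_mul_right (le_trans (ENNReal.ofReal_le_ofReal ?_)
      (h.ofReal_integral_along_le hT)) _
    linarith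
  refine le_trans ?_ (mul_le_mul_right hpost _)
  rw [ofReal_integral_eq_lintegral_ofReal j1 n1, ← lintegral_const_mul' _ _ (by simp),
    ← lintegral_const_mul' _ _ (by simp)]
  refine lintegral_mono_ae ?_
  filter_upwards [hpos, i1.prod_right_ae] with s hs his
  rw [h.ofReal_integral_collisions hs sqPost_nonneg his]
  exact h.kernel.dissip_le (h.measurable_slice s)

/-- The total number of collisions is finite. -/
lemma lintegral_dissip_lt_top (h : Sol B f b R₀ δ Φ M E) :
    ∫⁻ s in Ioi 0, dissip B (fun p => ‖f s p‖ₑ) < ⊤ := by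
  have hR := h.kernel.R_pos
  have hδ := h.kernel.delta_pos
  have hc : 0 < band δ ^ 2 * R₀ ^ 2 := by unfold band; positivity
  have hU : (⋃ n : ℕ, Ioc (0:ℝ) n) = Ioi 0 := by
    ext x
    simp only [mem_iUnion, mem_Ioc, mem_Ioi, exists_and_left, and_iff_left_iff_imp]
    exact fun _ => exists_nat_ge x
  rw [← hU, setLIntegral_iUnion_of_directed _ (directed_of_isDirected_le fun m n hmn =>
    Ioc_subset_Ioc_right (by exact_mod_cast hmn))]
  have h1 : ∀ n : ℕ, ∫⁻ s in Ioc (0:ℝ) n, dissip B (fun p => ‖f s p‖ₑ) ≤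
      (ENNReal.ofReal (band δ ^ 2 * R₀ ^ 2))⁻¹ * dissipBound b E := fun n => by
    refine le_trans (le_of_eq ?_) (mul_le_mul_right (h.lintegral_Ioc_dissip_le n.cast_nonneg) _)
    rw [← mul_assoc, ENNReal.inv_mul_cancel (ENNReal.ofReal_pos.2 hc).ne' (by simp), one_mul]
  refine (iSup_le h1).trans_lt (ENNReal.mul_lt_top (ENNReal.inv_lt_top.2 (ENNReal.ofReal_pos.2 hc)) ?_)
  have hsurf : surf univ < ⊤ := measure_lt_top _ _
  have := h.E_lt
  unfold dissipBound
  finiteness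

end Sol

/-! ### Decay of the solution -/

namespace Sol

variable {B : ℝ → ℝ → ℝ} {f : ℝ → Phase → ℝ} {b R₀ δ : ℝ} {Φ : ℝ → ℝ≥0∞} {M E : ℝ≥0∞}

lemma measurable_gainE (h : Sol B f b R₀ δ Φ M E) {α : Type*} [MeasurableSpace α] {t : α → ℝ}
    {p : α → Phase} (ht : Measurable t) (hp : Measurable p) :
    Measurable fun a => gainE B (fun p => ‖f (t a) p‖ₑ) (p a) := by
  have hk := measurable_kernE h.kernel.measurable
  have h1 : Measurable fun a : α × (Vel × Sph) =>
      f (t a.1) ((p a.1).1, postVs (p a.1).2 a.2.1 a.2.2) :=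
    h.measurable_comp (by fun_prop) (by fun_prop)
  have h2 : Measurable fun a : α × (Vel × Sph) =>
      f (t a.1) ((p a.1).1, postV (p a.1).2 a.2.1 a.2.2) :=
    h.measurable_comp (by fun_prop) (by fun_prop)
  have h3 : Measurable fun a : α × (Vel × Sph) => kernE B ((p a.1).2, a.2) :=
    hk.comp (f := fun a : α × (Vel × Sph) => ((p a.1).2, a.2)) (by fun_prop)
  exact Measurable.lintegral_prod_right' (f := fun a : α × (Vel × Sph) =>
    kernE B ((p a.1).2, a.2) * (‖f (t a.1) ((p a.1).1, postVs (p a.1).2 a.2.1 a.2.2)‖ₑ *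
      ‖f (t a.1) ((p a.1).1, postV (p a.1).2 a.2.1 a.2.2)‖ₑ)) (h3.mul (h1.enorm.mul h2.enorm))

lemma ofReal_collisionPhase_le (h : Sol B f b R₀ δ Φ M E) {s : ℝ} (hs : 0 ≤ s) :
    ∀ᵐ p, ENNReal.ofReal (collisionPhase B (f s) (f s) p) ≤ gainE B (fun p => ‖f s p‖ₑ) p := by
  filter_upwards [Measure.ae_ae_of_ae_prod (h.collisions_nonneg hs)] with p hp
  rw [collisionPhase_eq]
  refine (ofReal_integral_le_lintegral _).trans (lintegral_mono_ae ?_)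
  filter_upwards [hp] with z hz
  refine (ENNReal.ofReal_le_ofReal ((sub_le_self _ hz).trans (le_abs_self _))).trans (le_of_eq ?_)
  rw [← Real.norm_eq_abs, ofReal_norm, collisions_collideX, enorm_mul, enorm_mul,
    h.kernel.enorm_kern]

lemma ofReal_rate_le (h : Sol B f b R₀ δ Φ M E) {T t : ℝ} (hT : 0 ≤ T) :
    ∀ᵐ p, ∀ᵐ s ∂(volume.restrict (Ioc T t)),
      ENNReal.ofReal (rate B f s p) ≤ gainE B (fun p => ‖f s p‖ₑ) (shear (-s) p) := by
  rw [← Measure.ae_ae_comm (p := fun s p =>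
    ENNReal.ofReal (rate B f s p) ≤ gainE B (fun p => ‖f s p‖ₑ) (shear (-s) p))]
  · filter_upwards [ae_restrict_mem measurableSet_Ioc] with s hs
    exact (measurePreserving_shear (-s)).quasiMeasurePreserving.ae
      (h.ofReal_collisionPhase_le (hT.trans hs.1.le))
  · exact measurableSet_le (h.measurable_rate (t := fun a : ℝ × Phase => a.1) (p := fun a => a.2)
      (by fun_prop) (by fun_prop)).ennreal_ofReal (h.measurable_gainE (by fun_prop) (by fun_prop))

/-- Duhamel's formula without the loss term. -/
lemma enorm_shear_le (h : Sol B f b R₀ δ Φ M E) {T t : ℝ} (hT : 0 ≤ T) (hTt : T ≤ t) (q : ℝ) :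
    ∀ᵐ p, ‖f t (shear q p)‖ₑ ≤ ‖f T (shear (t + q - T) p)‖ₑ +
      ∫⁻ s in Ioc T t, gainE B (fun p => ‖f s p‖ₑ) (shear (t + q - s) p) := by
  have ht := hT.trans hTt
  have key : ∀ᵐ p, ‖along f t p‖ₑ ≤ ‖along f T p‖ₑ +
      ∫⁻ s in Ioc T t, gainE B (fun p => ‖f s p‖ₑ) (shear (-s) p) := by
    filter_upwards [h.duhamel t ht, h.duhamel T hT, h.intervalIntegrable_rate ht,
      h.intervalIntegrable_rate hT, h.ofReal_rate_le (t := t) hT,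
      (measurePreserving_shear (-t)).quasiMeasurePreserving.ae (h.nonneg ht)] with p a1 a2 a3 a4 a5 a6
    have h1 : along f t p = along f T p + ∫ s in Ioc T t, rate B f s p := by
      rw [a1, a2, path, path, ← intervalIntegral.integral_of_le hTt, add_assoc,
        intervalIntegral.integral_add_adjacent_intervals a4 (a4.symm.trans a3)]
    rw [Real.enorm_eq_ofReal (show 0 ≤ along f t p from a6), h1]
    refine ENNReal.ofReal_add_le.trans (add_le_add ?_ ?_)
    · rw [← ofReal_norm]
      exact ENNReal.ofReal_le_ofReal (le_abs_self _)
    · exact (ofReal_integral_le_lintegral _).trans (lintegral_mono_ae a5)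
  -- Relabelling the trajectories by `shear (t + q)` turns the density along them at time `t` into
  -- `f t` transported by `q`.
  filter_upwards [(measurePreserving_shear (t + q)).quasiMeasurePreserving.ae key] with p hp
  simp only [along, shear_shear] at hp
  have e : ∀ s : ℝ, -s + (t + q) = t + q - s := fun s => by ring
  simp only [e, add_sub_cancel_left] at hp
  exact hp

/-- The bound for the gain term just before the time of observation. -/
def gainBound (δ : ℝ) (Φ : ℝ → ℝ≥0∞) (M : ℝ≥0∞) : ℝ≥0∞ :=
  (ENNReal.ofReal δ)⁻¹ *
    (surf univ * ENNReal.ofReal (4 * Real.pi) * (2 * ∫⁻ r in Ioi (0:ℝ), Φ r) * M ^ 2)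

lemma gainBound_lt_top (h : Sol B f b R₀ δ Φ M E) : gainBound δ Φ M < ⊤ := by
  have hsurf : surf univ < ⊤ := measure_lt_top _ _
  have h1 := h.kernel.lintegral_lt_top
  have h2 := h.M_lt
  have h3 : ENNReal.ofReal δ ≠ 0 := (ENNReal.ofReal_pos.2 h.kernel.delta_pos).ne'
  unfold gainBound
  finiteness

/-- The effect of the gain term between `T` and `t`. -/
lemma lintegral_gainE_le (h : Sol B f b R₀ δ Φ M E) {T t ε q : ℝ} (hT : 0 ≤ T) (hε : 0 < ε)
    (hTt : T + ε ≤ t) (hq : 0 ≤ q) (x : ℝ) :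
    ∫⁻ s in Ioc T t, ∫⁻ v : Vel, gainE B (fun p => ‖f s p‖ₑ) (shear (t + q - s) (x, v)) ≤
      (ENNReal.ofReal (ε * R₀ * δ))⁻¹ * ENNReal.ofReal (4 * Real.pi) *
        (∫⁻ s in Ioi T, dissip B (fun p => ‖f s p‖ₑ)) + gainBound δ Φ M * ENNReal.ofReal ε := by
  have hR := h.kernel.R_pos
  have hδ := h.kernel.delta_pos
  have hc : ENNReal.ofReal (ε * R₀ * δ) ≠ 0 := (ENNReal.ofReal_pos.2 (by positivity)).ne'
  have hd : ENNReal.ofReal δ ≠ 0 := (ENNReal.ofReal_pos.2 hδ).ne'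
  -- Gain of age at least `ε` is paid for by the number of collisions after `T`; the recent gain is
  -- bounded uniformly and lasts only for a time `ε`.
  rw [← Ioc_union_Ioc_eq_Ioc (show T ≤ t - ε by linarith) (show t - ε ≤ t by linarith)]
  refine (lintegral_union_le _ _ _).trans (add_le_add ?_ ?_)
  · rw [← lintegral_const_mul' _ _ (by finiteness)]
    refine le_trans ?_ (lintegral_mono_set (s := Ioc T (t - ε)) Ioc_subset_Ioi_self)
    refine setLIntegral_mono' measurableSet_Ioc fun s hs => ?_
    have h1 := h.kernel.lintegral_gainE_le_dissip (h.measurable_slice s).enorm x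
      (τ := t + q - s) (by linarith [hs.2])
    have h2 : ENNReal.ofReal (ε * R₀ * δ) *
        (∫⁻ v : Vel, gainE B (fun p => ‖f s p‖ₑ) (shear (t + q - s) (x, v))) ≤
        ENNReal.ofReal (4 * Real.pi) * dissip B (fun p => ‖f s p‖ₑ) := by
      refine le_trans (mul_le_mul_left (ENNReal.ofReal_le_ofReal ?_) _) h1
      have : ε ≤ t + q - s := by linarith [hs.2]
      gcongr
    rw [mul_assoc]
    refine le_trans (le_of_eq ?_) (mul_le_mul_right h2 _)
    rw [← mul_assoc, ENNReal.inv_mul_cancel hc (by simp), one_mul]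
  · calc _ ≤ ∫⁻ s in Ioc (t - ε) t, gainBound δ Φ M := by
          refine lintegral_mono_ae ?_
          -- For `q = 0` and `s = t` the age `t + q - s` would be zero, which the gain estimate
          -- excludes.
          have hne : ∀ᵐ s ∂(volume.restrict (Ioc (t - ε) t)), s ≠ t :=
            ae_restrict_of_ae (Measure.ae_ne volume t)
          filter_upwards [ae_restrict_of_ae h.density, ae_restrict_mem measurableSet_Ioc, hne]
            with s hs hs0 hst
          have hst' : s < t := lt_of_le_of_ne hs0.2 hst
          have hs1 : 0 ≤ s := by linarith [hs0.1]
          have h1 := h.kernel.lintegral_gainE_le_sq (h.measurable_slice s).enorm x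
            (τ := t + q - s) (by linarith) (M := M)
            (by simpa only [shear_zero] using hs hs1 0 le_rfl)
            (hs hs1 (t + q - s) (by linarith))
          refine le_trans (le_of_eq ?_) (mul_le_mul_right h1 (ENNReal.ofReal δ)⁻¹)
          rw [← mul_assoc, ENNReal.inv_mul_cancel hd (by simp), one_mul]
          rfl
      _ = _ := by
          rw [setLIntegral_const, Real.volume_Ioc, sub_sub_cancel]

/-- An additional transport by `q ≥ 0` only increases the ages `t + q - s`, so the bounds for `q =
0` serve for every term of the supremum. -/
lemma normX_le (h : Sol B f b R₀ δ Φ M E) {T t ε : ℝ} (hT : 0 ≤ T) (hε : 0 < ε)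
    (hTt : T + ε ≤ t) {w : Phase → ℝ} (hw : Integrable w)
    (hgw : HasWeakDeriv (f T) (0, EuclideanSpace.single 0 1) w) :
    normX (f t) ≤ (ENNReal.ofReal (t - T))⁻¹ * (∫⁻ p, ‖w p‖ₑ) +
      ((ENNReal.ofReal (ε * R₀ * δ))⁻¹ * ENNReal.ofReal (4 * Real.pi) *
        (∫⁻ s in Ioi T, dissip B (fun p => ‖f s p‖ₑ)) + gainBound δ Φ M * ENNReal.ofReal ε) := by
  have hint : Integrable (f T) :=
    ⟨(h.measurable_slice T).aestronglyMeasurable, (h.lintegral_enorm_le hT).trans_lt h.E_lt⟩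
  refine iSup₂_le fun q hq => essSup_le_of_ae_le _ ?_
  have h1 := hgw.lintegral_shear_le (h.measurable_slice T) hint (h.nonneg hT) hw
    (q := t + q - T) (by linarith)
  have h2 := Measure.ae_ae_of_ae_prod (h.enorm_shear_le hT (show T ≤ t by linarith) q)
  filter_upwards [h1, h2] with x hx1 hx2
  have hm := h.measurable_slice T
  have hg := h.measurable_gainE (t := fun a : Vel × ℝ => a.2)
    (p := fun a => shear (t + q - a.2) (x, a.1)) (by fun_prop) (by fun_prop)
  calc ∫⁻ v : Vel, ‖transport q (f t) (x, v)‖ₑ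
      ≤ ∫⁻ v : Vel, (‖f T (shear (t + q - T) (x, v))‖ₑ +
          ∫⁻ s in Ioc T t, gainE B (fun p => ‖f s p‖ₑ) (shear (t + q - s) (x, v))) :=
        lintegral_mono_ae hx2
    _ = (∫⁻ v : Vel, ‖f T (shear (t + q - T) (x, v))‖ₑ) + ∫⁻ s in Ioc T t, ∫⁻ v : Vel,
          gainE B (fun p => ‖f s p‖ₑ) (shear (t + q - s) (x, v)) := by
        rw [lintegral_add_left (by fun_prop), lintegral_lintegral_swap]
        exact hg.aemeasurable
    _ ≤ _ := by
        refine add_le_add ?_ (h.lintegral_gainE_le hT hε hTt hq x)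
        have hpos : 0 < t - T := by linarith
        have hx3 := (mul_le_mul_left (ENNReal.ofReal_le_ofReal
          (show t - T ≤ t + q - T by linarith)) _).trans hx1
        refine le_trans (le_of_eq ?_) (mul_le_mul_right hx3 _)
        rw [← mul_assoc, ENNReal.inv_mul_cancel (ENNReal.ofReal_pos.2 hpos).ne' (by simp), one_mul]

end Sol

lemma exists_integrable_weakDeriv {g : Phase → ℝ} (hg : normW11 g < ⊤) :
    ∃ w, Integrable w ∧ HasWeakDeriv g (0, EuclideanSpace.single 0 1) w := by
  have h1 : weakDerivNorm (0, EuclideanSpace.single 0 1) g < ⊤ := by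
    refine lt_of_le_of_lt (le_trans ?_ le_add_self) hg
    exact Finset.single_le_sum (f := fun i : Fin 3 =>
      weakDerivNorm (0, EuclideanSpace.single i 1) g) (fun _ _ => bot_le) (Finset.mem_univ 0)
  simp only [weakDerivNorm, iInf_lt_iff] at h1
  obtain ⟨w, hw, hfin⟩ := h1
  exact ⟨w, ⟨hw.locallyIntegrable_deriv.aestronglyMeasurable, hfin⟩, hw⟩

lemma tendsto_setLIntegral_Ioi {d : ℝ → ℝ≥0∞} (hd : ∫⁻ s in Ioi 0, d s < ⊤) :
    Tendsto (fun n : ℕ => ∫⁻ s in Ioi (n : ℝ), d s) atTop (𝓝 0) := by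
  have h1 : Tendsto (fun n : ℕ => (volume.withDensity d) (Ioi (n : ℝ))) atTop
      (𝓝 ((volume.withDensity d) (⋂ n : ℕ, Ioi (n : ℝ)))) := by
    refine tendsto_measure_iInter_atTop (fun n => measurableSet_Ioi.nullMeasurableSet)
      (fun m n hmn => Ioi_subset_Ioi (by exact_mod_cast hmn)) ⟨0, ?_⟩
    rw [withDensity_apply _ measurableSet_Ioi]
    simpa using hd.ne
  have h2 : (⋂ n : ℕ, Ioi (n : ℝ)) = ∅ := by
    ext x
    simp only [mem_iInter, mem_Ioi, mem_empty_iff_false, iff_false, not_forall, not_lt]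
    exact exists_nat_ge x
  rw [h2, measure_empty] at h1
  simpa only [withDensity_apply _ measurableSet_Ioi] using h1

/-- The order of choices matters: first `ε`, which makes the recent gain small; then the starting
time `n`, since the constant in front of the remaining collisions grows as `ε → 0`; and `t` last,
because the derivative norm of `f n` is finite without any bound uniform in `n`. -/
lemma Sol.tendsto_normX {B : ℝ → ℝ → ℝ} {f : ℝ → Phase → ℝ} {b R₀ δ : ℝ} {Φ : ℝ → ℝ≥0∞}
    {M E : ℝ≥0∞} (h : Sol B f b R₀ δ Φ M E) (hW : ∀ t, 0 ≤ t → normW11 (f t) < ⊤) :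
    Tendsto (fun t => normX (f t)) atTop (𝓝 0) := by
  have hR := h.kernel.R_pos
  have hδ := h.kernel.delta_pos
  rw [ENNReal.tendsto_nhds_zero]
  intro κ hκ
  have hκ3 : 0 < κ / 3 := ENNReal.div_pos hκ.ne' (by simp)
  obtain ⟨ε, hε1, hε⟩ : ∃ ε : ℝ, gainBound δ Φ M * ENNReal.ofReal ε ≤ κ / 3 ∧ 0 < ε := by
    have h1 : Tendsto (fun ε : ℝ => gainBound δ Φ M * ENNReal.ofReal ε) (𝓝[>] 0) (𝓝 0) := by
      have := ENNReal.Tendsto.const_mul (a := gainBound δ Φ M)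
        ((ENNReal.tendsto_ofReal (tendsto_id (α := ℝ) (x := 𝓝 0))).mono_left
          (nhdsWithin_le_nhds (s := Ioi 0))) (Or.inr h.gainBound_lt_top.ne)
      simpa using this
    exact (((ENNReal.tendsto_nhds_zero.1 h1) _ hκ3).and self_mem_nhdsWithin).exists
  have hc : ENNReal.ofReal (ε * R₀ * δ) ≠ 0 := (ENNReal.ofReal_pos.2 (by positivity)).ne'
  obtain ⟨n, hn⟩ : ∃ n : ℕ, (ENNReal.ofReal (ε * R₀ * δ))⁻¹ * ENNReal.ofReal (4 * Real.pi) *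
        (∫⁻ s in Ioi (n : ℝ), dissip B (fun p => ‖f s p‖ₑ)) ≤ κ / 3 := by
    have h1 := ENNReal.Tendsto.const_mul
      (a := (ENNReal.ofReal (ε * R₀ * δ))⁻¹ * ENNReal.ofReal (4 * Real.pi))
      (tendsto_setLIntegral_Ioi h.lintegral_dissip_lt_top) (Or.inr (by finiteness))
    rw [mul_zero] at h1
    exact ((ENNReal.tendsto_nhds_zero.1 h1) _ hκ3).exists
  obtain ⟨w, hw, hgw⟩ := exists_integrable_weakDeriv (hW n n.cast_nonneg)
  have h2 : Tendsto (fun t : ℝ => (ENNReal.ofReal (t - n))⁻¹ * ∫⁻ p, ‖w p‖ₑ) atTop (𝓝 0) := by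
    have h3 : Tendsto (fun t : ℝ => (ENNReal.ofReal (t - n))⁻¹) atTop (𝓝 0) := by
      have h4 : Tendsto (fun t : ℝ => ENNReal.ofReal (t - n)) atTop (𝓝 ⊤) :=
        ENNReal.tendsto_ofReal_atTop.comp (tendsto_atTop_add_const_right _ (-(n : ℝ)) tendsto_id)
      simpa using h4.inv
    simpa using ENNReal.Tendsto.mul_const h3 (Or.inr hw.2.ne)
  filter_upwards [(ENNReal.tendsto_nhds_zero.1 h2) _ hκ3, eventually_ge_atTop (n + ε)] with t ht1 ht2
  refine (h.normX_le n.cast_nonneg hε ht2 hw hgw).trans ?_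
  refine (add_le_add ht1 (add_le_add hn hε1)).trans (le_of_eq ?_)
  rw [← add_assoc, ENNReal.add_thirds]

end Boltzmann1D

end

theorem mainTheorem5 (B : ℝ → ℝ → ℝ) (hB : Boltzmann1D.IsCollisionKernel B)
    (hH1 : Boltzmann1D.HypH1 B) (hH2 : Boltzmann1D.HypH2 B)
    (fin : Boltzmann1D.Phase → ℝ) (f : ℝ → Boltzmann1D.Phase → ℝ)
    (hf : Boltzmann1D.IsMildSolution B fin f)
    (hX : Boltzmann1D.BoundedInX f)
    (hW : Boltzmann1D.ContinuousIn Boltzmann1D.normW11 f)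
    (hL : Boltzmann1D.BoundedContinuousIn Boltzmann1D.normL12 f) :
    Tendsto (fun t => Boltzmann1D.normX (f t)) atTop (𝓝 0) := by
  obtain ⟨b, R₀, δ, Φ, M, E, h⟩ := Boltzmann1D.exists_sol hB hH1 hH2 hf hX hL
  exact h.tendsto_normX fun t ht => (hW.mem t ht).2
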